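/- Let $d\in\{2,3\}$, let $x_1,\dots,x_n\in\mathbb{R}^d$ ($n\ge 1$) be distinct points, let $f_1,\dots,f_n\in\mathbb{R}^d$ be arbitrary vectors (forces), $f=(f_1^T,\dots,f_n^T)^T\in\mathbb{R}^{nd}$, and let $\omega_0\neq 0$ be real. A network of springs and masses consists of finitely many nodes at distinct positions $p_v\in\mathbb{R}^d$, nonnegative spring constants $k_{vw}=k_{wv}$ between pairs of distinct nodes (there is a spring between $v$ and $w$ exactly when $k_{vw}>0$), and nonnegative node masses $m_v$. For displacements $u_v\in\mathbb{R}^d$ of the nodes and a real frequency $\omega$, the force at node $v$ is $$F_v(u)=\sum_{w\ne v}k_{vw}\,n_{vw}n_{vw}^T(u_v-u_w)-\omega^2m_vu_v,\qquad n_{vw}=\frac{p_w-p_v}{|p_w-p_v|}.$$ Some nodes are selected as terminals, the others are called interior. The frequency $\omega$ is a resonance frequency if for some displacements of the terminals no displacements of the interior nodes make the forces at all interior nodes vanish. Otherwise, the response matrix $W(\omega)$ is the matrix that maps the terminal displacements to the terminal forces when the forces at all interior nodes vanish. The network is planar if $d=2$, no spring (a straight segment) passes through a node other than its two ends, and two different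 springs meet at most in a common end. Then for every $\varepsilon>0$ and every finite set $S\subset\mathbb{R}^d$ there is a network of springs and masses with terminals $x_1,\dots,x_n$, which is planar if $d=2$, whose interior nodes lie at distance at most $\varepsilon$ from the convex hull of $x_1,\dots,x_n$ and outside $S$, and whose response matrix at every real $\omega$ with $\omega^2\ne\omega_0^2$ is $$W(\omega)=f f^T\,\frac{\omega^2}{\omega^2-\omega_0^2}.$$ In particular its static response $W(0)$ is zero. If $f\neq0$, its resonance frequencies are exactly $\pm\omega_0$; if $f=0$, it has none. Moreover, the network can be chosen so that exactly two of its nodes carry mass, both of them interior, and there is a nonzero $a=(a_1^T,a_2^T)^T\in\mathbb{R}^{2d}$ such that both masses equal $m=|a|^2/\omega_0^2$ and the static ($\omega=0$) response matrix of the same network, with the two massive nodes taken as additional terminals, is the rank-one matrix $\binom{f}{a}\binom{f}{a}^T$. -/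

import Mathlib

/-- A finite network of springs and point masses in `ℝ^d` with node set `V`: pairwise distinct node
positions, nonnegative spring constants (`stiffness v w = 0` means that there is no spring between
`v` and `w`), and nonnegative node masses. -/
structure SpringMassNetwork (d : ℕ) (V : Type) where
  pos : V → EuclideanSpace ℝ (Fin d)
  pos_injective : Function.Injective pos
  stiffness : V → V → ℝ
  stiffness_symm : ∀ v w, stiffness v w = stiffness w v
  stiffness_self : ∀ v, stiffness v v = 0
  stiffness_nonneg : ∀ v w, 0 ≤ stiffness v w
  mass : V → ℝ
  mass_nonneg : ∀ v, 0 ≤ mass v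

/-- The `T × d`-vector of the components of a `T`-indexed family of vectors of `ℝ^d`. -/
def stackedVec {d : ℕ} {T : Type} (u : T → EuclideanSpace ℝ (Fin d)) : T × Fin d → ℝ :=
  fun p => u p.1 p.2

/-- The matrix `f fᵀ`, where `f` is the stacked vector of the family `f i`. -/
def rankOneMatrix {d : ℕ} {T : Type} (f : T → EuclideanSpace ℝ (Fin d)) :
    Matrix (T × Fin d) (T × Fin d) ℝ :=
  Matrix.vecMulVec (stackedVec f) (stackedVec f)

namespace SpringMassNetwork

variable {d : ℕ} {V : Type}

/-- The unit vector pointing from node `v` to node `w`. -/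
noncomputable def dir (N : SpringMassNetwork d V) (v w : V) : EuclideanSpace ℝ (Fin d) :=
  ‖N.pos w - N.pos v‖⁻¹ • (N.pos w - N.pos v)

/-- There is a spring between `v` and `w`. -/
def HasSpring (N : SpringMassNetwork d V) (v w : V) : Prop :=
  0 < N.stiffness v w

/-- The `v`-block of `(K - ω² M) u`, with `K` the stiffness matrix and `M` the mass matrix of the
network: the external force needed at node `v` to sustain the displacements `u` at frequency `ω`.
By Hooke's law the spring between `v` and `w` contributes `k n nᵀ (u_v - u_w)` to `K u`. -/
noncomputable def nodeForce [Fintype V] (N : SpringMassNetwork d V) (ω : ℝ)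
    (u : V → EuclideanSpace ℝ (Fin d)) (v : V) : EuclideanSpace ℝ (Fin d) :=
  (∑ w, (N.stiffness v w * inner ℝ (N.dir v w) (u v - u w)) • N.dir v w)
    - (ω ^ 2 * N.mass v) • u v

/-- The displacements `u` extend the terminal displacements `uB` (the terminals are the nodes
`t i`), and the forces at all interior (that is, non-terminal) nodes are balanced: `u` is a critical
point of `u ↦ uᵀ (K - ω² M) u` with respect to the interior displacements. -/
def IsEquilibrium [Fintype V] (N : SpringMassNetwork d V) {T : Type} (t : T → V) (ω : ℝ)
    (uB : T → EuclideanSpace ℝ (Fin d)) (u : V → EuclideanSpace ℝ (Fin d)) : Prop :=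
  (∀ i, u (t i) = uB i) ∧ ∀ v, v ∉ Set.range t → N.nodeForce ω u v = 0

/-- `ω` is a resonance frequency: for some terminal displacements the forces at the interior nodes
cannot be balanced. -/
def IsResonance [Fintype V] (N : SpringMassNetwork d V) {T : Type} (t : T → V) (ω : ℝ) : Prop :=
  ∃ uB : T → EuclideanSpace ℝ (Fin d), ¬ ∃ u, N.IsEquilibrium t ω uB u

/-- `W` is the response matrix at frequency `ω` of the network with terminals `t i`: `ω` is not a
resonance frequency, and `W` maps the terminal displacements to the forces at the terminals. -/
def IsResponseAt [Fintype V] (N : SpringMassNetwork d V) {T : Type} [Fintype T] (t : T → V)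
    (ω : ℝ) (W : Matrix (T × Fin d) (T × Fin d) ℝ) : Prop :=
  ¬ N.IsResonance t ω ∧
    ∀ uB u, N.IsEquilibrium t ω uB u →
      stackedVec (fun i => N.nodeForce ω u (t i)) = W.mulVec (stackedVec uB)

/-- The springs do not cross: a spring passes through no node other than its two ends, and two
different springs have no point in common except possibly an end of both. -/
def NonCrossing (N : SpringMassNetwork d V) : Prop :=
  (∀ v w, N.HasSpring v w → ∀ z, N.pos z ∉ openSegment ℝ (N.pos v) (N.pos w)) ∧
    ∀ v w v' w', N.HasSpring v w → N.HasSpring v' w' → s(v, w) ≠ s(v', w') →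
      Disjoint (openSegment ℝ (N.pos v) (N.pos w)) (openSegment ℝ (N.pos v') (N.pos w'))

end SpringMassNetwork

/-! Statics comes first. A bar between `p` and `q` can exert exactly the multiples of `barLoad p q`,
so the loads that a framework withstands form the span `supportable B`. Put springs of positive
stiffness along the bars. The equilibria with force-free interior nodes then produce exactly the
supportable loads that live on the terminals. If these form a line spanned by `F`, the static
response is a symmetric positive semidefinite matrix with that range, so a common rescaling of the
stiffnesses turns it into `F Fᵀ` (`exists_rankOne_response`, `exists_barNetwork_response`). What
remains is geometry: find bars whose loads on the terminals are exactly the multiples of `F = (f,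
a)`.

Such an `F` has zero resultant and zero torque. In dimension two or three every torque is a single
wedge product, so arbitrary forces `f` are balanced by forces `a` at two further points
(`exists_balancing_pair`). A balanced load is realized by removing one terminal at a time
(`realizes_of_transfer`): the force at `q` is carried along its line of action to a new node `y` and
is split there among bars to `d - 1` fixed terminals `w j` and to a node `z'`, to which the force at
`z` has been carried likewise. Balance at `y` and `z'` locks the tensions of all these bars to the
single parameter of the reduced load. The genericity needed is open or fails for finitely many
parameters, so the induction `realizable_of_frame` runs down to two opposite forces on a line (`d =
2`) or three forces in a plane (`d = 3`, `realizable_triangle`).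

For `d = 2` crossings are removed without changing the supportable loads on the old nodes. Each bar
is first replaced by the other five bars of a generic quadrilateral having it as one of its six bars
(`supportable_lens_inf`), which gives general position. Then each crossing point becomes a node.
This is harmless because the tensions along the two independent directions must balance separately
there (`InGeneralPosition.exists_uncross`).

Finally the two extra terminals become interior nodes of mass `m`. With `c = f·u + a·y`, where `y`
are the displacements of the masses, the terminal forces are `c f` and the masses obey `c a = ω² m
y`. Pairing with `a` and using `m = |a|²/ω₀²` gives `c (ω² - ω₀²) = ω² f·u`, which is the asserted
response and shows where the resonances are. -/

open Finsupp in
/-- The pair of opposite forces that a bar between `p` and `q` exerts on its ends. -/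
noncomputable def barLoad {E : Type} [AddCommGroup E] (p q : E) : E →₀ E :=
  single p (p - q) - single q (p - q)

/-! ### Loads, bars and balance. -/

section Loads

variable {E : Type} [AddCommGroup E]

theorem barLoad_comm (p q : E) : barLoad p q = barLoad q p := by
  unfold barLoad
  rw [← neg_sub q p, Finsupp.single_neg, Finsupp.single_neg]
  abel

theorem barLoad_apply_left {p q : E} (h : p ≠ q) : barLoad p q p = p - q := by
  simp [barLoad, h]

theorem barLoad_apply_right {p q : E} (h : p ≠ q) : barLoad p q q = q - p := by
  simp [barLoad, h.symm]

theorem barLoad_apply_of_ne {p q r : E} (h1 : r ≠ p) (h2 : r ≠ q) : barLoad p q r = 0 := by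
  simp [barLoad, h1, h2]

/-- `barLoad` as a function of the unordered pair of the ends of the bar. -/
noncomputable def edgeLoad : Sym2 E → E →₀ E :=
  Sym2.lift ⟨barLoad, barLoad_comm⟩

@[simp] theorem edgeLoad_mk (p q : E) : edgeLoad s(p, q) = barLoad p q := rfl

theorem edgeLoad_apply_of_notMem {e : Sym2 E} {p : E} (h : p ∉ e) : edgeLoad e p = 0 := by
  induction e with
  | _ a b =>
    simp only [Sym2.mem_iff, not_or] at h
    exact barLoad_apply_of_ne h.1 h.2

variable [Module ℝ E]

/-- The loads that the bars in `B` can support. -/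
noncomputable def supportable (B : Set (Sym2 E)) : Submodule ℝ (E →₀ E) :=
  Submodule.span ℝ (edgeLoad '' B)

theorem supportable_union (A B : Set (Sym2 E)) :
    supportable (A ∪ B) = supportable A ⊔ supportable B := by
  simp [supportable, Set.image_union, Submodule.span_union]

theorem supportable_mono {A B : Set (Sym2 E)} (h : A ⊆ B) : supportable A ≤ supportable B :=
  Submodule.span_mono (Set.image_mono h)

theorem edgeLoad_mem_supportable {B : Set (Sym2 E)} {e : Sym2 E} (h : e ∈ B) :
    edgeLoad e ∈ supportable B :=
  Submodule.subset_span ⟨e, h, rfl⟩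

theorem barLoad_mem_supportable {B : Set (Sym2 E)} {p q : E} (h : s(p, q) ∈ B) :
    barLoad p q ∈ supportable B :=
  edgeLoad_mem_supportable h

theorem supportable_singleton (p q : E) :
    supportable {s(p, q)} = Submodule.span ℝ {barLoad p q} := by
  simp [supportable]

theorem supportable_le_supported {B : Set (Sym2 E)} {X : Set E} (h : ∀ e ∈ B, ∀ p ∈ e, p ∈ X) :
    supportable B ≤ Finsupp.supported E ℝ X := by
  refine Submodule.span_le.2 ?_
  rintro _ ⟨e, he, rfl⟩
  rw [SetLike.mem_coe, Finsupp.mem_supported']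
  exact fun p hp => edgeLoad_apply_of_notMem fun hpe => hp (h e he p hpe)

theorem apply_eq_zero_of_mem_supportable {B : Set (Sym2 E)} {ρ : E →₀ E} (hρ : ρ ∈ supportable B)
    {p : E} (hp : ∀ e ∈ B, p ∉ e) : ρ p = 0 := by
  have h : supportable B ≤ Finsupp.supported E ℝ {p}ᶜ :=
    supportable_le_supported fun e he r hr => by
      rintro rfl
      exact hp e he hr
  exact (Finsupp.mem_supported' ℝ ρ).1 (h hρ) p (by simp)

/-- The sum of the forces of a load. -/
noncomputable def resultant : (E →₀ E) →ₗ[ℝ] E :=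
  Finsupp.lsum ℝ fun _ => LinearMap.id

/-- The component of the torque of a load given by a pair of linear functionals. -/
noncomputable def moment (φ ψ : E →ₗ[ℝ] ℝ) : (E →₀ E) →ₗ[ℝ] ℝ :=
  Finsupp.lsum ℝ fun p => ψ p • φ - φ p • ψ

@[simp] theorem resultant_single (p g : E) : resultant (Finsupp.single p g) = g := by
  simp [resultant]

@[simp] theorem moment_single (φ ψ : E →ₗ[ℝ] ℝ) (p g : E) :
    moment φ ψ (Finsupp.single p g) = ψ p * φ g - φ p * ψ g := by
  simp [moment]

/-- The load `F` has zero resultant force and zero torque. -/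
def IsBalanced (F : E →₀ E) : Prop :=
  resultant F = 0 ∧ ∀ φ ψ : E →ₗ[ℝ] ℝ, moment φ ψ F = 0

theorem IsBalanced.add {F G : E →₀ E} (hF : IsBalanced F) (hG : IsBalanced G) :
    IsBalanced (F + G) := by
  refine ⟨by rw [map_add, hF.1, hG.1, add_zero], fun φ ψ => ?_⟩
  rw [map_add, hF.2, hG.2, add_zero]

theorem IsBalanced.smul {F : E →₀ E} (hF : IsBalanced F) (c : ℝ) : IsBalanced (c • F) := by
  refine ⟨by rw [map_smul, hF.1, smul_zero], fun φ ψ => ?_⟩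
  rw [map_smul, hF.2, smul_zero]

theorem isBalanced_zero : IsBalanced (0 : E →₀ E) := ⟨by simp, by simp⟩

theorem IsBalanced.sum {ι : Type} (s : Finset ι) {F : ι → E →₀ E} (h : ∀ i ∈ s, IsBalanced (F i)) :
    IsBalanced (∑ i ∈ s, F i) :=
  Finset.sum_induction F IsBalanced (fun _ _ => IsBalanced.add) isBalanced_zero h

theorem isBalanced_barLoad (p q : E) : IsBalanced (barLoad p q) := by
  refine ⟨by simp [barLoad], fun φ ψ => ?_⟩
  simp only [barLoad, map_sub, moment_single]
  ring

end Loads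

/-! ### Frameworks that support a single load. -/

section Realizable

variable {E : Type} [AddCommGroup E] [Module ℝ E]

/-- The finitely many bars in `B` have their ends in `U`, the ends outside the set `X` of terminals
avoid `S`, and the loads on the terminals supported by the bars are exactly the multiples of
`F`. -/
structure Realizes (U S X : Set E) (F : E →₀ E) (B : Set (Sym2 E)) : Prop where
  finite : B.Finite
  not_isDiag : ∀ e ∈ B, ¬ e.IsDiag
  mem_region : ∀ e ∈ B, ∀ p ∈ e, p ∈ U
  notMem_of_notMem : ∀ e ∈ B, ∀ p ∈ e, p ∉ X → p ∉ S
  supportable_inf : supportable B ⊓ Finsupp.supported E ℝ X = Submodule.span ℝ {F}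

/-- The load `F` can be realized with interior nodes avoiding any given finite set. -/
def Realizable (U X : Set E) (F : E →₀ E) : Prop :=
  ∀ S : Set E, S.Finite → ∃ B : Set (Sym2 E), Realizes U S X F B

theorem realizable_barLoad {U X : Set E} {p q : E} (hpq : p ≠ q) (hp : p ∈ U) (hq : q ∈ U)
    (hpX : p ∈ X) (hqX : q ∈ X) {c : ℝ} (hc : c ≠ 0) : Realizable U X (c • barLoad p q) := by
  intro S _
  refine ⟨{s(p, q)}, Set.finite_singleton _, by simpa using hpq, ?_, ?_, ?_⟩
  · rintro e rfl r hr
    rcases Sym2.mem_iff.1 hr with rfl | rfl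
    · exact hp
    · exact hq
  · rintro e rfl r hr h
    rcases Sym2.mem_iff.1 hr with rfl | rfl
    · exact absurd hpX h
    · exact absurd hqX h
  · rw [inf_eq_left.2]
    · rw [supportable_singleton, Submodule.span_singleton_smul_eq hc.isUnit]
    · refine supportable_le_supported ?_
      rintro e rfl r hr
      rcases Sym2.mem_iff.1 hr with rfl | rfl <;> assumption

end Realizable

/-! ### Removing one terminal by carrying forces along their lines of action. -/

section Transfer

variable {E : Type} [AddCommGroup E] [Module ℝ E]

theorem Realizes.apply_eq_zero {U S X : Set E} {F ρ : E →₀ E} {B : Set (Sym2 E)}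
    (h : Realizes U S X F B) (hρ : ρ ∈ supportable B) {p : E} (hpX : p ∉ X) (hpS : p ∈ S) :
    ρ p = 0 :=
  apply_eq_zero_of_mem_supportable hρ fun e he hp => h.notMem_of_notMem e he p hp hpX hpS

/-- The load that is left at the other nodes when the force at `q` is passed through a node `y` on
its line of action to nodes `z'` and `w j`, and the force at `z` is moved to `z'`. -/
noncomputable def transferredLoad {ι : Type} [Fintype ι] (F : E →₀ E) (q z y z' : E) (w : ι → E)
    (δ δ' α₀ : ℝ) (α : ι → ℝ) : E →₀ E :=
  F + δ'⁻¹ • barLoad z z' + δ⁻¹ • barLoad q y - α₀ • barLoad y z' - ∑ j, α j • barLoad y (w j)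

variable {ι : Type} [Fintype ι] {F : E →₀ E} {q z y z' : E} {w : ι → E} {δ δ' α₀ : ℝ} {α : ι → ℝ}

theorem isBalanced_transferredLoad (hF : IsBalanced F) :
    IsBalanced (transferredLoad F q z y z' w δ δ' α₀ α) := by
  unfold transferredLoad
  simp only [sub_eq_add_neg, ← neg_smul, ← Finset.sum_neg_distrib]
  refine (((hF.add ?_).add ?_).add ?_).add (IsBalanced.sum _ fun j _ => ?_) <;>
    exact (isBalanced_barLoad _ _).smul _

theorem transferredLoad_apply_of_ne {p : E} (hq : p ≠ q) (hz : p ≠ z) (hy : p ≠ y) (hz' : p ≠ z')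
    (hw : ∀ j, p ≠ w j) : transferredLoad F q z y z' w δ δ' α₀ α p = F p := by
  simp [transferredLoad, barLoad_apply_of_ne, hq, hz, hy, hz', hw]

theorem transferredLoad_apply_fst (hqz : q ≠ z) (hqy : q ≠ y) (hqz' : q ≠ z') (hw : ∀ j, q ≠ w j)
    (hδ : δ ≠ 0) (hy : y = q + δ • F q) : transferredLoad F q z y z' w δ δ' α₀ α q = 0 := by
  simp only [transferredLoad, Finsupp.sub_apply, Finsupp.add_apply, Finsupp.smul_apply,
    Finsupp.finsetSum_apply, barLoad_apply_left hqy, barLoad_apply_of_ne hqz hqz',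
    barLoad_apply_of_ne hqy hqz', barLoad_apply_of_ne hqy (hw _)]
  rw [show q - y = -(δ • F q) by rw [hy]; abel, smul_neg, smul_smul, inv_mul_cancel₀ hδ]
  simp

theorem transferredLoad_apply_snd (hqz : z ≠ q) (hzy : z ≠ y) (hzz' : z ≠ z') (hw : ∀ j, z ≠ w j)
    (hδ : δ' ≠ 0) (hz' : z' = z + δ' • F z) : transferredLoad F q z y z' w δ δ' α₀ α z = 0 := by
  simp only [transferredLoad, Finsupp.sub_apply, Finsupp.add_apply, Finsupp.smul_apply,
    Finsupp.finsetSum_apply, barLoad_apply_left hzz', barLoad_apply_of_ne hqz hzy,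
    barLoad_apply_of_ne hzy hzz', barLoad_apply_of_ne hzy (hw _)]
  rw [show z - z' = -(δ' • F z) by rw [hz']; abel, smul_neg, smul_smul, inv_mul_cancel₀ hδ]
  simp

theorem transferredLoad_apply_target (hqz' : z' ≠ q) (hzz' : z ≠ z') (hyz' : y ≠ z')
    (hw : ∀ j, z' ≠ w j) (hδ : δ' ≠ 0) (hz' : z' = z + δ' • F z) (hF : F z' = 0) :
    transferredLoad F q z y z' w δ δ' α₀ α z' = F z + α₀ • (y - z') := by
  simp only [transferredLoad, Finsupp.sub_apply, Finsupp.add_apply, Finsupp.smul_apply,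
    Finsupp.finsetSum_apply, barLoad_apply_right hzz', barLoad_apply_of_ne hqz' hyz'.symm,
    barLoad_apply_right hyz', barLoad_apply_of_ne hyz'.symm (hw _)]
  rw [show z' - z = δ' • F z by rw [hz']; abel, smul_smul, inv_mul_cancel₀ hδ, hF]
  simp only [zero_add, smul_zero, Finset.sum_const_zero, sub_zero, add_zero]
  module

theorem transferredLoad_apply_via (hyq : q ≠ y) (hyz : y ≠ z) (hyz' : y ≠ z') (hw : ∀ j, y ≠ w j)
    (hδ : δ ≠ 0) (hy : y = q + δ • F q) (hF : F y = 0)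
    (hα : F q = α₀ • (y - z') + ∑ j, α j • (y - w j)) :
    transferredLoad F q z y z' w δ δ' α₀ α y = 0 := by
  simp only [transferredLoad, Finsupp.sub_apply, Finsupp.add_apply, Finsupp.smul_apply,
    Finsupp.finsetSum_apply, barLoad_apply_right hyq, barLoad_apply_of_ne hyz hyz',
    barLoad_apply_left hyz', barLoad_apply_left (hw _)]
  rw [show y - q = δ • F q by nth_rw 1 [hy]; abel, smul_smul, inv_mul_cancel₀ hδ, hF, hα]
  simp

/-- The force at `z` has to be moved to a new node `z'`: at the terminal `z` itself nothing would
relate the tension of the bar from `y` to the reduced load, whereas balance at the interior node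
`z'` does. Then `hα₀` lets this tension determine the one in the arm from `q`, and no freedom beyond
one scalar is left. -/
theorem realizes_of_transfer {U S X : Set E} (hXU : X ⊆ U) (hFX : F ∈ Finsupp.supported E ℝ X)
    (hqX : q ∈ X) (hzX : z ∈ X) (hqz : q ≠ z) (hwX : ∀ j, w j ∈ X) (hwq : ∀ j, q ≠ w j)
    (hwz : ∀ j, z ≠ w j) (hyX : y ∉ X) (hz'X : z' ∉ X) (hyz' : y ≠ z') (hyU : y ∈ U) (hz'U : z' ∈ U)
    (hyS : y ∉ S) (hz'S : z' ∉ S) (hδ : δ ≠ 0) (hδ' : δ' ≠ 0) (hy : y = q + δ • F q)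
    (hz' : z' = z + δ' • F z)
    (hα : F q = α₀ • (y - z') + ∑ j, α j • (y - w j)) (hα₀ : α₀ ≠ 0)
    (hli : ∀ (t₀ : ℝ) (t : ι → ℝ), t₀ • (y - z') + ∑ j, t j • (y - w j) = 0 →
      t₀ = 0 ∧ ∀ j, t j = 0)
    (hpar : ∀ a b : ℝ, a • F z + b • (y - z') = 0 → a = 0 ∧ b = 0)
    {B : Set (Sym2 E)}
    (hB : Realizes U (S ∪ X ∪ {y}) (insert z' (X \ {q, z}))
      (transferredLoad F q z y z' w δ δ' α₀ α) B) :
    Realizes U S X F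
      (B ∪ ({s(q, y)} ∪ ({s(z, z')} ∪ ({s(y, z')} ∪ Set.range fun j => s(y, w j))))) := by
  have hqy : q ≠ y := by rintro rfl; exact hyX hqX
  have hqz' : q ≠ z' := by rintro rfl; exact hz'X hqX
  have hzy : z ≠ y := by rintro rfl; exact hyX hzX
  have hzz' : z ≠ z' := by rintro rfl; exact hz'X hzX
  have hyw : ∀ j, y ≠ w j := by rintro j rfl; exact hyX (hwX j)
  have hz'w : ∀ j, z' ≠ w j := by rintro j rfl; exact hz'X (hwX j)
  have hF0 : ∀ p, p ∉ X → F p = 0 := (Finsupp.mem_supported' ℝ F).1 hFX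
  have hmem : ∀ e ∈ B ∪ ({s(q, y)} ∪ ({s(z, z')} ∪ ({s(y, z')} ∪ Set.range fun j => s(y, w j)))),
      ∀ p ∈ e, (∃ e ∈ B, p ∈ e) ∨ p ∈ X ∨ p = y ∨ p = z' := by
    intro e he p hp
    simp only [Set.mem_union, Set.mem_singleton_iff, Set.mem_range] at he
    rcases he with he | rfl | rfl | rfl | ⟨j, rfl⟩
    · exact Or.inl ⟨e, he, hp⟩
    all_goals
      rcases Sym2.mem_iff.1 hp with rfl | rfl <;> simp [hqX, hzX, hwX]
  refine ⟨?_, ?_, ?_, ?_, ?_⟩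
  · exact hB.finite.union ((Set.finite_singleton _).union ((Set.finite_singleton _).union
      ((Set.finite_singleton _).union (Set.finite_range _))))
  · intro e he
    simp only [Set.mem_union, Set.mem_singleton_iff, Set.mem_range] at he
    rcases he with he | rfl | rfl | rfl | ⟨j, rfl⟩
    · exact hB.not_isDiag e he
    all_goals simp [hqy, hzz', hyz', hyw]
  · intro e he p hp
    rcases hmem e he p hp with ⟨e', he', hp'⟩ | h | rfl | rfl
    · exact hB.mem_region e' he' p hp'
    · exact hXU h
    · exact hyU
    · exact hz'U
  · intro e he p hp hpX
    rcases hmem e he p hp with ⟨e', he', hp'⟩ | h | rfl | rfl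
    · by_cases h : p = z'
      · rwa [h]
      · intro hpS
        exact hB.notMem_of_notMem e' he' p hp' (by simp [h, hpX]) (by simp [hpS])
    · exact absurd h hpX
    · exact hyS
    · exact hz'S
  have hsup : supportable (B ∪ ({s(q, y)} ∪ ({s(z, z')} ∪ ({s(y, z')} ∪
      Set.range fun j => s(y, w j))))) = supportable B ⊔ (Submodule.span ℝ {barLoad q y} ⊔
        (Submodule.span ℝ {barLoad z z'} ⊔ (Submodule.span ℝ {barLoad y z'} ⊔
          Submodule.span ℝ (Set.range fun j => barLoad y (w j))))) := by
    simp only [supportable_union, supportable_singleton]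
    congr 4
    simp only [supportable, ← Set.range_comp]
    rfl
  set F' := transferredLoad F q z y z' w δ δ' α₀ α with hF'
  have hF'y : F' y = 0 :=
    transferredLoad_apply_via hqy hzy.symm hyz' hyw hδ hy (hF0 y hyX) hα
  have hF'z' : F' z' = F z + α₀ • (y - z') :=
    transferredLoad_apply_target hqz'.symm hzz' hyz' hz'w hδ' hz' (hF0 z' hz'X)
  apply le_antisymm
  · rintro ρ ⟨hρ, hρX⟩
    have hρ0 : ∀ p, p ∉ X → ρ p = 0 := (Finsupp.mem_supported' ℝ ρ).1 hρX
    rw [SetLike.mem_coe, hsup] at hρ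
    obtain ⟨ρ', hρ', s₁, hs₁, rfl⟩ := Submodule.mem_sup.1 hρ
    obtain ⟨r₁, hr₁, s₂, hs₂, rfl⟩ := Submodule.mem_sup.1 hs₁
    obtain ⟨r₂, hr₂, s₃, hs₃, rfl⟩ := Submodule.mem_sup.1 hs₂
    obtain ⟨r₃, hr₃, r, hr, rfl⟩ := Submodule.mem_sup.1 hs₃
    obtain ⟨a, rfl⟩ := Submodule.mem_span_singleton.1 hr₁
    obtain ⟨b, rfl⟩ := Submodule.mem_span_singleton.1 hr₂
    obtain ⟨t₀, rfl⟩ := Submodule.mem_span_singleton.1 hr₃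
    obtain ⟨t, rfl⟩ := (Submodule.mem_span_range_iff_exists_fun ℝ).1 hr
    -- Away from its own terminals `B` avoids `S ∪ X ∪ {y}`, so `ρ'` vanishes at `q`, `z` and `y`.
    -- At the remaining points outside `X` other than `z'` no added bar ends, and `ρ'` agrees there
    -- with the whole load.
    have hρ'X : ρ' ∈ Finsupp.supported E ℝ (insert z' (X \ {q, z})) := by
      rw [Finsupp.mem_supported']
      intro p hp
      by_cases hpS : p ∈ S ∪ X ∪ {y}
      · exact hB.apply_eq_zero hρ' hp hpS
      · simp only [Set.mem_union, Set.mem_singleton_iff, not_or] at hpS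
        have h := hρ0 p hpS.1.2
        have hpz' : p ≠ z' := by rintro rfl; exact hp (by simp)
        have hpq : p ≠ q := by rintro rfl; exact hpS.1.2 hqX
        have hpz : p ≠ z := by rintro rfl; exact hpS.1.2 hzX
        have hpw : ∀ j, p ≠ w j := by rintro j rfl; exact hpS.1.2 (hwX j)
        simpa [Finsupp.finsetSum_apply, barLoad_apply_of_ne, hpq, hpS.2, hpz, hpz', hpw] using h
    have hc : ρ' ∈ Submodule.span ℝ {F'} := by
      rw [← hB.supportable_inf]
      exact ⟨hρ', hρ'X⟩
    obtain ⟨c, rfl⟩ := Submodule.mem_span_singleton.1 hc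
    have ey := hρ0 y hyX
    simp only [Finsupp.add_apply, Finsupp.smul_apply, Finsupp.finsetSum_apply, hF'y,
      barLoad_apply_right hqy, barLoad_apply_of_ne hzy.symm hyz', barLoad_apply_left hyz',
      barLoad_apply_left (hyw _)] at ey
    rw [show y - q = δ • F q by nth_rw 1 [hy]; abel] at ey
    -- Balance at `y`: by independence of the directions, the tension `a` of the arm fixes the
    -- tensions of all bars leaving `y`.
    have e1 := hli (a * δ * α₀ + t₀) (fun j => a * δ * α j + t j) (by
      simp only [add_smul, Finset.sum_add_distrib, mul_smul, ← Finset.smul_sum]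
      have h : (a * δ) • F q = (a * δ) • (α₀ • (y - z') + ∑ j, α j • (y - w j)) := by rw [← hα]
      simp only [mul_smul, smul_add] at h
      simp only [smul_zero, zero_add] at ey
      linear_combination (norm := module) ey - h)
    have ez := hρ0 z' hz'X
    simp only [Finsupp.add_apply, Finsupp.smul_apply, Finsupp.finsetSum_apply, hF'z',
      barLoad_apply_of_ne hqz'.symm hyz'.symm, barLoad_apply_right hzz', barLoad_apply_right hyz',
      barLoad_apply_of_ne hyz'.symm (hz'w _)] at ez
    rw [show z' - z = δ' • F z by nth_rw 1 [hz']; abel] at ez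
    -- Balance at `z'`: since `F z` and `y - z'` are independent, `c` fixes both `b` and `t₀`.
    have e2 := hpar (c + b * δ') (c * α₀ - t₀) (by
      simp only [smul_zero, Finset.sum_const_zero, add_zero, zero_add] at ez
      linear_combination (norm := module) ez)
    have ht₀ : t₀ = c * α₀ := by linarith [e2.2]
    have ha : a = -(c * δ⁻¹) := by
      have h : (c + a * δ) * α₀ = 0 := by linarith [e1.1]
      have := (mul_eq_zero.1 h).resolve_right hα₀
      field_simp
      linarith
    have hb : b = -(c * δ'⁻¹) := by
      field_simp
      linarith [e2.1]
    have ht : t = fun j => c * α j := by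
      funext j
      have := e1.2 j
      rw [ha] at this
      field_simp at this
      linarith
    rw [Submodule.mem_span_singleton]
    refine ⟨c, ?_⟩
    rw [ht₀, ha, hb, ht, hF', transferredLoad]
    simp only [mul_smul, ← Finset.smul_sum]
    module
  · rw [Submodule.span_singleton_le_iff_mem]
    refine ⟨?_, hFX⟩
    rw [SetLike.mem_coe]
    have hF'B : F' ∈ supportable B := by
      have h : F' ∈ supportable B ⊓ Finsupp.supported E ℝ (insert z' (X \ {q, z})) := by
        rw [hB.supportable_inf]
        exact Submodule.mem_span_singleton_self F'
      exact h.1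
    have h : F = F' + (-δ⁻¹) • barLoad q y + (-δ'⁻¹) • barLoad z z' + α₀ • barLoad y z' +
        ∑ j, α j • barLoad y (w j) := by
      rw [hF', transferredLoad]
      module
    rw [h]
    refine add_mem (add_mem (add_mem (add_mem ?_ ?_) ?_) ?_) (sum_mem fun j _ => ?_)
    · exact supportable_mono Set.subset_union_left hF'B
    · exact Submodule.smul_mem _ _ (barLoad_mem_supportable (by simp))
    · exact Submodule.smul_mem _ _ (barLoad_mem_supportable (by simp))
    · exact Submodule.smul_mem _ _ (barLoad_mem_supportable (by simp))
    · exact Submodule.smul_mem _ _ (barLoad_mem_supportable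
        (Or.inr (Or.inr (Or.inr (Or.inr ⟨j, rfl⟩)))))

end Transfer

/-! ### Induction on the number of terminals. -/

section Chain

open Filter Topology

theorem eventually_notMem_of_finite {α : Type*} [TopologicalSpace α] [T1Space α] {s : Set α}
    (hs : s.Finite) (a : α) : ∀ᶠ x in 𝓝[≠] a, x ∉ s := by
  have h : ∀ᶠ x in 𝓝 a, x ∈ (s \ {a})ᶜ :=
    (hs.subset Set.sdiff_subset).isClosed.isOpen_compl.mem_nhds (by simp)
  filter_upwards [h.filter_mono nhdsWithin_le_nhds, self_mem_nhdsWithin] with x hx hxa hxs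
  exact hx ⟨hxs, hxa⟩

theorem tendsto_add_smul_nhds {E : Type} [NormedAddCommGroup E] [NormedSpace ℝ E] (q f : E) :
    Tendsto (fun δ : ℝ => q + δ • f) (𝓝[≠] 0) (𝓝 q) := by
  have h : Continuous fun δ : ℝ => q + δ • f := by fun_prop
  have := h.tendsto 0
  simp only [zero_smul, add_zero] at this
  exact this.mono_left nhdsWithin_le_nhds

variable {E : Type} [NormedAddCommGroup E] [NormedSpace ℝ E] [FiniteDimensional ℝ E]
  {ι : Type} [Fintype ι]

/-- In the moving frame of `f` and the vectors `q + δ • f - w j`, the `f`-coordinate `κ` of `q + δ •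
f - z` is affine in `δ`. It vanishes identically only if `z` lies in the affine span of the `w j`,
so at most one `δ` is bad; for `κ ≠ 0` one solves for `f`. Likewise two values of `δ` with `q + δ •
f - z` parallel to `g` would make `g` parallel to `f` and put `z` on the line of action of `f`. -/
theorem eventually_transfer_conditions (hcard : Fintype.card ι + 1 = Module.finrank ℝ E)
    {q f z g : E} {w : ι → E}
    (hw : LinearIndependent ℝ fun o : Option ι => o.elim f fun j => q - w j)
    (hz : z ∉ affineSpan ℝ (Set.range w)) (hzq : z - q ∉ Submodule.span ℝ {f}) (hg : g ≠ 0) :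
    ∀ᶠ δ : ℝ in 𝓝[≠] 0, ∃ (α₀ : ℝ) (α : ι → ℝ),
      f = α₀ • (q + δ • f - z) + ∑ j, α j • (q + δ • f - w j) ∧ α₀ ≠ 0 ∧
      (∀ (t₀ : ℝ) (t : ι → ℝ), t₀ • (q + δ • f - z) + ∑ j, t j • (q + δ • f - w j) = 0 →
        t₀ = 0 ∧ ∀ j, t j = 0) ∧
      ∀ a b : ℝ, a • g + b • (q + δ • f - z) = 0 → a = 0 ∧ b = 0 := by
  have hf : f ≠ 0 := hw.ne_zero none
  have hspan : Submodule.span ℝ (Set.range fun o : Option ι => o.elim f fun j => q - w j) = ⊤ :=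
    hw.span_eq_top_of_card_eq_finrank' (by simpa using hcard)
  obtain ⟨c, hc⟩ := (Submodule.mem_span_range_iff_exists_fun ℝ).1
    (hspan ▸ Submodule.mem_top : q - z ∈ Submodule.span ℝ _)
  rw [Fintype.sum_option] at hc
  simp only [Option.elim_none, Option.elim_some] at hc
  set μ := c none with hμ
  set ν : ι → ℝ := fun j => c (some j) with hν
  have key : ∀ δ : ℝ, q + δ • f - z =
      (μ + δ * (1 - ∑ j, ν j)) • f + ∑ j, ν j • (q + δ • f - w j) := by
    intro δ
    have h : ∑ j, ν j • (q + δ • f - w j) = ∑ j, ν j • (q - w j) + (∑ j, ν j) • (δ • f) := by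
      rw [Finset.sum_smul, ← Finset.sum_add_distrib]
      exact Finset.sum_congr rfl fun j _ => by module
    rw [h]
    linear_combination (norm := module) -hc
  have hκ : ({δ : ℝ | μ + δ * (1 - ∑ j, ν j) = 0}).Finite := by
    apply Set.Subsingleton.finite
    intro δ₁ h₁ δ₂ h₂
    simp only [Set.mem_ofPred_eq] at h₁ h₂
    by_contra hne
    have hs : 1 - ∑ j, ν j = 0 := by
      have h : (δ₁ - δ₂) * (1 - ∑ j, ν j) = 0 := by linarith
      exact (mul_eq_zero.1 h).resolve_left (sub_ne_zero.2 hne)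
    have hμ0 : μ = 0 := by rw [hs] at h₁; linarith
    have hsum : ∑ j, ν j = 1 := by linarith
    apply hz
    have hz' : z = Finset.univ.affineCombination ℝ w ν := by
      rw [Finset.affineCombination_eq_linear_combination _ _ _ hsum]
      have h := key 0
      simp only [hμ0, zero_smul, add_zero, zero_mul, zero_add, smul_sub,
        Finset.sum_sub_distrib, ← Finset.sum_smul, hsum, one_smul] at h
      exact sub_right_injective h
    rw [hz']
    exact affineCombination_mem_affineSpan hsum w
  have hpar : ({δ : ℝ | ∃ s : ℝ, q + δ • f - z = s • g}).Finite := by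
    apply Set.Subsingleton.finite
    rintro δ₁ ⟨s₁, h₁⟩ δ₂ ⟨s₂, h₂⟩
    by_contra hne
    have h : (δ₁ - δ₂) • f = (s₁ - s₂) • g := by
      linear_combination (norm := module) h₁ - h₂
    have hs : s₁ - s₂ ≠ 0 := by
      intro h0
      rw [h0, zero_smul, smul_eq_zero] at h
      exact h.elim (sub_ne_zero.2 hne) hf
    apply hzq
    rw [Submodule.mem_span_singleton]
    refine ⟨δ₁ - s₁ * ((s₁ - s₂)⁻¹ * (δ₁ - δ₂)), ?_⟩
    have hg' : g = ((s₁ - s₂)⁻¹ * (δ₁ - δ₂)) • f := by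
      rw [mul_smul, h, smul_smul, inv_mul_cancel₀ hs, one_smul]
    have h₁' : q + δ₁ • f - z = s₁ • ((s₁ - s₂)⁻¹ * (δ₁ - δ₂)) • f := by rw [← hg', h₁]
    linear_combination (norm := module) h₁'
  filter_upwards [eventually_notMem_of_finite hκ 0, eventually_notMem_of_finite hpar 0]
    with δ h₁ h₂
  simp only [not_exists] at h₁ h₂
  set κ := μ + δ * (1 - ∑ j, ν j) with hκdef
  have hk := key δ
  refine ⟨κ⁻¹, fun j => -(κ⁻¹ * ν j), ?_, inv_ne_zero h₁, ?_, ?_⟩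
  · rw [hk, smul_add, smul_smul, inv_mul_cancel₀ h₁, one_smul, Finset.smul_sum]
    simp only [neg_smul, mul_smul, Finset.sum_neg_distrib]
    abel
  · intro t₀ t ht
    rw [Fintype.linearIndependent_iff] at hw
    have h := hw (fun o => o.elim (t₀ * κ + δ * ∑ j, (t₀ * ν j + t j)) fun j => t₀ * ν j + t j) (by
      rw [Fintype.sum_option]
      simp only [Option.elim_none, Option.elim_some]
      rw [hk] at ht
      have e : ∑ j, (t₀ * ν j + t j) • (q - w j) = t₀ • ∑ j, ν j • (q + δ • f - w j) +
          ∑ j, t j • (q + δ • f - w j) - (∑ j, (t₀ * ν j + t j)) • (δ • f) := by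
        rw [Finset.smul_sum, Finset.sum_smul, ← Finset.sum_add_distrib, ← Finset.sum_sub_distrib]
        exact Finset.sum_congr rfl fun j _ => by module
      rw [e]
      linear_combination (norm := module) ht)
    have hj : ∀ j, t₀ * ν j + t j = 0 := fun j => h (some j)
    have h0 : t₀ * κ + δ * ∑ j, (t₀ * ν j + t j) = 0 := h none
    simp only [hj, Finset.sum_const_zero, mul_zero, add_zero] at h0
    have ht0 : t₀ = 0 := (mul_eq_zero.1 h0).resolve_right h₁
    refine ⟨ht0, fun j => ?_⟩
    simpa [ht0] using hj j
  · intro a b hab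
    have hb : b = 0 := by
      by_contra hb
      apply h₂ (-(b⁻¹ * a))
      have : b • (q + δ • f - z) = -(a • g) := by rw [eq_neg_iff_add_eq_zero, add_comm, hab]
      rw [← inv_smul_smul₀ hb (q + δ • f - z), this]
      module
    refine ⟨?_, hb⟩
    rw [hb, zero_smul, add_zero, smul_eq_zero] at hab
    exact hab.resolve_right hg

/-- A balanced load can be realized if it can be realized after all forces but those at the nodes
`z` and `w j` are passed on to these nodes. -/
theorem realizable_of_frame (hcard : Fintype.card ι + 1 = Module.finrank ℝ E) {U : Set E}
    (hU : IsOpen U) {w : ι → E} (hwU : ∀ j, w j ∈ U)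
    (base : ∀ (z : E) (F : E →₀ E), z ∈ U → z ∉ affineSpan ℝ (Set.range w) →
      F ∈ Finsupp.supported E ℝ (insert z (Set.range w)) → IsBalanced F → F z ≠ 0 →
      Realizable U (insert z (Set.range w)) F)
    (K : Finset E) : ∀ (z : E) (F : E →₀ E), (K : Set E) ⊆ U → z ∈ U →
      z ∉ affineSpan ℝ (Set.range w) → z ∉ K → (∀ j, w j ∉ K) →
      F ∈ Finsupp.supported E ℝ (K ∪ insert z (Set.range w)) → IsBalanced F → F z ≠ 0 →
      (∀ q ∈ K, LinearIndependent ℝ fun o : Option ι => o.elim (F q) fun j => q - w j) →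
      (∀ q ∈ K, z - q ∉ Submodule.span ℝ {F q}) →
      Realizable U (K ∪ insert z (Set.range w)) F := by
  classical
  induction K using Finset.induction_on with
  | empty =>
    intro z F _ hzU hz _ _ hF hFb hFz _ _
    simp only [Finset.coe_empty, Set.empty_union] at hF ⊢
    exact base z F hzU hz hF hFb hFz
  | insert q K hqK ih =>
    intro z F hKU hzU hz hzK hwK hF hFb hFz hli hline S hS
    set X : Set E := (insert q K : Finset E) ∪ insert z (Set.range w) with hX
    have hXfin : X.Finite := (Finset.finite_toSet _).union ((Set.finite_range w).insert z)
    have hXU : X ⊆ U := by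
      rintro p (hp | rfl | ⟨j, rfl⟩)
      exacts [hKU hp, hzU, hwU j]
    have hqX : q ∈ X := Or.inl (by simp)
    have hzX : z ∈ X := Or.inr (by simp)
    have hwX : ∀ j, w j ∈ X := fun j => Or.inr (by simp)
    have hqz : q ≠ z := by rintro rfl; simp at hzK
    have hwq : ∀ j, q ≠ w j := fun j h => hwK j (by simp [← h])
    have hwz : ∀ j, z ≠ w j := fun j h => hz (h ▸ subset_affineSpan ℝ _ ⟨j, rfl⟩)
    -- The induction hypotheses on `z` are open conditions and pass to nearby points; the punctured
    -- limit keeps the new point off the finite set.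
    obtain ⟨δ', hδ', hz'U, hz', hz'line, hz'XS⟩ : ∃ δ' : ℝ, δ' ≠ 0 ∧ z + δ' • F z ∈ U ∧
        z + δ' • F z ∉ affineSpan ℝ (Set.range w) ∧
        (∀ p ∈ insert q K, z + δ' • F z - p ∉ Submodule.span ℝ {F p}) ∧
        z + δ' • F z ∉ X ∪ S := by
      have ht := tendsto_add_smul_nhds z (F z)
      have e1 : ∀ᶠ p in 𝓝 z, p ∈ U := hU.mem_nhds hzU
      have e2 : ∀ᶠ p in 𝓝 z, p ∉ affineSpan ℝ (Set.range w) :=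
        (AffineSubspace.closed_of_finiteDimensional _).isOpen_compl.mem_nhds hz
      have e3 : ∀ᶠ p in 𝓝 z, ∀ r ∈ insert q K, p - r ∉ Submodule.span ℝ {F r} := by
        rw [Finset.eventually_all]
        intro r hr
        have hc : Continuous fun p : E => p - r := by fun_prop
        exact hc.continuousAt.eventually
          ((Submodule.closed_of_finiteDimensional _).isOpen_compl.mem_nhds (hline r hr))
      have e4 : ∀ᶠ p in 𝓝[≠] z, p ∉ X ∪ S := eventually_notMem_of_finite (hXfin.union hS) z
      have ht' : Tendsto (fun δ : ℝ => z + δ • F z) (𝓝[≠] 0) (𝓝[≠] z) := by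
        refine tendsto_nhdsWithin_iff.2 ⟨ht, ?_⟩
        filter_upwards [self_mem_nhdsWithin] with δ hδ
        simpa [hFz] using hδ
      obtain ⟨δ', ⟨⟨⟨h1, h2⟩, h3⟩, h4⟩, h5⟩ := ((((ht.eventually e1).and (ht.eventually e2)).and
        (ht.eventually e3)).and (ht'.eventually e4) |>.and self_mem_nhdsWithin).exists
      exact ⟨δ', h5, h1, h2, h3, h4⟩
    set z' := z + δ' • F z with hz'def
    have hliq := hli q (by simp)
    have hFq : F q ≠ 0 := hliq.ne_zero none
    obtain ⟨δ, hδ, hyU, hyXS, α₀, α, hα, hα₀, hind, hpar⟩ : ∃ δ : ℝ, δ ≠ 0 ∧ q + δ • F q ∈ U ∧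
        q + δ • F q ∉ insert z' (X ∪ S) ∧ ∃ (α₀ : ℝ) (α : ι → ℝ),
        F q = α₀ • (q + δ • F q - z') + ∑ j, α j • (q + δ • F q - w j) ∧ α₀ ≠ 0 ∧
        (∀ (t₀ : ℝ) (t : ι → ℝ), t₀ • (q + δ • F q - z') + ∑ j, t j • (q + δ • F q - w j) = 0 →
          t₀ = 0 ∧ ∀ j, t j = 0) ∧
        ∀ a b : ℝ, a • F z + b • (q + δ • F q - z') = 0 → a = 0 ∧ b = 0 := by
      have ht := tendsto_add_smul_nhds q (F q)
      have ht' : Tendsto (fun δ : ℝ => q + δ • F q) (𝓝[≠] 0) (𝓝[≠] q) := by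
        refine tendsto_nhdsWithin_iff.2 ⟨ht, ?_⟩
        filter_upwards [self_mem_nhdsWithin] with δ hδ
        simpa [hFq] using hδ
      have e1 : ∀ᶠ p in 𝓝 q, p ∈ U := hU.mem_nhds (hXU hqX)
      have e2 : ∀ᶠ p in 𝓝[≠] q, p ∉ insert z' (X ∪ S) :=
        eventually_notMem_of_finite ((hXfin.union hS).insert z') q
      obtain ⟨δ, ⟨⟨h1, h2⟩, h3⟩, h4⟩ := (((ht.eventually e1).and (ht'.eventually e2)).and
        (eventually_transfer_conditions hcard hliq hz' (hz'line q (by simp)) hFz) |>.and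
          self_mem_nhdsWithin).exists
      exact ⟨δ, h4, h1, h2, h3⟩
    set y := q + δ • F q with hydef
    simp only [Set.mem_insert_iff, Set.mem_union, not_or] at hyXS hz'XS
    have hz'q : z' ≠ q := by rintro h; exact hz'XS.1 (h ▸ hqX)
    have hz'z : z' ≠ z := by rintro h; exact hz'XS.1 (h ▸ hzX)
    have hz'w : ∀ j, z' ≠ w j := fun j h => hz'XS.1 (h ▸ hwX j)
    have hyq : y ≠ q := by rintro h; exact hyXS.2.1 (h ▸ hqX)
    have hyz : y ≠ z := by rintro h; exact hyXS.2.1 (h ▸ hzX)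
    have hyw : ∀ j, y ≠ w j := fun j h => hyXS.2.1 (h ▸ hwX j)
    have hF0 : ∀ p, p ∉ X → F p = 0 := (Finsupp.mem_supported' ℝ F).1 hF
    set F' := transferredLoad F q z y z' w δ δ' α₀ α with hF'
    have hKX : ∀ p ∈ K, p ∈ X := fun p hp => Or.inl (by simp [hp])
    have hF'K : ∀ p ∈ K, F' p = F p := by
      intro p hp
      have hpz : p ≠ z := by rintro rfl; simp [hp] at hzK
      have hpq : p ≠ q := by rintro rfl; exact hqK hp
      have hpy : p ≠ y := by rintro h; exact hyXS.2.1 (h ▸ hKX p hp)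
      have hpz' : p ≠ z' := by rintro h; exact hz'XS.1 (h ▸ hKX p hp)
      have hpw : ∀ j, p ≠ w j := fun j h => hwK j (by simp [← h, hp])
      exact transferredLoad_apply_of_ne hpq hpz hpy hpz' hpw
    have hX' : insert z' (X \ {q, z}) = (K : Set E) ∪ insert z' (Set.range w) := by
      ext p
      simp only [hX, Set.mem_insert_iff, Set.mem_sdiff, Set.mem_union, Finset.coe_insert,
        Finset.mem_coe, Set.mem_singleton_iff, Set.mem_range]
      constructor
      · rintro (h | ⟨(h | h) | h | h, h'⟩) <;> tauto
      · rintro (h | h | ⟨j, rfl⟩)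
        · refine Or.inr ⟨Or.inl (Or.inr h), ?_⟩
          rintro (rfl | rfl)
          · exact hqK h
          · simp [h] at hzK
        · exact Or.inl h
        · exact Or.inr ⟨Or.inr (Or.inr ⟨j, rfl⟩), fun h => h.elim (fun h => hwq j h.symm)
            fun h => hwz j h.symm⟩
    obtain ⟨B, hB⟩ := ih z' F' (fun p hp => hKU (by simp [Finset.mem_coe.1 hp])) hz'U hz'
      (fun h => hz'XS.1 (hKX z' h)) (fun j h => hwK j (by simp [h])) (by
        rw [Finsupp.mem_supported']
        intro p hp
        rw [← hX'] at hp
        by_cases hpq : p = q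
        · rw [hpq]
          exact transferredLoad_apply_fst hqz hyq.symm hz'q.symm hwq hδ hydef
        by_cases hpz : p = z
        · rw [hpz]
          exact transferredLoad_apply_snd hqz.symm hyz.symm hz'z.symm hwz hδ' hz'def
        by_cases hpy : p = y
        · rw [hpy]
          exact transferredLoad_apply_via hyq.symm hyz hyXS.1 hyw hδ hydef (hF0 y hyXS.2.1) hα
        have hpX : p ∉ X := by
          intro h
          exact hp (Or.inr ⟨h, by simp [hpq, hpz]⟩)
        have hpz' : p ≠ z' := by rintro rfl; exact hp (by simp)
        rw [hF', transferredLoad_apply_of_ne hpq hpz hpy hpz' (by rintro j rfl; exact hpX (hwX j)),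
          hF0 p hpX])
      -- The force at `z'` is `F z + α₀ • (y - z')`, which cannot vanish because the two directions
      -- are independent; this keeps the induction going.
      (isBalanced_transferredLoad hFb) (by
        rw [hF', transferredLoad_apply_target hz'q hz'z.symm hyXS.1 hz'w hδ' hz'def
          (hF0 z' hz'XS.1)]
        intro h
        have := hpar 1 α₀ (by rw [one_smul, h])
        exact one_ne_zero this.1)
      (fun p hp => by rw [hF'K p hp]; exact hli p (by simp [hp]))
      (fun p hp => by rw [hF'K p hp]; exact hz'line p (by simp [hp]))
      (S ∪ X ∪ {y}) ((hS.union hXfin).union (Set.finite_singleton y))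
    rw [← hX'] at hB
    exact ⟨_, realizes_of_transfer hXU hF hqX hzX hqz hwX hwq hwz hyXS.2.1 hz'XS.1 hyXS.1 hyU hz'U
      hyXS.2.2 hz'XS.2 hδ hδ' hydef hz'def hα hα₀ hind hpar hB⟩

end Chain

/-! ### Balanced loads on two or three points. -/

section Triangle

open Filter Topology

theorem exists_dual_family {E : Type} [AddCommGroup E] [Module ℝ E] {ι : Type} {v : ι → E}
    (hv : LinearIndependent ℝ v) :
    ∃ φ : ι → E →ₗ[ℝ] ℝ, ∀ i, φ i (v i) = 1 ∧ ∀ j, j ≠ i → φ i (v j) = 0 := by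
  obtain ⟨g, hg⟩ := LinearMap.exists_leftInverse_of_injective
    (Finsupp.linearCombination ℝ v) (LinearMap.ker_eq_bot.2 hv)
  have h : ∀ j, g (v j) = Finsupp.single j 1 := fun j => by
    have := LinearMap.congr_fun hg (Finsupp.single j 1)
    simpa using this
  refine ⟨fun i => (Finsupp.lapply i).comp g, fun i => ⟨?_, fun j hj => ?_⟩⟩
  · simp [h]
  · simp [h, hj]

section

variable {E : Type} [AddCommGroup E] [Module ℝ E]

/-- Two balanced forces are opposite, and vanishing torque makes them collinear with the segment.
Testing the torque against a functional equal to `1` on `a - b` reads off the coefficient. -/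
theorem eq_smul_barLoad_of_isBalanced {a b : E} (hab : a ≠ b) {F : E →₀ E}
    (hF : F ∈ Finsupp.supported E ℝ {a, b}) (hFb : IsBalanced F) : ∃ c : ℝ, F = c • barLoad a b := by
  have hF0 := (Finsupp.mem_supported' ℝ F).1 hF
  have hsum : F = Finsupp.single a (F a) + Finsupp.single b (F b) := by
    ext p
    by_cases hpa : p = a
    · simp [hpa, hab]
    · by_cases hpb : p = b
      · simp [hpb, hab.symm]
      · simp [hpa, hpb, hF0 p (by simp [hpa, hpb])]
  have hr : F b = -F a := by
    have h := hFb.1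
    rw [hsum, map_add, resultant_single, resultant_single] at h
    exact (neg_eq_of_add_eq_zero_right h).symm
  obtain ⟨φ, hφ⟩ := exists_dual_family
    (LinearIndependent.of_subsingleton (v := fun _ : Unit => a - b) () (sub_ne_zero.2 hab))
  have hφ1 : φ () (a - b) = 1 := (hφ ()).1
  have hFa : F a = φ () (F a) • (a - b) := by
    rw [← sub_eq_zero, ← Module.forall_dual_apply_eq_zero_iff ℝ]
    intro ψ
    have h := hFb.2 (φ ()) ψ
    rw [hsum, map_add, moment_single, moment_single, hr] at h
    simp only [map_neg, map_sub, map_smul, smul_eq_mul] at h hφ1 ⊢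
    linear_combination -h - ψ (F a) * hφ1
  refine ⟨φ () (F a), ?_⟩
  rw [barLoad, smul_sub, Finsupp.smul_single, Finsupp.smul_single, ← hFa]
  nth_rw 1 [hsum]
  rw [hr, Finsupp.single_neg, sub_eq_add_neg]

/-- Moments against functionals dual to `b - a` and `c - a` force the three vectors into the plane
of the triangle. The moment of the two dual functionals makes the matrix of coefficients at `b` and
`c` symmetric, which leaves three parameters, one for each side. -/
theorem eq_sum_barLoad_of_isBalanced {a b c : E} (hab : a ≠ b) (hac : a ≠ c) (hbc : b ≠ c)
    (hli : LinearIndependent ℝ ![b - a, c - a]) {F : E →₀ E}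
    (hF : F ∈ Finsupp.supported E ℝ {a, b, c}) (hFb : IsBalanced F) :
    ∃ r s t : ℝ, F = r • barLoad a b + s • barLoad b c + t • barLoad a c := by
  have hF0 := (Finsupp.mem_supported' ℝ F).1 hF
  have hsum : F = Finsupp.single a (F a) + Finsupp.single b (F b) + Finsupp.single c (F c) := by
    ext p
    by_cases hpa : p = a
    · simp [hpa, hab.symm, hac.symm]
    · by_cases hpb : p = b
      · simp [hpb, hab, hbc.symm]
      · by_cases hpc : p = c
        · simp [hpc, hac, hbc]
        · simp [hpa, hpb, hpc, hF0 p (by simp [hpa, hpb, hpc])]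
  have hr : F a = -F b - F c := by
    have h := hFb.1
    rw [hsum, map_add, map_add, resultant_single, resultant_single, resultant_single] at h
    linear_combination (norm := module) h
  obtain ⟨φ, hφ⟩ := exists_dual_family hli
  have h00 : φ 0 (b - a) = 1 := (hφ 0).1
  have h01 : φ 0 (c - a) = 0 := (hφ 0).2 1 (by simp)
  have h10 : φ 1 (b - a) = 0 := (hφ 1).2 0 (by simp)
  have h11 : φ 1 (c - a) = 1 := (hφ 1).1
  have hm : ∀ α β : E →ₗ[ℝ] ℝ, β (b - a) * α (F b) - α (b - a) * β (F b) +
      (β (c - a) * α (F c) - α (c - a) * β (F c)) = 0 := by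
    intro α β
    have h := hFb.2 α β
    rw [hsum, map_add, map_add, moment_single, moment_single, moment_single, hr] at h
    simp only [map_neg, map_sub] at h ⊢
    linear_combination h
  have hFb' : F b = φ 0 (F b) • (b - a) + φ 0 (F c) • (c - a) := by
    rw [← sub_eq_zero, ← Module.forall_dual_apply_eq_zero_iff ℝ]
    intro ψ
    have h := hm (φ 0) ψ
    rw [h00, h01] at h
    simp only [map_sub, map_add, map_smul, smul_eq_mul] at h ⊢
    linear_combination -h
  have hFc' : F c = φ 1 (F b) • (b - a) + φ 1 (F c) • (c - a) := by
    rw [← sub_eq_zero, ← Module.forall_dual_apply_eq_zero_iff ℝ]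
    intro ψ
    have h := hm (φ 1) ψ
    rw [h10, h11] at h
    simp only [map_sub, map_add, map_smul, smul_eq_mul] at h ⊢
    linear_combination -h
  have hsymm : φ 1 (F b) = φ 0 (F c) := by
    have h := hm (φ 0) (φ 1)
    rw [h00, h01, h10, h11] at h
    linarith
  refine ⟨φ 0 (F b) + φ 0 (F c), -φ 0 (F c), φ 1 (F c) + φ 0 (F c), ?_⟩
  have ha : F a = (φ 0 (F b) + φ 0 (F c)) • (a - b) + (φ 1 (F c) + φ 0 (F c)) • (a - c) := by
    rw [hsymm] at hFc'
    linear_combination (norm := module) hr - hFb' - hFc'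
  ext p
  simp only [Finsupp.add_apply, Finsupp.smul_apply]
  by_cases hpa : p = a
  · rw [hpa, barLoad_apply_left hab, barLoad_apply_left hac, barLoad_apply_of_ne hab hac, ha]
    module
  · by_cases hpb : p = b
    · rw [hpb, barLoad_apply_right hab, barLoad_apply_left hbc, barLoad_apply_of_ne hab.symm hbc]
      nth_rw 1 [hFb']
      module
    · by_cases hpc : p = c
      · rw [hpc, barLoad_apply_right hbc, barLoad_apply_right hac,
          barLoad_apply_of_ne hac.symm hbc.symm]
        nth_rw 1 [hFc']
        rw [hsymm]
        module
      · rw [barLoad_apply_of_ne hpa hpb, barLoad_apply_of_ne hpb hpc, barLoad_apply_of_ne hpa hpc,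
          hF0 p (by simp [hpa, hpb, hpc])]
        simp

theorem LinearIndependent.eq_zero_of_vertex {a b c : E}
    (hli : LinearIndependent ℝ ![b - a, c - a]) {r t : ℝ}
    (h : r • (a - b) + t • (a - c) = 0) : r = 0 ∧ t = 0 := by
  refine LinearIndependent.pair_iff.1 hli r t ?_
  linear_combination (norm := module) -h

theorem LinearIndependent.rotate_vertex {a b c : E}
    (hli : LinearIndependent ℝ ![b - a, c - a]) : LinearIndependent ℝ ![c - b, a - b] := by
  rw [LinearIndependent.pair_iff]
  intro s t h
  have := LinearIndependent.pair_iff.1 hli (-s - t) s (by linear_combination (norm := module) h)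
  exact ⟨this.2, by linarith [this.1, this.2]⟩

theorem realizable_of_apply_eq_zero {U : Set E} {a b c : E} (hab : a ≠ b)
    (ha : a ∈ U) (hb : b ∈ U) {F : E →₀ E} (hF : F ∈ Finsupp.supported E ℝ {a, b, c})
    (hFb : IsBalanced F) (hF0 : F ≠ 0) (hc : F c = 0) : Realizable U {a, b, c} F := by
  obtain ⟨r, rfl⟩ := eq_smul_barLoad_of_isBalanced hab (by
    rw [Finsupp.mem_supported'] at hF ⊢
    intro p hp
    by_cases hpc : p = c
    · rw [hpc, hc]
    · exact hF p (by simpa [hpc] using hp)) hFb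
  refine realizable_barLoad hab ha hb (by simp) (by simp) ?_
  rintro rfl
  simp at hF0

end

variable {E : Type} [NormedAddCommGroup E] [NormedSpace ℝ E]

theorem eventually_linearIndependent_add_smul {a b c : E}
    (hli : LinearIndependent ℝ ![b - a, c - a]) (f g h : E) :
    ∀ᶠ δ : ℝ in 𝓝[≠] 0, LinearIndependent ℝ
      ![b + δ • g - (a + δ • f), c + δ • h - (a + δ • f)] := by
  have hcont : Continuous fun δ : ℝ => ![b + δ • g - (a + δ • f), c + δ • h - (a + δ • f)] := by
    fun_prop
  have ht := hcont.tendsto 0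
  simp only [zero_smul, add_zero] at ht
  exact ((ht.eventually (isOpen_setOfPred_linearIndependent.mem_nhds hli))).filter_mono
    nhdsWithin_le_nhds

-- The sides alone would support a three-parameter family of loads. Instead each force is carried
-- along its own line to a vertex of a smaller or shifted triangle `ya yb yc`. Each side carrying
-- stress forces equal multipliers of the two arms at its ends, and enough sides are stressed to
-- connect all three arms.
set_option maxHeartbeats 1000000 in
theorem realizable_triangle_of_ne_zero {U : Set E} (hU : IsOpen U) {a b c : E}
    (hli : LinearIndependent ℝ ![b - a, c - a]) (hab : a ≠ b) (hac : a ≠ c) (hbc : b ≠ c)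
    (haU : a ∈ U) (hbU : b ∈ U) (hcU : c ∈ U) {F : E →₀ E}
    (hF : F ∈ Finsupp.supported E ℝ {a, b, c}) (hFb : IsBalanced F)
    (ha : F a ≠ 0) (hb : F b ≠ 0) (hc : F c ≠ 0) : Realizable U {a, b, c} F := by
  intro S hS
  have hF0 := (Finsupp.mem_supported' ℝ F).1 hF
  have hfin : (({a, b, c} : Set E) ∪ S).Finite := (by simp : ({a, b, c} : Set E).Finite).union hS
  have harm : ∀ p ∈ U, F p ≠ 0 → ∀ᶠ δ : ℝ in 𝓝[≠] 0, p + δ • F p ∈ U ∧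
      p + δ • F p ∉ ({a, b, c} : Set E) ∪ S := by
    intro p hp hFp
    have ht := tendsto_add_smul_nhds p (F p)
    have ht' : Tendsto (fun δ : ℝ => p + δ • F p) (𝓝[≠] 0) (𝓝[≠] p) := by
      refine tendsto_nhdsWithin_iff.2 ⟨ht, ?_⟩
      filter_upwards [self_mem_nhdsWithin] with δ hδ
      simpa [hFp] using hδ
    exact (ht.eventually (hU.mem_nhds hp)).and
      (ht'.eventually (eventually_notMem_of_finite hfin p))
  have hli' := eventually_linearIndependent_add_smul hli (F a) (F b) (F c)
  have hne : ∀ᶠ δ : ℝ in 𝓝[≠] 0, δ ≠ 0 := self_mem_nhdsWithin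
  -- One common `δ` serves all three arms, so that after the transfer a single factor `δ⁻¹` cancels
  -- the forces at `a`, `b` and `c`.
  obtain ⟨δ, hδ, ⟨hyaU, hyaX⟩, ⟨hybU, hybX⟩, ⟨hycU, hycX⟩, hy⟩ :=
    (hne.and ((harm a haU ha).and ((harm b hbU hb).and ((harm c hcU hc).and hli')))).exists
  obtain ⟨ya, hya⟩ : ∃ ya, ya = a + δ • F a := ⟨_, rfl⟩
  obtain ⟨yb, hyb⟩ : ∃ yb, yb = b + δ • F b := ⟨_, rfl⟩
  obtain ⟨yc, hyc⟩ : ∃ yc, yc = c + δ • F c := ⟨_, rfl⟩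
  rw [← hya, ← hyb, ← hyc] at hy
  rw [← hya] at hyaU hyaX
  rw [← hyb] at hybU hybX
  rw [← hyc] at hycU hycX
  simp only [Set.mem_union, Set.mem_insert_iff, Set.mem_singleton_iff, not_or]
    at hyaX hybX hycX
  obtain ⟨⟨haa, hab', hac'⟩, hyaS⟩ := hyaX
  obtain ⟨⟨hba, hbb, hbc'⟩, hybS⟩ := hybX
  obtain ⟨⟨hca, hcb, hcc⟩, hycS⟩ := hycX
  have hy2 := hy.rotate_vertex
  have hy3 := hy2.rotate_vertex
  have hyab : ya ≠ yb := fun h => hy.ne_zero 0 (by simp [h])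
  have hyac : ya ≠ yc := fun h => hy.ne_zero 1 (by simp [h])
  have hybc : yb ≠ yc := fun h => hy2.ne_zero 0 (by simp [h])
  have eab : ya - a = δ • F a := by rw [hya]; abel
  have ebb : yb - b = δ • F b := by rw [hyb]; abel
  have ecc : yc - c = δ • F c := by rw [hyc]; abel
  have va : ∀ {p : E}, p ∉ ({a, b, c} : Set E) → F p = 0 := fun h => hF0 _ h
  obtain ⟨F', hF'⟩ : ∃ F', F' = F + δ⁻¹ • (barLoad a ya + barLoad b yb + barLoad c yc) := ⟨_, rfl⟩
  obtain ⟨r, s, t, hrst⟩ := eq_sum_barLoad_of_isBalanced hyab hyac hybc hy (F := F') (by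
    rw [Finsupp.mem_supported']
    intro p hp
    simp only [Set.mem_insert_iff, Set.mem_singleton_iff, not_or] at hp
    rw [hF']
    simp only [Finsupp.add_apply, Finsupp.smul_apply]
    by_cases hpa : p = a
    · rw [hpa, barLoad_apply_left (Ne.symm haa), barLoad_apply_of_ne hab (Ne.symm hba),
        barLoad_apply_of_ne hac (Ne.symm hca), ← neg_sub, eab, add_zero, add_zero, smul_neg,
        inv_smul_smul₀ hδ, add_neg_cancel]
    by_cases hpb : p = b
    · rw [hpb, barLoad_apply_left (Ne.symm hbb), barLoad_apply_of_ne hab.symm (Ne.symm hab'),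
        barLoad_apply_of_ne hbc (Ne.symm hcb), ← neg_sub, ebb, add_zero, zero_add, smul_neg,
        inv_smul_smul₀ hδ, add_neg_cancel]
    by_cases hpc : p = c
    · rw [hpc, barLoad_apply_left (Ne.symm hcc), barLoad_apply_of_ne hbc.symm (Ne.symm hbc'),
        barLoad_apply_of_ne hac.symm (Ne.symm hac'), ← neg_sub, ecc, zero_add, zero_add, smul_neg,
        inv_smul_smul₀ hδ, add_neg_cancel]
    rw [barLoad_apply_of_ne hpa hp.1, barLoad_apply_of_ne hpb hp.2.1,
      barLoad_apply_of_ne hpc hp.2.2, va (by simp [hpa, hpb, hpc])]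
    simp)
    (hF' ▸ hFb.add ((((isBalanced_barLoad _ _).add (isBalanced_barLoad _ _)).add
      (isBalanced_barLoad _ _)).smul _))
  have hFeq : F = r • barLoad ya yb + s • barLoad yb yc + t • barLoad ya yc -
      δ⁻¹ • (barLoad a ya + barLoad b yb + barLoad c yc) := by
    rw [← hrst, hF']
    abel
  have hvala : F a = r • (ya - yb) + t • (ya - yc) := by
    have h : F ya = 0 := va (by simp [haa, hab', hac'])
    rw [hFeq] at h
    simp only [Finsupp.add_apply, Finsupp.sub_apply, Finsupp.smul_apply, barLoad_apply_left hyab,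
      barLoad_apply_left hyac, barLoad_apply_of_ne hyab hyac, barLoad_apply_right (Ne.symm haa),
      barLoad_apply_of_ne hab' hyab, barLoad_apply_of_ne hac' hyac, eab] at h
    rw [add_zero, add_zero, inv_smul_smul₀ hδ] at h
    linear_combination (norm := module) -h
  have hvalb : F b = s • (yb - yc) + r • (yb - ya) := by
    have h : F yb = 0 := va (by simp [hba, hbb, hbc'])
    rw [hFeq] at h
    simp only [Finsupp.add_apply, Finsupp.sub_apply, Finsupp.smul_apply, barLoad_apply_right hyab,
      barLoad_apply_left hybc, barLoad_apply_of_ne hyab.symm hybc, barLoad_apply_right (Ne.symm hbb),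
      barLoad_apply_of_ne hba hyab.symm, barLoad_apply_of_ne hbc' hybc, ebb] at h
    rw [zero_add, add_zero, inv_smul_smul₀ hδ] at h
    linear_combination (norm := module) -h
  have hvalc : F c = t • (yc - ya) + s • (yc - yb) := by
    have h : F yc = 0 := va (by simp [hca, hcb, hcc])
    rw [hFeq] at h
    simp only [Finsupp.add_apply, Finsupp.sub_apply, Finsupp.smul_apply, barLoad_apply_right hyac,
      barLoad_apply_right hybc, barLoad_apply_of_ne hyac.symm hybc.symm,
      barLoad_apply_right (Ne.symm hcc), barLoad_apply_of_ne hca hyac.symm,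
      barLoad_apply_of_ne hcb hybc.symm, ecc] at h
    rw [zero_add, zero_add, inv_smul_smul₀ hδ] at h
    linear_combination (norm := module) -h
  set B : Set (Sym2 E) := {s(a, ya)} ∪ ({s(b, yb)} ∪ ({s(c, yc)} ∪ ({s(ya, yb)} ∪
    ({s(yb, yc)} ∪ {s(ya, yc)})))) with hB
  have hcases : ∀ e ∈ B, e = s(a, ya) ∨ e = s(b, yb) ∨ e = s(c, yc) ∨ e = s(ya, yb) ∨
      e = s(yb, yc) ∨ e = s(ya, yc) := fun e he => he
  have hmem : ∀ e ∈ B, ∀ p ∈ e, (p = a ∨ p = b ∨ p = c) ∨ p = ya ∨ p = yb ∨ p = yc := by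
    intro e he p hp
    rcases hcases e he with rfl | rfl | rfl | rfl | rfl | rfl <;>
      rcases Sym2.mem_iff.1 hp with rfl | rfl <;> simp
  have hFB : F ∈ supportable B := by
    rw [hFeq]
    refine sub_mem (add_mem (add_mem ?_ ?_) ?_) (Submodule.smul_mem _ _
      (add_mem (add_mem ?_ ?_) ?_))
    any_goals refine Submodule.smul_mem _ _ ?_
    all_goals exact barLoad_mem_supportable (by simp [hB])
  refine ⟨B, ?_, ?_, ?_, ?_, le_antisymm ?_ ?_⟩
  · simp [hB]
  · intro e he
    rcases hcases e he with rfl | rfl | rfl | rfl | rfl | rfl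
    · simpa using Ne.symm haa
    · simpa using Ne.symm hbb
    · simpa using Ne.symm hcc
    · simpa using hyab
    · simpa using hybc
    · simpa using hyac
  · intro e he p hp
    rcases hmem e he p hp with (rfl | rfl | rfl) | rfl | rfl | rfl <;> assumption
  · intro e he p hp hpX
    rcases hmem e he p hp with h | rfl | rfl | rfl
    · exact absurd h hpX
    all_goals assumption
  · rintro ρ ⟨hρ, hρX⟩
    have hρ0 : ∀ p, p ∉ ({a, b, c} : Set E) → ρ p = 0 := (Finsupp.mem_supported' ℝ ρ).1 hρX
    rw [SetLike.mem_coe, hB] at hρ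
    simp only [supportable_union, supportable_singleton] at hρ
    obtain ⟨ρ₁, h₁, σ₁, hσ₁, rfl⟩ := Submodule.mem_sup.1 hρ
    obtain ⟨ρ₂, h₂, σ₂, hσ₂, rfl⟩ := Submodule.mem_sup.1 hσ₁
    obtain ⟨ρ₃, h₃, σ₃, hσ₃, rfl⟩ := Submodule.mem_sup.1 hσ₂
    obtain ⟨ρ₄, h₄, σ₄, hσ₄, rfl⟩ := Submodule.mem_sup.1 hσ₃
    obtain ⟨ρ₅, h₅, ρ₆, h₆, rfl⟩ := Submodule.mem_sup.1 hσ₄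
    obtain ⟨ka, rfl⟩ := Submodule.mem_span_singleton.1 h₁
    obtain ⟨kb, rfl⟩ := Submodule.mem_span_singleton.1 h₂
    obtain ⟨kc, rfl⟩ := Submodule.mem_span_singleton.1 h₃
    obtain ⟨r', rfl⟩ := Submodule.mem_span_singleton.1 h₄
    obtain ⟨s', rfl⟩ := Submodule.mem_span_singleton.1 h₅
    obtain ⟨t', rfl⟩ := Submodule.mem_span_singleton.1 h₆
    have ea := hρ0 ya (by simp [haa, hab', hac'])
    have eb := hρ0 yb (by simp [hba, hbb, hbc'])
    have ec := hρ0 yc (by simp [hca, hcb, hcc])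
    simp only [Finsupp.add_apply, Finsupp.smul_apply, barLoad_apply_left hyab,
      barLoad_apply_left hyac, barLoad_apply_of_ne hyab hyac, barLoad_apply_right (Ne.symm haa),
      barLoad_apply_of_ne hab' hyab, barLoad_apply_of_ne hac' hyac, eab, hvala] at ea
    simp only [Finsupp.add_apply, Finsupp.smul_apply, barLoad_apply_right hyab,
      barLoad_apply_left hybc, barLoad_apply_of_ne hyab.symm hybc, barLoad_apply_right (Ne.symm hbb),
      barLoad_apply_of_ne hba hyab.symm, barLoad_apply_of_ne hbc' hybc, ebb, hvalb] at eb
    simp only [Finsupp.add_apply, Finsupp.smul_apply, barLoad_apply_right hyac,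
      barLoad_apply_right hybc, barLoad_apply_of_ne hyac.symm hybc.symm,
      barLoad_apply_right (Ne.symm hcc), barLoad_apply_of_ne hca hyac.symm,
      barLoad_apply_of_ne hcb hybc.symm, ecc, hvalc] at ec
    obtain ⟨a1, a2⟩ := hy.eq_zero_of_vertex (r := ka * δ * r + r') (t := ka * δ * t + t')
      (by linear_combination (norm := module) ea)
    obtain ⟨b1, b2⟩ := hy2.eq_zero_of_vertex (r := kb * δ * s + s') (t := kb * δ * r + r')
      (by linear_combination (norm := module) eb)
    obtain ⟨c1, c2⟩ := hy3.eq_zero_of_vertex (r := kc * δ * t + t') (t := kc * δ * s + s')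
      (by linear_combination (norm := module) ec)
    have q1 : (ka - kb) * r = 0 := mul_left_cancel₀ hδ (by linear_combination a1 - b2)
    have q2 : (kb - kc) * s = 0 := mul_left_cancel₀ hδ (by linear_combination b1 - c2)
    have q3 : (ka - kc) * t = 0 := mul_left_cancel₀ hδ (by linear_combination a2 - c1)
    -- No two of `r`, `s`, `t` vanish, because each vertex carries a nonzero force; hence at least
    -- two of `q1`, `q2`, `q3` give an equality.
    have n1 : ¬ (r = 0 ∧ t = 0) := by rintro ⟨rfl, rfl⟩; simp [hvala] at ha
    have n2 : ¬ (s = 0 ∧ r = 0) := by rintro ⟨rfl, rfl⟩; simp [hvalb] at hb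
    have n3 : ¬ (t = 0 ∧ s = 0) := by rintro ⟨rfl, rfl⟩; simp [hvalc] at hc
    simp only [mul_eq_zero, sub_eq_zero] at q1 q2 q3
    obtain ⟨rfl, rfl⟩ : ka = kb ∧ kb = kc := by grind
    rw [Submodule.mem_span_singleton]
    refine ⟨-(ka * δ), ?_⟩
    rw [show r' = -(ka * δ * r) by linarith, show s' = -(ka * δ * s) by linarith,
      show t' = -(ka * δ * t) by linarith, hFeq]
    have hd : ka * δ * δ⁻¹ = ka := by field_simp
    simp only [smul_add, smul_sub, smul_smul, neg_mul, hd]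
    module
  · rw [Submodule.span_singleton_le_iff_mem]
    exact ⟨hFB, hF⟩

theorem realizable_triangle {U : Set E} (hU : IsOpen U) {a b c : E}
    (hli : LinearIndependent ℝ ![b - a, c - a]) (haU : a ∈ U) (hbU : b ∈ U) (hcU : c ∈ U)
    {F : E →₀ E} (hF : F ∈ Finsupp.supported E ℝ {a, b, c}) (hFb : IsBalanced F) (hF0 : F ≠ 0) :
    Realizable U {a, b, c} F := by
  have hab : a ≠ b := fun h => hli.ne_zero 0 (by simp [h])
  have hac : a ≠ c := fun h => hli.ne_zero 1 (by simp [h])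
  have hbc : b ≠ c := fun h => hli.rotate_vertex.ne_zero 0 (by simp [h])
  by_cases hc : F c = 0
  · exact realizable_of_apply_eq_zero hab haU hbU hF hFb hF0 hc
  by_cases hb : F b = 0
  · rw [Set.pair_comm] at hF ⊢
    exact realizable_of_apply_eq_zero hac haU hcU hF hFb hF0 hb
  by_cases ha : F a = 0
  · rw [Set.insert_comm, Set.pair_comm] at hF ⊢
    exact realizable_of_apply_eq_zero hbc hbU hcU hF hFb hF0 ha
  exact realizable_triangle_of_ne_zero hU hli hab hac hbc haU hbU hcU hF hFb ha hb hc

end Triangle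

/-! ### Placing two balancing forces. -/

section Placement

open Filter Topology MeasureTheory

/-- The load with force `g i` at `pos i`. -/
noncomputable def pointLoad {E T : Type} [AddCommGroup E] [Fintype T] (pos g : T → E) : E →₀ E :=
  ∑ i, Finsupp.single (pos i) (g i)

theorem pointLoad_apply {E T : Type} [AddCommGroup E] [Fintype T] {pos g : T → E}
    (hpos : Function.Injective pos) (i : T) : pointLoad pos g (pos i) = g i := by
  classical
  simp [pointLoad, Finsupp.finsetSum_apply, Finsupp.single_apply, hpos.eq_iff]

theorem pointLoad_apply_of_notMem {E T : Type} [AddCommGroup E] [Fintype T] {pos g : T → E} {p : E}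
    (hp : p ∉ Set.range pos) : pointLoad pos g p = 0 := by
  classical
  rw [pointLoad, Finsupp.finsetSum_apply]
  refine Finset.sum_eq_zero fun i _ => Finsupp.single_eq_of_ne ?_
  rintro rfl
  exact hp ⟨i, rfl⟩

variable {d : ℕ}

/-- Finite sets and proper affine subspaces are Lebesgue null, whereas nonempty open sets are not.
-/
theorem exists_mem_open_notMem_affineSubspace (hd : 0 < d) {κ : Type} [Finite κ]
    {A : κ → AffineSubspace ℝ (EuclideanSpace ℝ (Fin d))} (hA : ∀ k, A k ≠ ⊤)
    {S U : Set (EuclideanSpace ℝ (Fin d))} (hS : S.Finite) (hU : IsOpen U) (hUne : U.Nonempty) :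
    ∃ p ∈ U, p ∉ S ∧ ∀ k, p ∉ A k := by
  have : Nonempty (Fin d) := ⟨⟨0, hd⟩⟩
  have : Nontrivial (EuclideanSpace ℝ (Fin d)) := by
    apply Module.nontrivial_of_finrank_pos (R := ℝ)
    simpa using hd
  by_contra! h
  have hsub : U ⊆ S ∪ ⋃ k, (A k : Set _) := by
    intro p hp
    by_cases hpS : p ∈ S
    · exact Or.inl hpS
    · obtain ⟨k, hk⟩ := h p hp hpS
      exact Or.inr (Set.mem_iUnion.2 ⟨k, hk⟩)
  have hnull : (volume : Measure (EuclideanSpace ℝ (Fin d))) (S ∪ ⋃ k, (A k : Set _)) = 0 := by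
    have : Countable κ := Finite.to_countable
    exact measure_union_null (hS.measure_zero _)
      (measure_iUnion_null fun k => Measure.addHaar_affineSubspace _ _ (hA k))
  exact (hU.measure_pos volume hUne).ne' (measure_mono_null hsub hnull)

theorem AffineSubspace.mk'_span_ne_top (q : EuclideanSpace ℝ (Fin d))
    (s : Finset (EuclideanSpace ℝ (Fin d))) (hs : s.card < d) :
    AffineSubspace.mk' q (Submodule.span ℝ (s : Set (EuclideanSpace ℝ (Fin d)))) ≠ ⊤ := by
  intro h
  have h' := congrArg AffineSubspace.direction h
  rw [AffineSubspace.direction_mk', AffineSubspace.direction_top] at h'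
  have := finrank_span_finset_le_card (R := ℝ) s
  rw [Set.finrank, h', finrank_top, finrank_euclideanSpace, Fintype.card_fin] at this
  omega

theorem sum_wedge_eq (y f : Fin d → ℝ) (φ ψ : Fin d → ℝ) :
    (∑ l, y l * ψ l) * (∑ k, f k * φ k) - (∑ l, y l * φ l) * (∑ k, f k * ψ k) =
      ∑ k, ∑ l, φ k * ψ l * (f k * y l - y k * f l) := by
  rw [Finset.sum_mul_sum, Finset.sum_mul_sum, Finset.sum_comm, ← Finset.sum_sub_distrib]
  refine Finset.sum_congr rfl fun k _ => ?_
  rw [← Finset.sum_sub_distrib]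
  exact Finset.sum_congr rfl fun l _ => by ring

/-- Bivectors are decomposable in dimension at most three. This fails in dimension four, and is one
of the places where `d` matters. -/
theorem exists_wedge_of_antisymm (hd : d = 2 ∨ d = 3) (T : Fin d → Fin d → ℝ)
    (hT : ∀ k l, T k l = -T l k) :
    ∃ v b : Fin d → ℝ, v ≠ 0 ∧ ∀ k l, T k l = v k * b l - b k * v l := by
  rcases hd with rfl | rfl
  · refine ⟨![1, 0], ![0, T 0 1], fun h => by simpa using congrFun h 0, ?_⟩
    have h0 := hT 0 0
    have h1 := hT 1 1
    have h01 := hT 1 0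
    intro k l
    fin_cases k <;> fin_cases l <;> simp <;> linarith
  · have h0 := hT 0 0
    have h1 := hT 1 1
    have h2 : T 2 2 = 0 := by linarith [hT 2 2]
    have h01 := hT 1 0
    have h02 := hT 2 0
    have h12 := hT 2 1
    by_cases h : T 0 1 = 0
    · refine ⟨![0, 0, 1], ![-T 0 2, -T 1 2, 0], fun h => by simpa using congrFun h 2, ?_⟩
      intro k l
      fin_cases k <;> fin_cases l <;> simp <;> linarith
    · refine ⟨![1, 0, -(T 1 2 / T 0 1)], ![0, T 0 1, T 0 2], fun h => by simpa using congrFun h 0,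
        ?_⟩
      intro k l
      fin_cases k <;> fin_cases l <;> simp [h2] <;> (try field_simp) <;> linarith

theorem EuclideanSpace.exists_coefficients (φ : EuclideanSpace ℝ (Fin d) →ₗ[ℝ] ℝ) :
    ∃ c : Fin d → ℝ, ∀ u, φ u = ∑ k, u k * c k := by
  refine ⟨fun k => φ (EuclideanSpace.single k 1), fun u => ?_⟩
  have h := (EuclideanSpace.basisFun (Fin d) ℝ).sum_repr u
  conv_lhs => rw [← h]
  simp

/-- In dimension two or three, every torque is the torque of a single pair of vectors. -/
theorem exists_wedge_eq_sum (hd : d = 2 ∨ d = 3) {n : ℕ}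
    (y f : Fin n → EuclideanSpace ℝ (Fin d)) :
    ∃ v b : EuclideanSpace ℝ (Fin d), v ≠ 0 ∧ ∀ φ ψ : EuclideanSpace ℝ (Fin d) →ₗ[ℝ] ℝ,
      ∑ i, (ψ (y i) * φ (f i) - φ (y i) * ψ (f i)) = ψ b * φ v - φ b * ψ v := by
  obtain ⟨v, b, hv, h⟩ := exists_wedge_of_antisymm hd
    (fun k l => ∑ i, (f i k * y i l - y i k * f i l)) (fun k l => by
      rw [← Finset.sum_neg_distrib]
      exact Finset.sum_congr rfl fun i _ => by ring)
  refine ⟨WithLp.toLp 2 v, WithLp.toLp 2 b, by simpa using hv, fun φ ψ => ?_⟩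
  obtain ⟨α, hα⟩ := EuclideanSpace.exists_coefficients φ
  obtain ⟨β, hβ⟩ := EuclideanSpace.exists_coefficients ψ
  simp only [hα, hβ, sum_wedge_eq]
  rw [Finset.sum_comm]
  refine Finset.sum_congr rfl fun k _ => ?_
  rw [Finset.sum_comm]
  refine Finset.sum_congr rfl fun l _ => ?_
  rw [← Finset.mul_sum, h]

theorem eventually_add_smul_mem {E : Type} [NormedAddCommGroup E] [NormedSpace ℝ E] {z : E}
    {O : Set E} (hO : O ∈ 𝓝 z) (v : E) : ∀ᶠ δ : ℝ in 𝓝[≠] 0, z + δ • v ∈ O :=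
  (tendsto_add_smul_nhds z v).eventually hO

/-- Any forces at given points are balanced by the forces at two further points in a given open
set, which can be chosen off the lines of action of the given forces. -/
theorem exists_balancing_pair (hd : d = 2 ∨ d = 3) {n : ℕ}
    (x f : Fin n → EuclideanSpace ℝ (Fin d)) {S U : Set (EuclideanSpace ℝ (Fin d))}
    (hS : S.Finite) (hU : IsOpen U) (hUne : U.Nonempty) :
    ∃ p a : Fin 2 → EuclideanSpace ℝ (Fin d), Function.Injective p ∧
      (∀ j, p j ∈ U ∧ p j ∉ S ∧ ∀ i, p j - x i ∉ Submodule.span ℝ {f i}) ∧ a 0 ≠ 0 ∧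
      IsBalanced (pointLoad x f + pointLoad p a) := by
  classical
  have hA : ∀ i, AffineSubspace.mk' (x i) (Submodule.span ℝ {f i}) ≠ ⊤ := fun i => by
    have h := AffineSubspace.mk'_span_ne_top (x i) {f i} (by rw [Finset.card_singleton]; omega)
    rwa [Finset.coe_singleton] at h
  obtain ⟨z, hzU, hzS, hz⟩ :=
    exists_mem_open_notMem_affineSubspace (by omega) hA hS hU hUne
  simp only [AffineSubspace.mem_mk', vsub_eq_sub] at hz
  obtain ⟨v, b, hv, hvb⟩ := exists_wedge_eq_sum hd (fun i => x i - z) f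
  have hlines : ∀ᶠ p in 𝓝 z, ∀ i, p - x i ∉ Submodule.span ℝ {f i} := by
    rw [eventually_all]
    intro i
    have hc : Continuous fun p => p - x i := by fun_prop
    exact hc.continuousAt.eventually
      ((Submodule.closed_of_finiteDimensional _).isOpen_compl.mem_nhds (hz i))
  have hne : ∀ᶠ δ : ℝ in 𝓝[≠] 0, δ ≠ 0 := self_mem_nhdsWithin
  obtain ⟨δ, hδ, h1, h2, h3⟩ := (hne.and ((eventually_add_smul_mem (hU.mem_nhds hzU) v).and
    ((eventually_add_smul_mem (hS.isClosed.isOpen_compl.mem_nhds hzS) v).and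
      (eventually_add_smul_mem hlines v)))).exists
  -- The component `τ • v` acts along the line through the two points and has no torque about `z`;
  -- it is free to keep the force at `z` nonzero.
  obtain ⟨τ, hτ⟩ : ∃ τ : ℝ, -(∑ i, f i) - (δ⁻¹ • b + τ • v) ≠ 0 := by
    by_contra! h
    have h0 := h 0
    have h1 := h 1
    apply hv
    linear_combination (norm := module) h0 - h1
  -- About `z`, only the second of the new forces has torque: its arm `δ • v` and the component `δ⁻¹
  -- • b` cancel the torque of the given forces. The first new force then corrects the resultant.
  refine ⟨![z, z + δ • v], ![-(∑ i, f i) - (δ⁻¹ • b + τ • v), δ⁻¹ • b + τ • v], ?_, ?_, hτ, ?_, ?_⟩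
  · intro i j h
    fin_cases i <;> fin_cases j <;> simp_all
  · intro j
    fin_cases j
    · exact ⟨hzU, hzS, hz⟩
    · exact ⟨h1, h2, h3⟩
  · simp [pointLoad, map_sum, resultant_single]
  · intro φ ψ
    have h := hvb φ ψ
    simp only [map_sub] at h
    simp only [pointLoad, map_add, map_sum, moment_single, Fin.sum_univ_two, Matrix.cons_val_zero,
      Matrix.cons_val_one, map_sub, map_neg, map_smul, smul_eq_mul]
    have e : ∑ i, ((ψ (x i) - ψ z) * φ (f i) - (φ (x i) - φ z) * ψ (f i)) =
        ∑ i, (ψ (x i) * φ (f i) - φ (x i) * ψ (f i)) - ψ z * ∑ i, φ (f i) +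
          φ z * ∑ i, ψ (f i) := by
      rw [Finset.mul_sum, Finset.mul_sum, ← Finset.sum_sub_distrib, ← Finset.sum_add_distrib]
      exact Finset.sum_congr rfl fun i _ => by ring
    rw [e] at h
    have hδ' : δ * δ⁻¹ = 1 := mul_inv_cancel₀ hδ
    linear_combination h + (ψ v * φ b - φ v * ψ b) * hδ'

end Placement

/-! ### Frameworks for arbitrary forces in dimensions two and three. -/

section Realization

open Filter Topology

/-- The induction works with a convenient terminal set `Y`: force-free points are dropped and
auxiliary ones added. Adding `X` to the avoided set makes the change to `X` free, since supported
loads vanish at points of `X` outside `Y`. -/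
theorem Realizable.exists_realizes {E : Type} [AddCommGroup E] [Module ℝ E] {U X Y S : Set E}
    {F : E →₀ E} (h : Realizable U Y F) (hX : X.Finite) (hS : S.Finite)
    (hFX : F ∈ Finsupp.supported E ℝ X) (hY : ∀ p ∈ Y, p ∉ X → p ∉ S) :
    ∃ B, Realizes U S X F B := by
  obtain ⟨B, hB⟩ := h (S ∪ X) (hS.union hX)
  refine ⟨B, hB.finite, hB.not_isDiag, hB.mem_region, ?_, le_antisymm ?_ ?_⟩
  · intro e he p hp hpX hpS
    by_cases hpY : p ∈ Y
    · exact hY p hpY hpX hpS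
    · exact hB.notMem_of_notMem e he p hp hpY (Or.inl hpS)
  · rintro ρ ⟨hρ, hρX⟩
    rw [← hB.supportable_inf]
    refine ⟨hρ, ?_⟩
    rw [SetLike.mem_coe, Finsupp.mem_supported']
    intro p hpY
    by_cases hpX : p ∈ X
    · exact hB.apply_eq_zero hρ hpY (Or.inr hpX)
    · exact (Finsupp.mem_supported' ℝ ρ).1 hρX p hpX
  · rw [Submodule.span_singleton_le_iff_mem]
    have hF : F ∈ supportable B ⊓ Finsupp.supported E ℝ Y := by
      rw [hB.supportable_inf]
      exact Submodule.mem_span_singleton_self F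
    exact ⟨hF.1, hFX⟩

section

variable {E : Type} [NormedAddCommGroup E] [NormedSpace ℝ E]

theorem realizable_base_of_pair {U : Set E} {b : E} (hb : b ∈ U) (z : E) (F : E →₀ E) (hz : z ∈ U)
    (hzb : z ∉ affineSpan ℝ (Set.range fun _ : Unit => b))
    (hF : F ∈ Finsupp.supported E ℝ (insert z (Set.range fun _ : Unit => b)))
    (hFb : IsBalanced F) (hFz : F z ≠ 0) :
    Realizable U (insert z (Set.range fun _ : Unit => b)) F := by
  rw [Set.range_const] at *
  have hne : z ≠ b := by rintro rfl; simp at hzb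
  obtain ⟨c, rfl⟩ := eq_smul_barLoad_of_isBalanced hne hF hFb
  refine realizable_barLoad hne hz hb (by simp) (by simp) ?_
  rintro rfl
  simp at hFz

theorem linearIndependent_sub_of_notMem_affineSpan {b c z : E} (hbc : b ≠ c)
    (hz : z ∉ affineSpan ℝ {b, c}) : LinearIndependent ℝ ![b - z, c - z] := by
  rw [LinearIndependent.pair_iff]
  intro s t h
  have hst : s + t = 0 := by
    by_contra hne
    apply hz
    have e : z = AffineMap.lineMap b c (t / (s + t)) := by
      have h' : (s + t) • z = s • b + t • c := by linear_combination (norm := module) -h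
      have hs : s / (s + t) = 1 - t / (s + t) := by field_simp; ring
      rw [AffineMap.lineMap_apply_module, ← hs, ← inv_smul_smul₀ hne z, h', smul_add, smul_smul,
        smul_smul, div_eq_inv_mul, div_eq_inv_mul]
    rw [e]
    exact AffineMap.lineMap_mem_affineSpan_pair _ _ _
  have ht : t = -s := by linarith
  have : s • (b - c) = 0 := by
    rw [ht] at h
    linear_combination (norm := module) h
  have hs : s = 0 := (smul_eq_zero.1 this).resolve_right (sub_ne_zero.2 hbc)
  exact ⟨hs, by linarith⟩

theorem realizable_base_of_triple {U : Set E} (hU : IsOpen U) {b c : E} (hbc : b ≠ c) (hb : b ∈ U)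
    (hc : c ∈ U) (z : E) (F : E →₀ E) (hz : z ∈ U)
    (hzbc : z ∉ affineSpan ℝ (Set.range ![b, c]))
    (hF : F ∈ Finsupp.supported E ℝ (insert z (Set.range ![b, c])))
    (hFb : IsBalanced F) (hFz : F z ≠ 0) :
    Realizable U (insert z (Set.range ![b, c])) F := by
  have e : Set.range ![b, c] = {b, c} := by simp [Matrix.range_cons, Set.pair_comm]
  rw [e] at hzbc hF ⊢
  exact realizable_triangle hU (linearIndependent_sub_of_notMem_affineSpan hbc hzbc) hz hb hc hF
    hFb (by rintro rfl; simp at hFz)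

theorem linearIndependent_frame_of_pair {q b f : E} (hf : f ≠ 0)
    (hb : b - q ∉ Submodule.span ℝ {f}) :
    LinearIndependent ℝ fun o : Option Unit => o.elim f fun _ => q - b := by
  rw [Fintype.linearIndependent_iff]
  intro g hg
  rw [Fintype.sum_option] at hg
  simp only [Option.elim_none, Option.elim_some, Finset.univ_unique, Finset.sum_singleton,
    PUnit.default_eq_unit] at hg
  have h1 : g (some ()) = 0 := by
    by_contra hne
    apply hb
    rw [Submodule.mem_span_singleton]
    refine ⟨(g (some ()))⁻¹ * g none, ?_⟩
    rw [mul_smul, inv_smul_eq_iff₀ hne]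
    linear_combination (norm := module) hg
  rw [h1, zero_smul, add_zero] at hg
  have h0 := (smul_eq_zero.1 hg).resolve_right hf
  rintro (_ | _) <;> assumption

theorem linearIndependent_frame_of_triple {q b c f : E} (hf : f ≠ 0)
    (hb : b - q ∉ Submodule.span ℝ {f}) (hc : c - q ∉ Submodule.span ℝ {f, b - q}) :
    LinearIndependent ℝ fun o : Option (Fin 2) => o.elim f fun j => q - ![b, c] j := by
  rw [Fintype.linearIndependent_iff]
  intro g hg
  rw [Fintype.sum_option] at hg
  simp only [Option.elim_none, Option.elim_some, Fin.sum_univ_two, Matrix.cons_val_zero,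
    Matrix.cons_val_one] at hg
  have h2 : g (some 1) = 0 := by
    by_contra hne
    apply hc
    rw [Submodule.mem_span_pair]
    refine ⟨(g (some 1))⁻¹ * g none, -((g (some 1))⁻¹ * g (some 0)), ?_⟩
    rw [neg_smul, mul_smul, mul_smul, ← sub_eq_add_neg, ← smul_sub, inv_smul_eq_iff₀ hne]
    linear_combination (norm := module) hg
  have h1 : g (some 0) = 0 := by
    by_contra hne
    apply hb
    rw [Submodule.mem_span_singleton]
    refine ⟨(g (some 0))⁻¹ * g none, ?_⟩
    rw [mul_smul, inv_smul_eq_iff₀ hne]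
    rw [h2] at hg
    linear_combination (norm := module) hg
  rw [h1, h2, zero_smul, zero_smul, add_zero, add_zero] at hg
  have h0 := (smul_eq_zero.1 hg).resolve_right hf
  rintro (_ | i)
  · exact h0
  · fin_cases i
    · exact h1
    · exact h2

end

variable {d : ℕ}

/-- Any forces at given points are, together with suitable forces at two further points, the only
load supported by some collection of bars. -/
theorem exists_realizes (hd : d = 2 ∨ d = 3) {n : ℕ} {x f : Fin n → EuclideanSpace ℝ (Fin d)}
    (hx : Function.Injective x) {S U : Set (EuclideanSpace ℝ (Fin d))}
    (hS : S.Finite) (hU : IsOpen U) (hUne : U.Nonempty) (hxU : ∀ i, x i ∈ U) :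
    ∃ (p a : Fin 2 → EuclideanSpace ℝ (Fin d)) (B : Set (Sym2 (EuclideanSpace ℝ (Fin d)))),
      Function.Injective (Sum.elim x p) ∧ (∀ j, p j ∈ U ∧ p j ∉ S) ∧ a ≠ 0 ∧
      Realizes U S (Set.range (Sum.elim x p)) (pointLoad (Sum.elim x p) (Sum.elim f a)) B := by
  classical
  obtain ⟨p, a, hp, hpU, ha, hbal⟩ := exists_balancing_pair hd x f
    (hS.union (Set.finite_range x)) hU hUne
  simp only [Set.mem_union, Set.mem_range, not_or, not_exists] at hpU
  have hinj : Function.Injective (Sum.elim x p) :=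
    hx.sumElim hp fun i j h => (hpU j).2.1.2 i h
  refine ⟨p, a, ?_⟩
  have hF : pointLoad (Sum.elim x p) (Sum.elim f a) = pointLoad x f + pointLoad p a := by
    simp [pointLoad]
  rw [← hF] at hbal
  set F := pointLoad (Sum.elim x p) (Sum.elim f a) with hFdef
  have hFx : ∀ i, F (x i) = f i := fun i => pointLoad_apply hinj (Sum.inl i)
  have hFp : ∀ j, F (p j) = a j := fun j => pointLoad_apply hinj (Sum.inr j)
  have hFX : F ∈ Finsupp.supported _ ℝ (Set.range (Sum.elim x p)) := by
    rw [Finsupp.mem_supported']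
    exact fun q hq => pointLoad_apply_of_notMem hq
  -- Only points with a nonzero force have a line of action and need to be removed.
  set K : Finset (EuclideanSpace ℝ (Fin d)) := (Finset.univ.filter fun i => f i ≠ 0).image x
    with hK
  have hKmem : ∀ q ∈ K, ∃ i, q = x i ∧ f i ≠ 0 := by
    intro q hq
    obtain ⟨i, hi, rfl⟩ := Finset.mem_image.1 hq
    exact ⟨i, rfl, (Finset.mem_filter.1 hi).2⟩
  have hKU : (K : Set (EuclideanSpace ℝ (Fin d))) ⊆ U := by
    intro q hq
    obtain ⟨i, rfl, -⟩ := hKmem q hq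
    exact hxU i
  have hpK : ∀ j, p j ∉ K := by
    intro j h
    obtain ⟨i, hi, -⟩ := hKmem _ h
    exact (hpU j).2.1.2 i hi.symm
  have hsupp : ∀ W : Set (EuclideanSpace ℝ (Fin d)), p 1 ∈ W →
      F ∈ Finsupp.supported _ ℝ ((K : Set (EuclideanSpace ℝ (Fin d))) ∪ insert (p 0) W) := by
    intro W hW
    rw [Finsupp.mem_supported']
    intro q hq
    by_cases hqX : q ∈ Set.range (Sum.elim x p)
    · obtain ⟨i | j, rfl⟩ := hqX
      · by_contra hne
        rw [Sum.elim_inl, hFx] at hne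
        exact hq (Or.inl (Finset.mem_image.2 ⟨i, by simpa using hne, rfl⟩))
      · fin_cases j
        · exact absurd (Or.inr (Or.inl rfl)) hq
        · exact absurd (Or.inr (Or.inr hW)) hq
    · exact pointLoad_apply_of_notMem hqX
  have hne : p 0 ≠ p 1 := fun h => zero_ne_one (hp h)
  have hline : ∀ q ∈ K, p 0 - q ∉ Submodule.span ℝ {F q} := by
    intro q hq
    obtain ⟨i, rfl, -⟩ := hKmem q hq
    rw [hFx]
    exact (hpU 0).2.2 i
  have hKX : ∀ q ∈ K, q ∈ Set.range (Sum.elim x p) := by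
    intro q hq
    obtain ⟨i, rfl, -⟩ := hKmem q hq
    exact ⟨Sum.inl i, rfl⟩
  have hpX : ∀ j, p j ∈ Set.range (Sum.elim x p) := fun j => ⟨Sum.inr j, rfl⟩
  suffices h : ∃ W : Set (EuclideanSpace ℝ (Fin d)),
      Realizable U ((K : Set (EuclideanSpace ℝ (Fin d))) ∪ insert (p 0) W) F ∧
      ∀ q ∈ W, q = p 1 ∨ q ∉ S by
    obtain ⟨W, hW, hWS⟩ := h
    obtain ⟨B, hB⟩ := hW.exists_realizes (Set.finite_range _) hS hFX (by
      rintro q (hq | rfl | hq) hqX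
      · exact absurd (hKX q hq) hqX
      · exact absurd (hpX 0) hqX
      · rcases hWS q hq with rfl | h
        · exact absurd (hpX 1) hqX
        · exact h)
    exact ⟨B, hinj, fun j => ⟨(hpU j).1, (hpU j).2.1.1⟩, fun h => ha (by rw [h]; rfl), hB⟩
  have hFz : F (p 0) ≠ 0 := by rwa [hFp]
  rcases hd with rfl | rfl
  · refine ⟨Set.range fun _ : Unit => p 1, ?_, by simp⟩
    refine realizable_of_frame (by simp) hU (fun _ => (hpU 1).1)
      (realizable_base_of_pair (hpU 1).1) K (p 0) F hKU (hpU 0).1 ?_ (hpK 0) (fun _ => hpK 1)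
      (hsupp _ (by simp)) hbal hFz ?_ hline
    · rw [Set.range_const]
      simpa using hne
    · intro q hq
      obtain ⟨i, rfl, hi⟩ := hKmem q hq
      rw [hFx]
      exact linearIndependent_frame_of_pair hi ((hpU 1).2.2 i)
  -- For `d = 3` two fixed nodes are needed, so an auxiliary `c` joins `p 1`. It must avoid the line
  -- through `p 0` and `p 1`, so that the final triangle is nondegenerate, and the planes spanned at
  -- `x i` by `f i` and `p 1 - x i`, so that the frame at `x i` is independent.
  · have hA : ∀ o : Option (Fin n), (o.elim
        (AffineSubspace.mk' (p 0) (Submodule.span ℝ {p 1 - p 0}))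
        fun i => AffineSubspace.mk' (x i) (Submodule.span ℝ {f i, p 1 - x i})) ≠ ⊤ := by
      rintro (_ | i)
      · have h := AffineSubspace.mk'_span_ne_top (p 0) {p 1 - p 0} (by simp)
        rwa [Finset.coe_singleton] at h
      · have h := AffineSubspace.mk'_span_ne_top (x i) {f i, p 1 - x i}
          (lt_of_le_of_lt Finset.card_le_two (by simp))
        rwa [Finset.coe_pair] at h
    obtain ⟨c, hcU, hcS, hc⟩ := exists_mem_open_notMem_affineSubspace (by norm_num) hA
      (hS.union (Set.finite_range (Sum.elim x p))) hU hUne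
    simp only [Set.mem_union, not_or] at hcS
    have hc0 := hc none
    have hci := fun i => hc (some i)
    simp only [Option.elim_none, Option.elim_some, AffineSubspace.mem_mk', vsub_eq_sub] at hc0 hci
    have hpc : p 1 ≠ c := by rintro rfl; exact hcS.2 (hpX 1)
    refine ⟨Set.range ![p 1, c], ?_, ?_⟩
    · refine realizable_of_frame (by simp) hU ?_
        (realizable_base_of_triple hU hpc (hpU 1).1 hcU) K (p 0) F hKU (hpU 0).1 ?_ (hpK 0) ?_
        (hsupp _ ⟨0, rfl⟩) hbal hFz ?_ hline
      · intro j
        fin_cases j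
        · exact (hpU 1).1
        · exact hcU
      · have e : Set.range ![p 1, c] = {p 1, c} := by simp [Matrix.range_cons, Set.pair_comm]
        rw [e]
        intro h
        obtain ⟨r, hr⟩ := mem_affineSpan_pair_iff_exists_lineMap_eq.1 h
        rw [AffineMap.lineMap_apply_module'] at hr
        have hr0 : r ≠ 0 := by
          rintro rfl
          apply hne
          rw [← hr]
          simp
        apply hc0
        rw [Submodule.mem_span_singleton]
        refine ⟨1 - r⁻¹, ?_⟩
        have e : c - p 1 = r⁻¹ • (p 0 - p 1) := by
          rw [eq_inv_smul_iff₀ hr0, ← hr]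
          abel
        linear_combination (norm := module) -e
      · intro j
        fin_cases j
        · exact hpK 1
        · exact fun h => hcS.2 (hKX c h)
      · intro q hq
        obtain ⟨i, rfl, hi⟩ := hKmem q hq
        rw [hFx]
        exact linearIndependent_frame_of_triple hi ((hpU 1).2.2 i) (hci i)
    · rintro q ⟨j, rfl⟩
      fin_cases j
      · exact Or.inl rfl
      · exact Or.inr hcS.1

end Realization

/-! ### Plane frameworks in general position and removal of a crossing. -/

section GeneralPosition

variable {E : Type} [AddCommGroup E] [Module ℝ E]

/-- The bar without its ends. -/
def openBar : Sym2 E → Set E :=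
  Sym2.lift ⟨fun p q => openSegment ℝ p q, fun p q => openSegment_symm ℝ p q⟩

@[simp] theorem openBar_mk (p q : E) : openBar s(p, q) = openSegment ℝ p q := rfl

/-- The points where two of the bars cross. -/
def crossings (B : Set (Sym2 E)) : Set E :=
  {c | ∃ e₁ ∈ B, ∃ e₂ ∈ B, e₁ ≠ e₂ ∧ c ∈ openBar e₁ ∧ c ∈ openBar e₂}

/-- The bars in `B` have their ends in `O` and contain no further points of `O`, and no three of
them cross in one point. -/
structure InGeneralPosition (O : Set E) (B : Set (Sym2 E)) : Prop where
  finite_nodes : O.Finite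
  finite : B.Finite
  not_isDiag : ∀ e ∈ B, ¬ e.IsDiag
  mem_nodes : ∀ e ∈ B, ∀ p ∈ e, p ∈ O
  notMem_openBar : ∀ e ∈ B, ∀ p ∈ O, p ∉ openBar e
  notMem_of_mem_of_mem : ∀ e₁ ∈ B, ∀ e₂ ∈ B, ∀ e₃ ∈ B, e₁ ≠ e₂ → e₁ ≠ e₃ → e₂ ≠ e₃ →
    ∀ c, c ∈ openBar e₁ → c ∈ openBar e₂ → c ∉ openBar e₃

theorem mem_openSegment_iff_exists {p q c : E} :
    c ∈ openSegment ℝ p q ↔ ∃ s : ℝ, 0 < s ∧ s < 1 ∧ c = p + s • (q - p) := by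
  rw [openSegment_eq_image']
  constructor
  · rintro ⟨s, ⟨h0, h1⟩, rfl⟩
    exact ⟨s, h0, h1, rfl⟩
  · rintro ⟨s, h0, h1, rfl⟩
    exact ⟨s, ⟨h0, h1⟩, rfl⟩

theorem exists_parameters_of_mem_openBar {e : Sym2 E} {c c' : E} (hcc' : c ≠ c')
    (hc : c ∈ openBar e) (hc' : c' ∈ openBar e) :
    ∃ α β : ℝ, α < 0 ∧ 0 < β ∧ e = s(c + α • (c' - c), c + β • (c' - c)) := by
  induction e with
  | _ v w =>
    obtain ⟨s, hs0, hs1, hs⟩ := mem_openSegment_iff_exists.1 hc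
    obtain ⟨t, ht0, ht1, ht⟩ := mem_openSegment_iff_exists.1 hc'
    have hd : c' - c = (t - s) • (w - v) := by rw [hs, ht]; module
    have hst : t - s ≠ 0 := by
      intro h
      rw [h, zero_smul, sub_eq_zero] at hd
      exact hcc' hd.symm
    have hv : v = c + (-s / (t - s)) • (c' - c) := by
      rw [hd, smul_smul, div_mul_cancel₀ _ hst, hs]
      module
    have hw : w = c + ((1 - s) / (t - s)) • (c' - c) := by
      rw [hd, smul_smul, div_mul_cancel₀ _ hst, hs]
      module
    rcases lt_or_gt_of_ne hst with h | h
    · refine ⟨(1 - s) / (t - s), -s / (t - s), div_neg_of_pos_of_neg (by linarith) h,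
        div_pos_of_neg_of_neg (by linarith) h, ?_⟩
      rw [← hv, ← hw, Sym2.eq_swap]
    · refine ⟨-s / (t - s), (1 - s) / (t - s), div_neg_of_neg_of_pos (by linarith) h,
        div_pos (by linarith) h, ?_⟩
      rw [← hv, ← hw]

theorem add_smul_mem_openSegment {c u : E} {α β t : ℝ} (h1 : α < t) (h2 : t < β) :
    c + t • u ∈ openSegment ℝ (c + α • u) (c + β • u) := by
  have h : 0 < β - α := by linarith
  refine mem_openSegment_iff_exists.2 ⟨(t - α) / (β - α), div_pos (by linarith) h,
    (div_lt_one h).2 (by linarith), ?_⟩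
  have e : c + β • u - (c + α • u) = (β - α) • u := by module
  rw [e, smul_smul, div_mul_cancel₀ _ h.ne']
  module

/-- Bars with two common inner points lie on one line. Parametrizing both on it, an end of one would
be an inner point of the other unless their ends coincide. -/
theorem InGeneralPosition.eq_of_mem_of_mem {O : Set E} {B : Set (Sym2 E)}
    (h : InGeneralPosition O B) {e₁ e₂ : Sym2 E} (h₁ : e₁ ∈ B) (h₂ : e₂ ∈ B) (hne : e₁ ≠ e₂)
    {c c' : E} (hc₁ : c ∈ openBar e₁) (hc₂ : c ∈ openBar e₂) (hc'₁ : c' ∈ openBar e₁)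
    (hc'₂ : c' ∈ openBar e₂) : c = c' := by
  by_contra hcc'
  obtain ⟨α, β, hα, hβ, he₁⟩ := exists_parameters_of_mem_openBar hcc' hc₁ hc'₁
  obtain ⟨α', β', hα', hβ', he₂⟩ := exists_parameters_of_mem_openBar hcc' hc₂ hc'₂
  set u := c' - c
  have key : ∀ {e e' : Sym2 E} {α β α' β' : ℝ}, e ∈ B → e' ∈ B → e = s(c + α • u, c + β • u) →
      e' = s(c + α' • u, c + β' • u) → ∀ t, (t = α' ∨ t = β') → ¬ (α < t ∧ t < β) := by
    rintro e e' α β α' β' he he' rfl rfl t ht ⟨h1, h2⟩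
    refine h.notMem_openBar _ he (c + t • u) (h.mem_nodes _ he' _ ?_)
      (add_smul_mem_openSegment h1 h2)
    rcases ht with rfl | rfl <;> simp
  have hα_eq : α = α' := by
    rcases lt_trichotomy α α' with hlt | heq | hgt
    · exact absurd ⟨hlt, by linarith⟩ (key h₁ h₂ he₁ he₂ α' (Or.inl rfl))
    · exact heq
    · exact absurd ⟨hgt, by linarith⟩ (key h₂ h₁ he₂ he₁ α (Or.inl rfl))
  have hβ_eq : β = β' := by
    rcases lt_trichotomy β β' with hlt | heq | hgt
    · exact absurd ⟨by linarith, hlt⟩ (key h₂ h₁ he₂ he₁ β (Or.inr rfl))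
    · exact heq
    · exact absurd ⟨by linarith, hgt⟩ (key h₁ h₂ he₁ he₂ β' (Or.inr rfl))
  exact hne (by rw [he₁, he₂, hα_eq, hβ_eq])

theorem InGeneralPosition.finite_crossings {O : Set E} {B : Set (Sym2 E)}
    (h : InGeneralPosition O B) : (crossings B).Finite := by
  have hsub : crossings B ⊆ ⋃ e₁ ∈ B, ⋃ e₂ ∈ B, {c | e₁ ≠ e₂ ∧ c ∈ openBar e₁ ∧ c ∈ openBar e₂} := by
    rintro c ⟨e₁, h₁, e₂, h₂, hc⟩
    simp only [Set.mem_iUnion]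
    exact ⟨e₁, h₁, e₂, h₂, hc⟩
  refine Set.Finite.subset ?_ hsub
  refine h.finite.biUnion fun e₁ h₁ => h.finite.biUnion fun e₂ h₂ => ?_
  apply Set.Subsingleton.finite
  rintro c ⟨hne, hc₁, hc₂⟩ c' ⟨-, hc'₁, hc'₂⟩
  exact h.eq_of_mem_of_mem h₁ h₂ hne hc₁ hc₂ hc'₁ hc'₂

theorem sub_mem_span_of_mem_openSegment {p q c : E} (h : c ∈ openSegment ℝ p q) :
    q - p ∈ Submodule.span ℝ {c - p} := by
  obtain ⟨s, hs, -, rfl⟩ := mem_openSegment_iff_exists.1 h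
  rw [Submodule.mem_span_singleton]
  refine ⟨s⁻¹, ?_⟩
  rw [add_sub_cancel_left, inv_smul_smul₀ hs.ne']

theorem sub_mem_span_of_mem_openSegment_of_mem_openSegment {p p' q c : E} (hpp' : p ≠ p')
    (h : c ∈ openSegment ℝ p q) (h' : c ∈ openSegment ℝ p' q) :
    q - p ∈ Submodule.span ℝ {p' - p} := by
  obtain ⟨s, hs, hs1, h⟩ := mem_openSegment_iff_exists.1 h
  obtain ⟨t, ht, ht1, h'⟩ := mem_openSegment_iff_exists.1 h'
  rw [h] at h'
  have key : (s - t) • (q - p) = (1 - t) • (p' - p) := by linear_combination (norm := module) h'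
  have hst : s - t ≠ 0 := by
    intro h0
    rw [h0, zero_smul] at key
    rcases smul_eq_zero.1 key.symm with h1 | h1
    · linarith
    · exact hpp' (sub_eq_zero.1 h1).symm
  rw [Submodule.mem_span_singleton]
  exact ⟨(s - t)⁻¹ * (1 - t), by rw [mul_smul, ← key, inv_smul_smul₀ hst]⟩

/-- Connecting a new node to old nodes preserves general position if it avoids finitely many
lines. -/
theorem InGeneralPosition.insert_node {O : Set E} {B : Set (Sym2 E)} (h : InGeneralPosition O B)
    {D : E} (hDO : D ∉ O)
    (hD : ∀ p ∈ O, ∀ c ∈ O ∪ crossings B, p ≠ c → D - p ∉ Submodule.span ℝ {c - p})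
    {P : Set E} (hP : P ⊆ O) :
    InGeneralPosition (insert D O) (B ∪ (fun p => s(p, D)) '' P) := by
  have hnode : ∀ p ∈ P, ∀ o ∈ O, o ∉ openSegment ℝ p D := by
    intro p hp o ho hoD
    have hpo : p ≠ o := by
      rintro rfl
      rw [left_mem_openSegment_iff] at hoD
      exact hDO (hoD ▸ ho)
    exact hD p (hP hp) o (Or.inl ho) hpo (sub_mem_span_of_mem_openSegment hoD)
  have hnew : ∀ p ∈ P, ∀ p' ∈ P, p ≠ p' → ∀ c, c ∈ openSegment ℝ p D → c ∉ openSegment ℝ p' D :=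
    fun p hp p' hp' hne c hc hc' => hD p (hP hp) p' (Or.inl (hP hp')) hne
      (sub_mem_span_of_mem_openSegment_of_mem_openSegment hne hc hc')
  have hcross : ∀ p ∈ P, ∀ c, c ∈ openSegment ℝ p D → c ∉ crossings B := by
    intro p hp c hc hcB
    have hpc : p ≠ c := by
      rintro rfl
      obtain ⟨e, he, -, -, -, hpe, -⟩ := hcB
      exact h.notMem_openBar e he p (hP hp) hpe
    exact hD p (hP hp) c (Or.inr hcB) hpc (sub_mem_span_of_mem_openSegment hc)
  refine ⟨h.finite_nodes.insert D, h.finite.union ((h.finite_nodes.subset hP).image _), ?_, ?_, ?_,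
    ?_⟩
  · rintro e (he | ⟨p, hp, rfl⟩)
    · exact h.not_isDiag e he
    · rw [Sym2.mk_isDiag_iff]
      rintro rfl
      exact hDO (hP hp)
  · rintro e (he | ⟨p, hp, rfl⟩) q hq
    · exact Or.inr (h.mem_nodes e he q hq)
    · rcases Sym2.mem_iff.1 hq with rfl | rfl
      · exact Or.inr (hP hp)
      · exact Or.inl rfl
  · rintro e (he | ⟨p, hp, rfl⟩) q (rfl | hq) hqe
    · revert he hqe
      induction e with
      | _ v w =>
        intro he hqe
        have hvw : v ≠ w := fun hvw => h.not_isDiag _ he (by simpa using hvw)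
        refine hD v (h.mem_nodes _ he v (by simp)) w (Or.inl (h.mem_nodes _ he w (by simp))) hvw ?_
        obtain ⟨s, -, -, rfl⟩ := mem_openSegment_iff_exists.1 hqe
        rw [add_sub_cancel_left]
        exact Submodule.smul_mem _ _ (Submodule.mem_span_singleton_self _)
    · exact h.notMem_openBar e he q hq hqe
    · rw [openBar_mk, right_mem_openSegment_iff] at hqe
      exact hDO (hqe ▸ hP hp)
    · exact hnode p hp q hq hqe
  · have key : ∀ p ∈ P, ∀ e₂ ∈ B ∪ (fun p => s(p, D)) '' P, ∀ e₃ ∈ B ∪ (fun p => s(p, D)) '' P,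
        s(p, D) ≠ e₂ → s(p, D) ≠ e₃ → e₂ ≠ e₃ → ∀ c, c ∈ openSegment ℝ p D → c ∈ openBar e₂ →
        c ∉ openBar e₃ := by
      rintro p hp e₂ (h₂ | ⟨p₂, hp₂, rfl⟩) e₃ (h₃ | ⟨p₃, hp₃, rfl⟩) h12 h13 h23 c hc hc₂ hc₃
      · exact hcross p hp c hc ⟨e₂, h₂, e₃, h₃, h23, hc₂, hc₃⟩
      · exact hnew p hp p₃ hp₃ (by rintro rfl; exact h13 rfl) c hc hc₃
      · exact hnew p hp p₂ hp₂ (by rintro rfl; exact h12 rfl) c hc hc₂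
      · exact hnew p hp p₂ hp₂ (by rintro rfl; exact h12 rfl) c hc hc₂
    intro e₁ h₁ e₂ h₂ e₃ h₃ h12 h13 h23 c hc₁ hc₂ hc₃
    rcases h₁ with h₁' | ⟨p, hp, rfl⟩
    · rcases h₂ with h₂' | ⟨p, hp, rfl⟩
      · rcases h₃ with h₃' | ⟨p, hp, rfl⟩
        · exact h.notMem_of_mem_of_mem e₁ h₁' e₂ h₂' e₃ h₃' h12 h13 h23 c hc₁ hc₂ hc₃
        · exact key p hp e₁ (Or.inl h₁') e₂ (Or.inl h₂') h13.symm h23.symm h12 c hc₃ hc₁ hc₂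
      · exact key p hp e₁ (Or.inl h₁') e₃ h₃ h12.symm h23 h13 c hc₂ hc₁ hc₃
    · exact key p hp e₂ h₂ e₃ h₃ h12 h13 h23 c hc₁ hc₂ hc₃

/-- `barLoad` is not normalized by length, so equal physical tension in the two pieces requires the
weights `t⁻¹` and `(1 - t)⁻¹`. -/
theorem barLoad_eq_of_mem_line {v w : E} {t : ℝ} (h0 : t ≠ 0) (h1 : 1 - t ≠ 0) :
    barLoad v w = t⁻¹ • barLoad v (v + t • (w - v)) +
      (1 - t)⁻¹ • barLoad (v + t • (w - v)) w := by
  have e1 : v - (v + t • (w - v)) = t • (v - w) := by module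
  have e2 : v + t • (w - v) - w = (1 - t) • (v - w) := by module
  simp only [barLoad, e1, e2, ← Finsupp.smul_single, ← smul_sub, inv_smul_smul₀ h0,
    inv_smul_smul₀ h1]
  abel

/-- Balance at `c` splits along the two independent directions, so the two pieces of each bar carry
the same tension and act together like the unbroken bar. -/
theorem supportable_crossing_inf {O : Set E} {v w v' w' : E} {t t' : ℝ} (ht : t ≠ 0) (ht1 : 1 - t ≠ 0)
    (ht' : t' ≠ 0) (ht1' : 1 - t' ≠ 0) (hv : v ∈ O) (hw : w ∈ O) (hv' : v' ∈ O) (hw' : w' ∈ O)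
    {c : E} (hcO : c ∉ O) (hc : c = v + t • (w - v)) (hc' : c = v' + t' • (w' - v'))
    (hli : LinearIndependent ℝ ![w - v, w' - v']) :
    supportable ({s(v, c)} ∪ ({s(c, w)} ∪ ({s(v', c)} ∪ {s(c, w')}))) ⊓ Finsupp.supported E ℝ O =
      supportable ({s(v, w)} ∪ {s(v', w')}) := by
  have hvc : v ≠ c := by rintro rfl; exact hcO hv
  have hwc : c ≠ w := by rintro rfl; exact hcO hw
  have hvc' : v' ≠ c := by rintro rfl; exact hcO hv'
  have hwc' : c ≠ w' := by rintro rfl; exact hcO hw'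
  have e : barLoad v w = t⁻¹ • barLoad v c + (1 - t)⁻¹ • barLoad c w := by
    rw [hc]; exact barLoad_eq_of_mem_line ht ht1
  have e' : barLoad v' w' = t'⁻¹ • barLoad v' c + (1 - t')⁻¹ • barLoad c w' := by
    rw [hc']; exact barLoad_eq_of_mem_line ht' ht1'
  simp only [supportable_union, supportable_singleton]
  apply le_antisymm
  · rintro ρ ⟨hρ, hρO⟩
    have hρc := (Finsupp.mem_supported' ℝ ρ).1 hρO c hcO
    rw [SetLike.mem_coe] at hρ
    obtain ⟨ρ₁, h₁, σ₁, hσ₁, rfl⟩ := Submodule.mem_sup.1 hρ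
    obtain ⟨ρ₂, h₂, σ₂, hσ₂, rfl⟩ := Submodule.mem_sup.1 hσ₁
    obtain ⟨ρ₃, h₃, ρ₄, h₄, rfl⟩ := Submodule.mem_sup.1 hσ₂
    obtain ⟨r₁, rfl⟩ := Submodule.mem_span_singleton.1 h₁
    obtain ⟨r₂, rfl⟩ := Submodule.mem_span_singleton.1 h₂
    obtain ⟨r₃, rfl⟩ := Submodule.mem_span_singleton.1 h₃
    obtain ⟨r₄, rfl⟩ := Submodule.mem_span_singleton.1 h₄
    simp only [Finsupp.add_apply, Finsupp.smul_apply, barLoad_apply_right hvc,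
      barLoad_apply_left hwc, barLoad_apply_right hvc', barLoad_apply_left hwc'] at hρc
    have d1 : c - v = t • (w - v) := by rw [hc]; abel
    have d2 : c - w = -((1 - t) • (w - v)) := by rw [hc]; module
    have d3 : c - v' = t' • (w' - v') := by rw [hc']; abel
    have d4 : c - w' = -((1 - t') • (w' - v')) := by rw [hc']; module
    rw [d1, d2, d3, d4] at hρc
    obtain ⟨q1, q2⟩ := LinearIndependent.pair_iff.1 hli (r₁ * t - r₂ * (1 - t))
      (r₃ * t' - r₄ * (1 - t')) (by linear_combination (norm := module) hρc)
    have hr₁ : r₁ = r₁ * t * t⁻¹ := by field_simp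
    have hr₂ : r₂ = r₁ * t * (1 - t)⁻¹ := by
      rw [sub_eq_zero.1 q1]; field_simp
    have hr₃ : r₃ = r₃ * t' * t'⁻¹ := by field_simp
    have hr₄ : r₄ = r₃ * t' * (1 - t')⁻¹ := by
      rw [sub_eq_zero.1 q2]; field_simp
    refine Submodule.mem_sup.2 ⟨(r₁ * t) • barLoad v w, Submodule.smul_mem _ _
      (Submodule.mem_span_singleton_self _), (r₃ * t') • barLoad v' w', Submodule.smul_mem _ _
      (Submodule.mem_span_singleton_self _), ?_⟩
    rw [e, e', smul_add, smul_add, smul_smul, smul_smul, smul_smul, smul_smul, ← hr₁, ← hr₂, ← hr₃,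
      ← hr₄]
    abel
  · refine sup_le ?_ ?_ <;>
      (simp only [← supportable_singleton, ← supportable_union]; rw [supportable_singleton])
    all_goals rw [Submodule.span_singleton_le_iff_mem] <;> refine ⟨?_, ?_⟩
    · rw [SetLike.mem_coe, e]
      exact add_mem (Submodule.smul_mem _ _ (barLoad_mem_supportable (by simp)))
        (Submodule.smul_mem _ _ (barLoad_mem_supportable (by simp)))
    · rw [SetLike.mem_coe, Finsupp.mem_supported']
      exact fun p hp => barLoad_apply_of_ne (by rintro rfl; exact hp hv) (by rintro rfl; exact hp hw)
    · rw [SetLike.mem_coe, e']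
      exact add_mem (Submodule.smul_mem _ _ (barLoad_mem_supportable (by simp)))
        (Submodule.smul_mem _ _ (barLoad_mem_supportable (by simp)))
    · rw [SetLike.mem_coe, Finsupp.mem_supported']
      exact fun p hp =>
        barLoad_apply_of_ne (by rintro rfl; exact hp hv') (by rintro rfl; exact hp hw')

/-- By the modular law, a local replacement can be analysed without the bars that it leaves
untouched. -/
theorem supportable_union_inf {O : Set E} {A B : Set (Sym2 E)} (hA : ∀ e ∈ A, ∀ p ∈ e, p ∈ O) :
    supportable (A ∪ B) ⊓ Finsupp.supported E ℝ O =
      supportable A ⊔ supportable B ⊓ Finsupp.supported E ℝ O := by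
  rw [supportable_union]
  exact sup_inf_assoc_of_le _ (supportable_le_supported hA)

theorem notMem_openSegment_of_mem_openSegment {v w c y : E} (hvw : v ≠ w)
    (hc : c ∈ openSegment ℝ v w) (hy : y ∈ openSegment ℝ v c) : y ∉ openSegment ℝ c w := by
  intro hy'
  obtain ⟨t, ht0, ht1, hc⟩ := mem_openSegment_iff_exists.1 hc
  obtain ⟨s, hs0, hs1, hy⟩ := mem_openSegment_iff_exists.1 hy
  obtain ⟨r, hr0, hr1, hy'⟩ := mem_openSegment_iff_exists.1 hy'
  rw [hy, hc] at hy'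
  have h : (s * t - (t + r * (1 - t))) • (w - v) = 0 := by
    linear_combination (norm := module) hy'
  have h' := (smul_eq_zero.1 h).resolve_right (sub_ne_zero.2 hvw.symm)
  nlinarith [mul_pos hr0 (sub_pos.2 ht1), mul_pos ht0 (sub_pos.2 hs1)]

theorem openSegment_subset_left {v w c : E} (hc : c ∈ openSegment ℝ v w) :
    openSegment ℝ v c ⊆ openSegment ℝ v w := by
  intro y hy
  obtain ⟨t, ht0, ht1, rfl⟩ := mem_openSegment_iff_exists.1 hc
  obtain ⟨s, hs0, hs1, rfl⟩ := mem_openSegment_iff_exists.1 hy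
  exact mem_openSegment_iff_exists.2 ⟨s * t, mul_pos hs0 ht0,
    by nlinarith [mul_pos ht0 (sub_pos.2 hs1)], by module⟩

theorem openSegment_subset_right {v w c : E} (hc : c ∈ openSegment ℝ v w) :
    openSegment ℝ c w ⊆ openSegment ℝ v w := by
  rw [openSegment_symm ℝ c w, openSegment_symm ℝ v w]
  rw [openSegment_symm] at hc
  exact openSegment_subset_left hc

/-- Parallel bars through `c` would share a whole neighbourhood of `c` on their line, against the
uniqueness of the common point; `c + η • (w - v)` is a second common point. -/
theorem InGeneralPosition.linearIndependent {O : Set E} {B : Set (Sym2 E)}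
    (h : InGeneralPosition O B) {v w v' w' c : E} (h₁ : s(v, w) ∈ B) (h₂ : s(v', w') ∈ B)
    (hne : s(v, w) ≠ s(v', w')) (hc : c ∈ openSegment ℝ v w) (hc' : c ∈ openSegment ℝ v' w') :
    LinearIndependent ℝ ![w - v, w' - v'] := by
  have hvw' : v' ≠ w' := fun hvw => h.not_isDiag _ h₂ (by simpa using hvw)
  have hw' : w' - v' ≠ 0 := sub_ne_zero.2 hvw'.symm
  rw [LinearIndependent.pair_symm_iff, LinearIndependent.pair_iff' hw']
  intro k hk
  have hvw : v ≠ w := fun hvw => h.not_isDiag _ h₁ (by simpa using hvw)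
  obtain ⟨t, ht0, ht1, hct⟩ := mem_openSegment_iff_exists.1 hc
  obtain ⟨t', ht0', ht1', hct'⟩ := mem_openSegment_iff_exists.1 hc'
  obtain ⟨η, hη0, hη1, hη2, hη3⟩ : ∃ η : ℝ, 0 < η ∧ t + η < 1 ∧ 0 < t' + η * k ∧ t' + η * k < 1 := by
    have c1 : Filter.Tendsto (fun η : ℝ => t + η) (nhdsWithin 0 (Set.Ioi 0)) (nhds t) := by
      have : Continuous fun η : ℝ => t + η := by fun_prop
      simpa using (this.tendsto 0).mono_left nhdsWithin_le_nhds
    have c2 : Filter.Tendsto (fun η : ℝ => t' + η * k) (nhdsWithin 0 (Set.Ioi 0)) (nhds t') := by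
      have : Continuous fun η : ℝ => t' + η * k := by fun_prop
      simpa using (this.tendsto 0).mono_left nhdsWithin_le_nhds
    have hpos : ∀ᶠ η : ℝ in nhdsWithin 0 (Set.Ioi 0), 0 < η := self_mem_nhdsWithin
    exact (hpos.and ((c1.eventually_lt_const ht1).and
      ((c2.eventually_const_lt ht0').and (c2.eventually_lt_const ht1')))).exists
  have hd : c = c + η • (w - v) := by
    refine h.eq_of_mem_of_mem h₁ h₂ hne hc hc' ?_ ?_
    · exact mem_openSegment_iff_exists.2 ⟨t + η, by linarith, hη1, by rw [hct]; module⟩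
    · refine mem_openSegment_iff_exists.2 ⟨t' + η * k, hη2, hη3, ?_⟩
      rw [hct', ← hk]
      module
  have : η • (w - v) = 0 := by
    nth_rw 1 [← add_zero c] at hd
    exact (add_left_cancel hd).symm
  exact (smul_ne_zero hη0.ne' (sub_ne_zero.2 hvw.symm)) this

/-- Making a crossing point of two bars a node. -/
theorem InGeneralPosition.exists_uncross {O : Set E} {B : Set (Sym2 E)}
    (h : InGeneralPosition O B) {c : E} (hc : c ∈ crossings B) :
    ∃ B' : Set (Sym2 E), c ∉ O ∧ InGeneralPosition (insert c O) B' ∧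
      crossings B' ⊆ crossings B \ {c} ∧ (∀ e ∈ B', ∀ p ∈ e, p = c ∨ ∃ e' ∈ B, p ∈ e') ∧
      supportable B' ⊓ Finsupp.supported E ℝ O = supportable B := by
  obtain ⟨e₁, h₁, e₂, h₂, hne, hc₁, hc₂⟩ := hc
  have hcO : c ∉ O := fun hcO => h.notMem_openBar e₁ h₁ c hcO hc₁
  revert h₁ h₂ hne hc₁ hc₂
  induction e₁ with | _ v w => ?_
  induction e₂ with | _ v' w' => ?_
  intro h₁ h₂ hne hc₁ hc₂
  rw [openBar_mk] at hc₁ hc₂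
  have hv : v ∈ O := h.mem_nodes _ h₁ v (by simp)
  have hw : w ∈ O := h.mem_nodes _ h₁ w (by simp)
  have hv' : v' ∈ O := h.mem_nodes _ h₂ v' (by simp)
  have hw' : w' ∈ O := h.mem_nodes _ h₂ w' (by simp)
  have hvw : v ≠ w := fun hvw => h.not_isDiag _ h₁ (by simpa using hvw)
  have hvw' : v' ≠ w' := fun hvw => h.not_isDiag _ h₂ (by simpa using hvw)
  set A := B \ ({s(v, w)} ∪ {s(v', w')}) with hA
  set G : Set (Sym2 E) := {s(v, c)} ∪ ({s(c, w)} ∪ ({s(v', c)} ∪ {s(c, w')})) with hG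
  have hGcases : ∀ e ∈ G, (e = s(v, c) ∨ e = s(c, w)) ∨ (e = s(v', c) ∨ e = s(c, w')) := by
    rintro e (rfl | rfl | rfl | rfl) <;> simp
  -- `parent e' e` relates a new bar to the old bar that contains it. New bars meeting at an inner
  -- point have different parents, so every incidence among new bars comes from one among old bars.
  set parent : Sym2 E → Sym2 E → Prop := fun e' e =>
    (e' ∈ A ∧ e' = e) ∨ (e = s(v, w) ∧ (e' = s(v, c) ∨ e' = s(c, w))) ∨
      (e = s(v', w') ∧ (e' = s(v', c) ∨ e' = s(c, w'))) with hparent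
  have hex : ∀ e' ∈ A ∪ G, ∃ e ∈ B, parent e' e := by
    rintro e' (he | he)
    · exact ⟨e', he.1, Or.inl ⟨he, rfl⟩⟩
    · rcases hGcases e' he with he | he
      · exact ⟨_, h₁, Or.inr (Or.inl ⟨rfl, he⟩)⟩
      · exact ⟨_, h₂, Or.inr (Or.inr ⟨rfl, he⟩)⟩
  have hsub : ∀ e' e, parent e' e → openBar e' ⊆ openBar e := by
    rintro e' e (⟨-, rfl⟩ | ⟨rfl, rfl | rfl⟩ | ⟨rfl, rfl | rfl⟩)
    · exact subset_rfl
    · exact openSegment_subset_left hc₁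
    · exact openSegment_subset_right hc₁
    · exact openSegment_subset_left hc₂
    · exact openSegment_subset_right hc₂
  have hdisj : ∀ e' e'' e, parent e' e → parent e'' e → e' ≠ e'' → ∀ y, y ∈ openBar e' →
      y ∉ openBar e'' := by
    have hA1 : s(v, w) ∉ A := by simp [hA]
    have hA2 : s(v', w') ∉ A := by simp [hA]
    have hd1 : ∀ y, y ∈ openSegment ℝ v c → y ∉ openSegment ℝ c w :=
      fun y hy => notMem_openSegment_of_mem_openSegment hvw hc₁ hy
    have hd2 : ∀ y, y ∈ openSegment ℝ v' c → y ∉ openSegment ℝ c w' :=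
      fun y hy => notMem_openSegment_of_mem_openSegment hvw' hc₂ hy
    rintro e' e'' e (⟨h', rfl⟩ | ⟨rfl, h'⟩ | ⟨rfl, h'⟩) (⟨h'', h3⟩ | ⟨h3, h''⟩ | ⟨h3, h''⟩) hn y hy hy'
    · exact hn h3.symm
    · exact hA1 (h3 ▸ h')
    · exact hA2 (h3 ▸ h')
    · exact hA1 (h3 ▸ h'')
    · rcases h' with rfl | rfl <;> rcases h'' with rfl | rfl
      · exact hn rfl
      · exact hd1 y hy hy'
      · exact hd1 y hy' hy
      · exact hn rfl
    · exact hne h3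
    · exact hA2 (h3 ▸ h'')
    · exact hne h3.symm
    · rcases h' with rfl | rfl <;> rcases h'' with rfl | rfl
      · exact hn rfl
      · exact hd2 y hy hy'
      · exact hd2 y hy' hy
      · exact hn rfl
  have hpar_ne : ∀ e' e'' e₁ e₂ y, parent e' e₁ → parent e'' e₂ → e' ≠ e'' → y ∈ openBar e' →
      y ∈ openBar e'' → e₁ ≠ e₂ := by
    rintro e' e'' e₁ e₂ y hp' hp'' hn hy hy' rfl
    exact hdisj e' e'' e₁ hp' hp'' hn y hy hy'
  have hcnot : ∀ e' ∈ A ∪ G, c ∉ openBar e' := by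
    rintro e' (he | he) hce
    · have hn : e' ≠ s(v, w) ∧ e' ≠ s(v', w') := by
        have := he.2
        simpa [not_or, and_comm] using this
      -- Here the absence of triple crossings is used: no third bar runs through the new node.
      exact h.notMem_of_mem_of_mem _ h₁ _ h₂ e' he.1 hne hn.1.symm hn.2.symm c hc₁ hc₂ hce
    · rcases hGcases e' he with (rfl | rfl) | (rfl | rfl)
      · exact hcO ((right_mem_openSegment_iff.1 hce : v = c) ▸ hv)
      · exact hcO ((left_mem_openSegment_iff.1 hce : c = w) ▸ hw)
      · exact hcO ((right_mem_openSegment_iff.1 hce : v' = c) ▸ hv')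
      · exact hcO ((left_mem_openSegment_iff.1 hce : c = w') ▸ hw')
  have hends : ∀ e ∈ A ∪ G, ∀ p ∈ e, p = c ∨ ∃ e' ∈ B, p ∈ e' := by
    rintro e (he | he) p hp
    · exact Or.inr ⟨e, he.1, hp⟩
    · have hcase : p = c ∨ p ∈ s(v, w) ∨ p ∈ s(v', w') := by
        rcases hGcases e he with (rfl | rfl) | (rfl | rfl) <;>
          rcases Sym2.mem_iff.1 hp with rfl | rfl <;> simp
      rcases hcase with rfl | hp | hp
      · exact Or.inl rfl
      · exact Or.inr ⟨_, h₁, hp⟩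
      · exact Or.inr ⟨_, h₂, hp⟩
  refine ⟨A ∪ G, hcO, ⟨h.finite_nodes.insert c, ?_, ?_, ?_, ?_, ?_⟩, ?_, hends, ?_⟩
  · exact (h.finite.subset Set.sdiff_subset).union (by simp [hG])
  · rintro e (he | he)
    · exact h.not_isDiag e he.1
    · rcases hGcases e he with (rfl | rfl) | (rfl | rfl) <;> rw [Sym2.mk_isDiag_iff] <;>
        rintro rfl <;> contradiction
  · intro e he p hp
    rcases hends e he p hp with rfl | ⟨e', he', hp'⟩
    · exact Or.inl rfl
    · exact Or.inr (h.mem_nodes e' he' p hp')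
  · rintro e he p (rfl | hp) hpe
    · exact hcnot e he hpe
    · obtain ⟨e', he', hpar⟩ := hex e he
      exact h.notMem_openBar e' he' p hp (hsub e e' hpar hpe)
  · intro e₁ he₁ e₂ he₂ e₃ he₃ h12 h13 h23 y hy₁ hy₂ hy₃
    obtain ⟨p₁, hp₁, q₁⟩ := hex e₁ he₁
    obtain ⟨p₂, hp₂, q₂⟩ := hex e₂ he₂
    obtain ⟨p₃, hp₃, q₃⟩ := hex e₃ he₃
    exact h.notMem_of_mem_of_mem p₁ hp₁ p₂ hp₂ p₃ hp₃
      (hpar_ne e₁ e₂ p₁ p₂ y q₁ q₂ h12 hy₁ hy₂) (hpar_ne e₁ e₃ p₁ p₃ y q₁ q₃ h13 hy₁ hy₃)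
      (hpar_ne e₂ e₃ p₂ p₃ y q₂ q₃ h23 hy₂ hy₃) y (hsub _ _ q₁ hy₁) (hsub _ _ q₂ hy₂)
      (hsub _ _ q₃ hy₃)
  · rintro y ⟨e₁, he₁, e₂, he₂, h12, hy₁, hy₂⟩
    obtain ⟨p₁, hp₁, q₁⟩ := hex e₁ he₁
    obtain ⟨p₂, hp₂, q₂⟩ := hex e₂ he₂
    refine ⟨⟨p₁, hp₁, p₂, hp₂, hpar_ne e₁ e₂ p₁ p₂ y q₁ q₂ h12 hy₁ hy₂, hsub _ _ q₁ hy₁,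
      hsub _ _ q₂ hy₂⟩, ?_⟩
    rintro rfl
    exact hcnot e₁ he₁ hy₁
  · rw [supportable_union_inf fun e he => h.mem_nodes e he.1]
    obtain ⟨t, ht0, ht1, ht⟩ := mem_openSegment_iff_exists.1 hc₁
    obtain ⟨t', ht0', ht1', ht'⟩ := mem_openSegment_iff_exists.1 hc₂
    rw [hG, supportable_crossing_inf ht0.ne' (by linarith) ht0'.ne' (by linarith) hv hw hv' hw' hcO
      ht ht' (h.linearIndependent h₁ h₂ hne hc₁ hc₂), ← supportable_union, hA, Set.sdiff_union_of_subset]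
    rintro e (rfl | rfl) <;> assumption

end GeneralPosition

/-! ### Making a plane framework free of crossings. -/

section Planarization

/-- Being off the line `a c` gives `β ≠ 0`, and being off the line `b c` gives `1 - β - γ ≠ 0`.
Their product is the coefficient of the bar `a b` in the self-stress, by which one has to divide. -/
theorem exists_affine_coordinates {E : Type} [AddCommGroup E] [Module ℝ E]
    (hfin : Module.finrank ℝ E = 2) {a b c e : E} (hb : b ≠ a)
    (hc : c - a ∉ Submodule.span ℝ {b - a}) (hac : e - a ∉ Submodule.span ℝ {c - a})
    (hbc : e - b ∉ Submodule.span ℝ {c - b}) :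
    ∃ β γ : ℝ, e = (1 - β - γ) • a + β • b + γ • c ∧ (1 - β - γ) * β ≠ 0 := by
  have hli : LinearIndependent ℝ ![b - a, c - a] := by
    rw [LinearIndependent.pair_iff' (sub_ne_zero.2 hb)]
    intro k hk
    exact hc (Submodule.mem_span_singleton.2 ⟨k, hk⟩)
  have : FiniteDimensional ℝ E := FiniteDimensional.of_finrank_pos (by omega)
  have hspan := hli.span_eq_top_of_card_eq_finrank' (by simp [hfin])
  have hmem : e - a ∈ Submodule.span ℝ (Set.range ![b - a, c - a]) := hspan ▸ Submodule.mem_top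
  obtain ⟨k, hk⟩ := (Submodule.mem_span_range_iff_exists_fun ℝ).1 hmem
  simp only [Fin.sum_univ_two, Matrix.cons_val_zero, Matrix.cons_val_one] at hk
  refine ⟨k 0, k 1, by linear_combination (norm := module) -hk, mul_ne_zero ?_ ?_⟩
  · intro h
    apply hbc
    rw [Submodule.mem_span_singleton]
    refine ⟨k 1, ?_⟩
    have h0 : k 0 = 1 - k 1 := by linarith
    rw [h0] at hk
    linear_combination (norm := module) hk
  · intro h
    apply hac
    rw [Submodule.mem_span_singleton]
    refine ⟨k 1, ?_⟩
    rw [h, zero_smul, zero_add] at hk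
    exact hk

/-- The self-stress of four points in a plane. -/
theorem barLoad_self_stress {E : Type} [AddCommGroup E] [Module ℝ E] {a b c e : E} {β γ : ℝ}
    (he : e = (1 - β - γ) • a + β • b + γ • c) :
    ((1 - β - γ) * β) • barLoad a b = (1 - β - γ) • barLoad a e + β • barLoad b e +
      γ • barLoad c e - ((1 - β - γ) * γ) • barLoad a c - (β * γ) • barLoad b c := by
  -- If the weights `l p` satisfy `∑ l p = 0` and `∑ l p • p = 0`, the tensions `l p * l q` are in
  -- equilibrium. Here the weights are `1 - β - γ`, `β`, `γ` and `-1`. Only the force slot is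
  -- linear, so the affine relation `he` is used once for each position.
  have hb : ∀ p q : E, barLoad p q = Finsupp.lsingle (R := ℝ) p p - Finsupp.lsingle (R := ℝ) p q -
      Finsupp.lsingle (R := ℝ) q p + Finsupp.lsingle (R := ℝ) q q := by
    intro p q
    simp only [Finsupp.lsingle_apply, barLoad, Finsupp.single_sub]
    abel
  have h : ∀ p : E, Finsupp.lsingle (R := ℝ) p e = (1 - β - γ) • Finsupp.lsingle (R := ℝ) p a +
      β • Finsupp.lsingle (R := ℝ) p b + γ • Finsupp.lsingle (R := ℝ) p c := by
    intro p
    nth_rw 1 [he]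
    simp only [map_add, map_smul]
  simp only [hb]
  linear_combination (norm := module) (1 - β - γ) • h a + β • h b + γ • h c - h e

theorem isBalanced_of_mem_supportable {E : Type} [AddCommGroup E] [Module ℝ E] {B : Set (Sym2 E)}
    {ρ : E →₀ E} (hρ : ρ ∈ supportable B) : IsBalanced ρ := by
  induction hρ using Submodule.span_induction with
  | mem x hx =>
    obtain ⟨s, -, rfl⟩ := hx
    induction s with | _ p q => exact isBalanced_barLoad p q
  | zero => exact isBalanced_zero
  | add x y _ _ hx hy => exact hx.add hy
  | smul k x _ hx => exact hx.smul k

/-- Any supportable load is balanced, so one that lives on `a` and `b` is a multiple of `barLoad a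
b`. Conversely the self-stress of the four points expresses `barLoad a b` by the other five bars. -/
theorem supportable_lens_inf {E : Type} [AddCommGroup E] [Module ℝ E]
    (hfin : Module.finrank ℝ E = 2) {O : Set E} {a b c e : E} (ha : a ∈ O) (hbO : b ∈ O)
    (hcO : c ∉ O) (heO : e ∉ O) (hb : b ≠ a)
    (hc : c - a ∉ Submodule.span ℝ {b - a}) (hac : e - a ∉ Submodule.span ℝ {c - a})
    (hbc : e - b ∉ Submodule.span ℝ {c - b}) :
    supportable ((fun p => s(p, c)) '' {a, b} ∪ (fun p => s(p, e)) '' {a, b, c}) ⊓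
      Finsupp.supported E ℝ O = Submodule.span ℝ {barLoad a b} := by
  set G := (fun p => s(p, c)) '' {a, b} ∪ (fun p => s(p, e)) '' {a, b, c} with hG
  have hGmem : ∀ s ∈ G, s = s(a, c) ∨ s = s(b, c) ∨ s = s(a, e) ∨ s = s(b, e) ∨ s = s(c, e) := by
    rintro s (⟨p, rfl | rfl, rfl⟩ | ⟨p, rfl | rfl | rfl, rfl⟩) <;> simp
  apply le_antisymm
  · rintro ρ ⟨hρ, hρO⟩
    have hbal := isBalanced_of_mem_supportable hρ
    obtain ⟨k, rfl⟩ := eq_smul_barLoad_of_isBalanced hb.symm (by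
      rw [Finsupp.mem_supported']
      intro p hp
      by_cases hpO : p ∈ O
      · refine apply_eq_zero_of_mem_supportable hρ fun s hs hps => ?_
        have hpc : p ≠ c := by rintro rfl; exact hcO hpO
        have hpe : p ≠ e := by rintro rfl; exact heO hpO
        simp only [Set.mem_insert_iff, Set.mem_singleton_iff, not_or] at hp
        rcases hGmem s hs with rfl | rfl | rfl | rfl | rfl <;> simp_all
      · exact (Finsupp.mem_supported' ℝ ρ).1 hρO p hpO) hbal
    exact Submodule.smul_mem _ _ (Submodule.mem_span_singleton_self _)
  · rw [Submodule.span_singleton_le_iff_mem]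
    constructor
    · obtain ⟨β, γ, he, hne⟩ := exists_affine_coordinates hfin hb hc hac hbc
      have h := barLoad_self_stress he
      rw [SetLike.mem_coe, ← inv_smul_smul₀ hne (barLoad a b), h]
      refine Submodule.smul_mem _ _ (sub_mem (sub_mem (add_mem (add_mem ?_ ?_) ?_) ?_) ?_) <;>
        refine Submodule.smul_mem _ _ (barLoad_mem_supportable ?_)
      · exact Or.inr ⟨a, by simp, rfl⟩
      · exact Or.inr ⟨b, by simp, rfl⟩
      · exact Or.inr ⟨c, by simp, rfl⟩
      · exact Or.inl ⟨a, by simp, rfl⟩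
      · exact Or.inl ⟨b, by simp, rfl⟩
    · rw [SetLike.mem_coe, Finsupp.mem_supported']
      exact fun p hp => barLoad_apply_of_ne (by rintro rfl; exact hp ha) (by rintro rfl; exact hp hbO)

theorem InGeneralPosition.exists_generic_point
    {O U : Set (EuclideanSpace ℝ (Fin 2))} {B : Set (Sym2 (EuclideanSpace ℝ (Fin 2)))}
    (h : InGeneralPosition O B) (hU : IsOpen U) (hUne : U.Nonempty) :
    ∃ D ∈ U, D ∉ O ∧
      ∀ p ∈ O, ∀ c ∈ O ∪ crossings B, p ≠ c → D - p ∉ Submodule.span ℝ {c - p} := by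
  classical
  have hfin : (O ×ˢ (O ∪ crossings B)).Finite :=
    h.finite_nodes.prod (h.finite_nodes.union h.finite_crossings)
  have : Finite ↥(O ×ˢ (O ∪ crossings B)) := hfin
  have hA : ∀ k : ↥(O ×ˢ (O ∪ crossings B)),
      AffineSubspace.mk' k.1.1 (Submodule.span ℝ {k.1.2 - k.1.1}) ≠ ⊤ := fun k => by
    have h := AffineSubspace.mk'_span_ne_top k.1.1 {k.1.2 - k.1.1} (by simp)
    rwa [Finset.coe_singleton] at h
  obtain ⟨D, hDU, hDO, hD⟩ :=
    exists_mem_open_notMem_affineSubspace (by norm_num) hA h.finite_nodes hU hUne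
  refine ⟨D, hDU, hDO, fun p hp c hc _ => ?_⟩
  have := hD ⟨(p, c), hp, hc⟩
  simpa only [AffineSubspace.mem_mk', vsub_eq_sub] using this

/-- A bar can be replaced by five bars connecting its ends with two new nodes in general
position. -/
theorem InGeneralPosition.exists_add_bar
    {O U : Set (EuclideanSpace ℝ (Fin 2))} {B : Set (Sym2 (EuclideanSpace ℝ (Fin 2)))}
    (h : InGeneralPosition O B) (hU : IsOpen U) {a b : EuclideanSpace ℝ (Fin 2)} (hab : a ≠ b)
    (haO : a ∈ O) (hbO : b ∈ O) (haU : a ∈ U) (hbU : b ∈ U) :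
    ∃ O' B', O ⊆ O' ∧ InGeneralPosition O' B' ∧
      (∀ s ∈ B', ∀ p ∈ s, (∃ s' ∈ B, p ∈ s') ∨ p ∈ U ∧ (p = a ∨ p = b ∨ p ∉ O)) ∧
      supportable B' ⊓ Finsupp.supported _ ℝ O =
        supportable B ⊔ Submodule.span ℝ {barLoad a b} := by
  -- The nodes `c` and `e` are chosen in turn off all lines through present nodes and crossings.
  -- This preserves general position and also keeps the quadrilateral nondegenerate.
  obtain ⟨c, hcU, hcO, hc⟩ := h.exists_generic_point hU ⟨a, haU⟩
  have hP : ({a, b} : Set (EuclideanSpace ℝ (Fin 2))) ⊆ O := by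
    rintro p (rfl | rfl) <;> assumption
  have h' := h.insert_node hcO hc hP
  obtain ⟨e, heU, heO, he⟩ := h'.exists_generic_point hU ⟨a, haU⟩
  have hP' : ({a, b, c} : Set (EuclideanSpace ℝ (Fin 2))) ⊆ insert c O := by
    rintro p (rfl | rfl | rfl)
    exacts [Or.inr haO, Or.inr hbO, Or.inl rfl]
  have h'' := h'.insert_node heO he hP'
  have hac : a ≠ c := by rintro rfl; exact hcO haO
  have hbc : b ≠ c := by rintro rfl; exact hcO hbO
  have heO' : e ∉ O := fun h => heO (Or.inr h)
  refine ⟨_, _, fun p hp => Or.inr (Or.inr hp), h'', ?_, ?_⟩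
  · rintro s ((hs | ⟨p, hp, rfl⟩) | ⟨p, hp, rfl⟩) r hr
    · exact Or.inl ⟨s, hs, hr⟩
    · right
      rcases Sym2.mem_iff.1 hr with rfl | rfl
      · rcases hp with rfl | rfl
        · exact ⟨haU, Or.inl rfl⟩
        · exact ⟨hbU, Or.inr (Or.inl rfl)⟩
      · exact ⟨hcU, Or.inr (Or.inr hcO)⟩
    · right
      rcases Sym2.mem_iff.1 hr with rfl | rfl
      · rcases hp with rfl | rfl | rfl
        · exact ⟨haU, Or.inl rfl⟩
        · exact ⟨hbU, Or.inr (Or.inl rfl)⟩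
        · exact ⟨hcU, Or.inr (Or.inr hcO)⟩
      · exact ⟨heU, Or.inr (Or.inr heO')⟩
  · rw [Set.union_assoc, supportable_union_inf h.mem_nodes]
    rw [supportable_lens_inf (by simp) haO hbO hcO heO' hab.symm]
    · exact hc a haO b (Or.inl hbO) hab
    · exact he a (Or.inr haO) c (Or.inl (Or.inl rfl)) hac
    · exact he b (Or.inr hbO) c (Or.inl (Or.inl rfl)) hbc

theorem exists_inGeneralPosition {Z S U : Set (EuclideanSpace ℝ (Fin 2))} (hZ : Z.Finite)
    (hS : S.Finite) (hU : IsOpen U) {B₀ : Set (Sym2 (EuclideanSpace ℝ (Fin 2)))} (hB₀ : B₀.Finite)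
    (hdiag : ∀ e ∈ B₀, ¬ e.IsDiag) (hnode : ∀ e ∈ B₀, ∀ p ∈ e, p ∈ Z ∧ p ∈ U) :
    ∃ O B, Z ∪ S ⊆ O ∧ InGeneralPosition O B ∧ (∀ e ∈ B, ∀ p ∈ e, p ∈ U ∧ (p ∈ Z ∨ p ∉ S)) ∧
      supportable B ⊓ Finsupp.supported _ ℝ Z = supportable B₀ := by
  -- The node set starts as `Z ∪ S`, so nodes created later avoid `S`, and bars never pass through a
  -- point of `Z` or `S`.
  induction B₀, hB₀ using Set.Finite.induction_on with
  | empty =>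
    refine ⟨Z ∪ S, ∅, subset_rfl, ⟨hZ.union hS, Set.finite_empty, ?_, ?_, ?_, ?_⟩, ?_, ?_⟩ <;>
      simp [supportable]
  | @insert e B₀ _ _ ih =>
    obtain ⟨O, B, hO, hB, hBn, hsup⟩ := ih (fun e he => hdiag e (Or.inr he))
      (fun e he => hnode e (Or.inr he))
    have hd := hdiag e (Or.inl rfl)
    have hn := hnode e (Or.inl rfl)
    clear hdiag hnode
    induction e with | _ a b => ?_
    have hab : a ≠ b := fun h => hd (by simpa using h)
    have ha := hn a (by simp)
    have hb := hn b (by simp)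
    obtain ⟨O', B', hOO', hB', hB'n, hsup'⟩ := hB.exists_add_bar hU hab (hO (Or.inl ha.1))
      (hO (Or.inl hb.1)) ha.2 hb.2
    refine ⟨O', B', hO.trans hOO', hB', ?_, ?_⟩
    · intro s hs p hp
      rcases hB'n s hs p hp with ⟨s', hs', hp'⟩ | ⟨hpU, rfl | rfl | hpO⟩
      · exact hBn s' hs' p hp'
      · exact ⟨ha.2, Or.inl ha.1⟩
      · exact ⟨hb.2, Or.inl hb.1⟩
      · exact ⟨hpU, Or.inr fun hpS => hpO (hO (Or.inr hpS))⟩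
    · have hle : Finsupp.supported (EuclideanSpace ℝ (Fin 2)) ℝ Z ≤ Finsupp.supported _ ℝ O :=
        Finsupp.supported_mono fun p hp => hO (Or.inl hp)
      have hbar : Submodule.span ℝ {barLoad a b} ≤ Finsupp.supported _ ℝ Z := by
        rw [← supportable_singleton]
        refine supportable_le_supported ?_
        rintro _ rfl p hp
        exact (hn p hp).1
      rw [← inf_eq_right.2 hle, ← inf_assoc, hsup', sup_comm, sup_inf_assoc_of_le _ hbar, hsup,
        Set.insert_eq, supportable_union, supportable_singleton]

/-- Uncrossing creates no new crossing and removes one, so it terminates. Convexity of `U` is what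
keeps the crossing points in the region. -/
theorem InGeneralPosition.exists_noncrossing {E : Type} [AddCommGroup E] [Module ℝ E]
    {Z S U : Set E} (hU : Convex ℝ U) (k : ℕ) : ∀ (O : Set E) (B : Set (Sym2 E)),
    (crossings B).ncard = k → Z ∪ S ⊆ O → InGeneralPosition O B →
    (∀ e ∈ B, ∀ p ∈ e, p ∈ U ∧ (p ∈ Z ∨ p ∉ S)) →
    ∃ O' B', Z ∪ S ⊆ O' ∧ InGeneralPosition O' B' ∧ crossings B' = ∅ ∧
      (∀ e ∈ B', ∀ p ∈ e, p ∈ U ∧ (p ∈ Z ∨ p ∉ S)) ∧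
      supportable B' ⊓ Finsupp.supported E ℝ Z = supportable B ⊓ Finsupp.supported E ℝ Z := by
  induction k using Nat.strong_induction_on with
  | _ k ih =>
    intro O B hk hO hB hn
    rcases Set.eq_empty_or_nonempty (crossings B) with h0 | ⟨c, hc⟩
    · exact ⟨O, B, hO, hB, h0, hn, rfl⟩
    · obtain ⟨B', hcO, hB', hcr, hends, hsup⟩ := hB.exists_uncross hc
      have hlt : (crossings B').ncard < k := by
        rw [← hk]
        exact Set.ncard_lt_ncard (lt_of_le_of_lt hcr
          ⟨Set.sdiff_subset, fun h => (h hc).2 rfl⟩) hB.finite_crossings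
      have hcU : c ∈ U := by
        obtain ⟨e, he, -, -, -, hce, -⟩ := hc
        have hne := hn e he
        revert hne hce
        induction e with
        | _ v w =>
          intro hce hne
          exact hU.openSegment_subset (hne v (by simp)).1 (hne w (by simp)).1 hce
      obtain ⟨O'', B'', hO'', hB'', h0, hn'', hsup''⟩ := ih _ hlt (insert c O) B' rfl
        (hO.trans (Set.subset_insert _ _)) hB' (by
          intro e he p hp
          rcases hends e he p hp with rfl | ⟨e', he', hp'⟩
          · exact ⟨hcU, Or.inr fun h => hcO (hO (Or.inr h))⟩
          · exact hn e' he' p hp')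
      refine ⟨O'', B'', hO'', hB'', h0, hn'', ?_⟩
      have hle : Finsupp.supported E ℝ Z ≤ Finsupp.supported E ℝ O :=
        Finsupp.supported_mono fun p hp => hO (Or.inl hp)
      rw [hsup'', ← hsup, inf_assoc, inf_eq_right.2 hle]

/-- In the plane, bars can be replaced by bars that do not cross, without changing the loads on
the nodes in `Z` that they support. -/
theorem exists_planar {Z S U : Set (EuclideanSpace ℝ (Fin 2))} (hZ : Z.Finite)
    (hS : S.Finite) (hU : IsOpen U) (hUc : Convex ℝ U)
    {B₀ : Set (Sym2 (EuclideanSpace ℝ (Fin 2)))} (hB₀ : B₀.Finite)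
    (hdiag : ∀ e ∈ B₀, ¬ e.IsDiag) (hnode : ∀ e ∈ B₀, ∀ p ∈ e, p ∈ Z ∧ p ∈ U) :
    ∃ O B, Z ∪ S ⊆ O ∧ InGeneralPosition O B ∧ crossings B = ∅ ∧
      (∀ e ∈ B, ∀ p ∈ e, p ∈ U ∧ (p ∈ Z ∨ p ∉ S)) ∧
      supportable B ⊓ Finsupp.supported _ ℝ Z = supportable B₀ := by
  obtain ⟨O, B, hO, hB, hn, hsup⟩ := exists_inGeneralPosition hZ hS hU hB₀ hdiag hnode
  obtain ⟨O', B', hO', hB', h0, hn', hsup'⟩ :=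
    InGeneralPosition.exists_noncrossing hUc _ O B rfl hO hB hn
  exact ⟨O', B', hO', hB', h0, hn', hsup'.trans hsup⟩

end Planarization

/-! ### Linear algebra of rank-one responses. -/

section RankOne

open scoped InnerProductSpace

/-- If the bars `b i` support exactly the multiples of `F` in a subspace `P`, then, after scaling
the stiffnesses, the response with respect to `P` is of rank one. -/
theorem exists_rankOne_response {H : Type} [NormedAddCommGroup H] [InnerProductSpace ℝ H]
    [FiniteDimensional ℝ H] {ι : Type} [Fintype ι] (b : ι → H) (P : Submodule ℝ H) {F : H}
    (hF : F ≠ 0) (hP : Submodule.span ℝ (Set.range b) ⊓ P = Submodule.span ℝ {F}) :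
    ∃ κ : ℝ, 0 < κ ∧
      (∀ u, κ • ∑ i, ⟪b i, u⟫_ℝ • b i ∈ P → κ • ∑ i, ⟪b i, u⟫_ℝ • b i = ⟪F, u⟫_ℝ • F) ∧
      ∀ u₀, ∃ u, u - u₀ ∈ Pᗮ ∧ κ • ∑ i, ⟪b i, u⟫_ℝ • b i ∈ P := by
  set R := Submodule.span ℝ (Set.range b) with hR
  have hFRP : F ∈ R ⊓ P := by rw [hP]; exact Submodule.mem_span_singleton_self F
  let K : H →ₗ[ℝ] H := ∑ i, (innerₛₗ ℝ (b i)).smulRight (b i)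
  have hK : ∀ u, K u = ∑ i, ⟪b i, u⟫_ℝ • b i := fun u => by simp [K]
  have hKR : ∀ u, K u ∈ R := fun u => by
    rw [hK]
    exact sum_mem fun i _ => Submodule.smul_mem _ _ (Submodule.subset_span ⟨i, rfl⟩)
  have hKinner : ∀ u w, ⟪K u, w⟫_ℝ = ∑ i, ⟪b i, u⟫_ℝ * ⟪b i, w⟫_ℝ := fun u w => by
    rw [hK, sum_inner]
    simp only [real_inner_smul_left]
  have hsymm : K.IsSymmetric := fun u w => by
    rw [hKinner, real_inner_comm, hKinner]
    exact Finset.sum_congr rfl fun i _ => mul_comm _ _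
  have hker : LinearMap.ker K = Rᗮ := by
    ext u
    rw [LinearMap.mem_ker, Submodule.mem_orthogonal]
    constructor
    · intro hu
      have h : ∀ i, ⟪b i, u⟫_ℝ = 0 := by
        have h0 := hKinner u u
        rw [hu, inner_zero_left] at h0
        intro i
        exact mul_self_eq_zero.1 ((Finset.sum_eq_zero_iff_of_nonneg
          fun i _ => mul_self_nonneg _).1 h0.symm i (Finset.mem_univ i))
      intro r hr
      induction hr using Submodule.span_induction with
      | mem x hx => obtain ⟨i, rfl⟩ := hx; exact h i
      | zero => simp
      | add x y _ _ hx hy => rw [inner_add_left, hx, hy, add_zero]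
      | smul c x _ hx => rw [real_inner_smul_left, hx, mul_zero]
    · intro hu
      rw [hK]
      exact Finset.sum_eq_zero fun i _ => by
        rw [hu (b i) (Submodule.subset_span ⟨i, rfl⟩), zero_smul]
  have hrange : LinearMap.range K = R := by
    rw [← Submodule.orthogonal_orthogonal (LinearMap.range K), hsymm.orthogonal_range, hker,
      Submodule.orthogonal_orthogonal]
  obtain ⟨g, hg⟩ : F ∈ LinearMap.range K := hrange ▸ hFRP.1
  -- With `K g = F`, a constrained output `K u = c • F` satisfies `⟪F, u⟫ = ⟪g, K u⟫ = c * ⟪g, F⟫`.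
  -- Scaling `K` by `⟪g, F⟫ = ⟪g, K g⟫`, positive since `K g ≠ 0`, thus gives exactly `F Fᵀ`.
  have hκ : 0 < ⟪g, F⟫_ℝ := by
    rw [real_inner_comm, ← hg, hKinner]
    refine lt_of_le_of_ne (Finset.sum_nonneg fun i _ => mul_self_nonneg _) fun h => hF ?_
    rw [← hg, hK]
    refine Finset.sum_eq_zero fun i hi => ?_
    rw [mul_self_eq_zero.1 ((Finset.sum_eq_zero_iff_of_nonneg
      fun i _ => mul_self_nonneg _).1 h.symm i hi), zero_smul]
  simp only [← hK]
  refine ⟨⟪g, F⟫_ℝ, hκ, fun u hu => ?_, fun u₀ => ?_⟩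
  · have hu' : K u ∈ P := by
      have := P.smul_mem (⟪g, F⟫_ℝ)⁻¹ hu
      rwa [inv_smul_smul₀ hκ.ne'] at this
    have h : K u ∈ Submodule.span ℝ {F} := by
      rw [← hP]
      exact ⟨hKR u, hu'⟩
    obtain ⟨c, hc⟩ := Submodule.mem_span_singleton.1 h
    have h2 : ⟪F, u⟫_ℝ = c * ⟪g, F⟫_ℝ := by
      rw [← hg, hsymm g u, ← hc, real_inner_smul_right, hg]
    rw [← hc, h2, smul_smul, mul_comm]
  · have horth : (R ⊓ P)ᗮ = Rᗮ ⊔ Pᗮ := by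
      rw [← Submodule.orthogonal_orthogonal (Rᗮ ⊔ Pᗮ), ← Submodule.inf_orthogonal,
        Submodule.orthogonal_orthogonal, Submodule.orthogonal_orthogonal]
    -- This makes `u₀ - c • g` orthogonal to `F`, hence an element of `Rᗮ ⊔ Pᗮ`. The first part is
    -- invisible to `K`, and the second is an allowed change of `u₀`.
    set c := ⟪F, u₀⟫_ℝ / ⟪g, F⟫_ℝ with hc
    have hmem : u₀ - c • g ∈ Rᗮ ⊔ Pᗮ := by
      rw [← horth, hP, Submodule.mem_orthogonal_singleton_iff_inner_right, inner_sub_right,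
        real_inner_smul_right, real_inner_comm g F, hc, div_mul_cancel₀ _ hκ.ne', sub_self]
    obtain ⟨r, hr, q, hq, hrq⟩ := Submodule.mem_sup.1 hmem
    rw [← hker, LinearMap.mem_ker] at hr
    refine ⟨u₀ - q, by simpa using hq, ?_⟩
    have e : u₀ - q = c • g + r := by linear_combination (norm := module) -hrq
    rw [e, map_add, map_smul, hg, hr, add_zero]
    exact P.smul_mem _ (P.smul_mem _ hFRP.2)

end RankOne

/-! ### From bars to springs. -/

section Network

open scoped InnerProductSpace

variable {d : ℕ}

/-- The values of a load at the nodes in `W`. -/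
noncomputable def nodalLoad (W : Set (EuclideanSpace ℝ (Fin d))) :
    (EuclideanSpace ℝ (Fin d) →₀ EuclideanSpace ℝ (Fin d)) →ₗ[ℝ]
      PiLp 2 fun _ : W => EuclideanSpace ℝ (Fin d) :=
  (WithLp.linearEquiv 2 ℝ (W → EuclideanSpace ℝ (Fin d))).symm.toLinearMap ∘ₗ
    LinearMap.funLeft ℝ _ (Subtype.val : W → EuclideanSpace ℝ (Fin d)) ∘ₗ Finsupp.lcoeFun

theorem nodalLoad_apply (W : Set (EuclideanSpace ℝ (Fin d)))
    (ρ : EuclideanSpace ℝ (Fin d) →₀ EuclideanSpace ℝ (Fin d)) (v : W) :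
    nodalLoad W ρ v = ρ v := rfl

theorem inner_nodalLoad_barLoad {W : Set (EuclideanSpace ℝ (Fin d))} [Fintype W] (v w : W)
    (u : PiLp 2 fun _ : W => EuclideanSpace ℝ (Fin d)) :
    ⟪nodalLoad W (barLoad v.1 w.1), u⟫_ℝ = ⟪v.1 - w.1, u v - u w⟫_ℝ := by
  classical
  rw [PiLp.inner_apply]
  have h : ∀ (q : W) (g : EuclideanSpace ℝ (Fin d)),
      ∑ z : W, ⟪Finsupp.single q.1 g z.1, u z⟫_ℝ = ⟪g, u q⟫_ℝ := by
    intro q g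
    rw [Finset.sum_eq_single q (fun z _ hz => ?_) (by simp), Finsupp.single_eq_same]
    rw [Finsupp.single_eq_of_ne (fun h => hz (Subtype.ext h)), inner_zero_left]
  simp only [nodalLoad_apply, barLoad, Finsupp.sub_apply, inner_sub_left (Finsupp.single _ _ _),
    Finset.sum_sub_distrib, h]
  rw [inner_sub_right]

/-- The network with springs along the bars in `B`, with stiffness proportional to the square of
the length, and with mass `m` at the nodes in `M`. -/
noncomputable def barNetwork (W : Set (EuclideanSpace ℝ (Fin d)))
    (B : Set (Sym2 (EuclideanSpace ℝ (Fin d)))) {κ m : ℝ} (hκ : 0 < κ) (hm : 0 ≤ m)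
    (M : Set (EuclideanSpace ℝ (Fin d))) : SpringMassNetwork d W := by
  classical
  exact
  { pos := Subtype.val
    pos_injective := Subtype.val_injective
    stiffness := fun v w => if s(v.1, w.1) ∈ B then κ * ‖w.1 - v.1‖ ^ 2 else 0
    stiffness_symm := fun v w => by rw [Sym2.eq_swap, norm_sub_rev]
    stiffness_self := fun v => by simp
    stiffness_nonneg := fun v w => by
      split_ifs
      · positivity
      · exact le_rfl
    mass := fun v => if v.1 ∈ M then m else 0
    mass_nonneg := fun v => by
      split_ifs
      · exact hm
      · exact le_rfl }

open Classical in
theorem nodeForce_barNetwork_zero {W : Set (EuclideanSpace ℝ (Fin d))} [Fintype W]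
    {B : Set (Sym2 (EuclideanSpace ℝ (Fin d)))} {κ m : ℝ} (hκ : 0 < κ) (hm : 0 ≤ m)
    (M : Set (EuclideanSpace ℝ (Fin d))) (u : W → EuclideanSpace ℝ (Fin d)) (z : W) :
    (barNetwork W B hκ hm M).nodeForce 0 u z =
      κ • ∑ w : W, if s(z.1, w.1) ∈ B then ⟪z.1 - w.1, u z - u w⟫_ℝ • (z.1 - w.1) else 0 := by
  simp only [SpringMassNetwork.nodeForce, barNetwork, SpringMassNetwork.dir]
  rw [Finset.smul_sum]
  simp only [ne_eq, OfNat.ofNat_ne_zero, not_false_eq_true, zero_pow, zero_mul, zero_smul, sub_zero]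
  refine Finset.sum_congr rfl fun w _ => ?_
  split_ifs with h
  · by_cases hzw : w.1 - z.1 = 0
    · have : z.1 - w.1 = 0 := by rw [← neg_sub, hzw, neg_zero]
      simp [hzw, this]
    · have hn : ‖w.1 - z.1‖ ≠ 0 := norm_ne_zero_iff.2 hzw
      rw [← neg_sub w.1 z.1, inner_neg_left, neg_smul_neg, real_inner_smul_left, smul_smul, smul_smul]
      congr 1
      field_simp
  · simp

open Classical in
-- Stiffness proportional to squared length cancels the normalization of the directions, so the
-- stiffness matrix is a multiple of the sum of the squares of the bar loads. The factor `2` arises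
-- because ordered pairs count each bar twice.
theorem sum_inner_nodalLoad {W : Set (EuclideanSpace ℝ (Fin d))} [Fintype W]
    (B : Set (Sym2 (EuclideanSpace ℝ (Fin d))))
    (u : PiLp 2 fun _ : W => EuclideanSpace ℝ (Fin d)) (z : W) :
    (∑ vw : W × W, ⟪if s(vw.1.1, vw.2.1) ∈ B then nodalLoad W (barLoad vw.1.1 vw.2.1) else 0, u⟫_ℝ •
      (if s(vw.1.1, vw.2.1) ∈ B then nodalLoad W (barLoad vw.1.1 vw.2.1) else 0)) z =
    (2 : ℝ) • ∑ w : W, if s(z.1, w.1) ∈ B then ⟪z.1 - w.1, u z - u w⟫_ℝ • (z.1 - w.1) else 0 := by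
  set T : W → W → EuclideanSpace ℝ (Fin d) := fun v w =>
    if s(v.1, w.1) ∈ B then ⟪v.1 - w.1, u v - u w⟫_ℝ • (v.1 - w.1) else 0 with hT
  have hTsymm : ∀ v w, T v w = -T w v := by
    intro v w
    simp only [hT]
    rw [Sym2.eq_swap]
    split_ifs
    · rw [← neg_sub w.1 v.1, ← neg_sub (u w) (u v), inner_neg_neg, smul_neg]
    · simp
  have hterm : ∀ v w : W,
      (⟪if s(v.1, w.1) ∈ B then nodalLoad W (barLoad v.1 w.1) else 0, u⟫_ℝ •
        (if s(v.1, w.1) ∈ B then nodalLoad W (barLoad v.1 w.1) else 0)) z =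
      (if v = z then T v w else 0) - (if w = z then T v w else 0) := by
    intro v w
    simp only [hT]
    by_cases hB : s(v.1, w.1) ∈ B
    · rw [if_pos hB, if_pos hB, PiLp.smul_apply, inner_nodalLoad_barLoad, nodalLoad_apply, barLoad,
        Finsupp.sub_apply, Finsupp.single_apply, Finsupp.single_apply, smul_sub, smul_ite, smul_ite,
        smul_zero]
      simp only [Subtype.coe_inj]
    · simp only [if_neg hB, smul_zero, ite_self, sub_zero, PiLp.zero_apply]
  rw [WithLp.ofLp_sum, Finset.sum_apply, Fintype.sum_prod_type]
  simp only [hterm, Finset.sum_sub_distrib]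
  have h1 : ∑ v : W, ∑ w : W, (if v = z then T v w else 0) = ∑ w, T z w := by
    rw [Finset.sum_comm]
    simp
  have h2 : ∑ v : W, ∑ w : W, (if w = z then T v w else 0) = -∑ w, T z w := by
    simp only [Finset.sum_ite_eq', Finset.mem_univ, if_true]
    rw [← Finset.sum_neg_distrib]
    exact Finset.sum_congr rfl fun v _ => hTsymm v z
  rw [h1, h2]
  module

theorem span_nodalLoad_inf {W X : Set (EuclideanSpace ℝ (Fin d))}
    {B : Set (Sym2 (EuclideanSpace ℝ (Fin d)))} (hBW : ∀ e ∈ B, ∀ p ∈ e, p ∈ W)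
    {F : EuclideanSpace ℝ (Fin d) →₀ EuclideanSpace ℝ (Fin d)}
    (hF : supportable B ⊓ Finsupp.supported _ ℝ X = Submodule.span ℝ {F})
    {P : Submodule ℝ (PiLp 2 fun _ : W => EuclideanSpace ℝ (Fin d))}
    (hP : ∀ h, h ∈ P ↔ ∀ v : W, v.1 ∉ X → h v = 0) :
    (supportable B).map (nodalLoad W) ⊓ P = Submodule.span ℝ {nodalLoad W F} := by
  have hFmem : F ∈ supportable B ⊓ Finsupp.supported _ ℝ X := by
    rw [hF]; exact Submodule.mem_span_singleton_self F
  apply le_antisymm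
  · rintro h ⟨⟨ρ, hρ, rfl⟩, hhP⟩
    have hρX : ρ ∈ Finsupp.supported (EuclideanSpace ℝ (Fin d)) ℝ X := by
      rw [Finsupp.mem_supported']
      intro p hp
      by_cases hpW : p ∈ W
      · exact (hP _).1 hhP ⟨p, hpW⟩ hp
      · exact (Finsupp.mem_supported' ℝ ρ).1 (supportable_le_supported hBW hρ) p hpW
    have h : ρ ∈ Submodule.span ℝ {F} := by
      rw [← hF]
      exact ⟨hρ, hρX⟩
    obtain ⟨c, rfl⟩ := Submodule.mem_span_singleton.1 h
    rw [map_smul]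
    exact Submodule.smul_mem _ _ (Submodule.mem_span_singleton_self _)
  · rw [Submodule.span_singleton_le_iff_mem]
    exact ⟨⟨F, hFmem.1, rfl⟩, (hP _).2 fun v hv => (Finsupp.mem_supported' ℝ F).1 hFmem.2 v.1 hv⟩

/-- A collection of bars supporting only the multiples of `F` is turned into a network with static
response `F Fᵀ`. -/
theorem exists_barNetwork_response {W X : Set (EuclideanSpace ℝ (Fin d))} [Fintype W]
    {B : Set (Sym2 (EuclideanSpace ℝ (Fin d)))} (hBW : ∀ e ∈ B, ∀ p ∈ e, p ∈ W) (hXW : X ⊆ W)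
    {F : EuclideanSpace ℝ (Fin d) →₀ EuclideanSpace ℝ (Fin d)} (hF0 : F ≠ 0)
    (hF : supportable B ⊓ Finsupp.supported _ ℝ X = Submodule.span ℝ {F}) :
    ∃ (κ : ℝ) (hκ : 0 < κ), ∀ (m : ℝ) (hm : 0 ≤ m) (M : Set (EuclideanSpace ℝ (Fin d))),
      (∀ u : W → EuclideanSpace ℝ (Fin d),
        (∀ v : W, v.1 ∉ X → (barNetwork W B hκ hm M).nodeForce 0 u v = 0) →
        ∀ v, (barNetwork W B hκ hm M).nodeForce 0 u v = (∑ w : W, ⟪F w, u w⟫_ℝ) • F v) ∧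
      ∀ u₀ : W → EuclideanSpace ℝ (Fin d), ∃ u : W → EuclideanSpace ℝ (Fin d),
        (∀ v : W, v.1 ∈ X → u v = u₀ v) ∧
        ∀ v : W, v.1 ∉ X → (barNetwork W B hκ hm M).nodeForce 0 u v = 0 := by
  classical
  let P : Submodule ℝ (PiLp 2 fun _ : W => EuclideanSpace ℝ (Fin d)) :=
    { carrier := {h | ∀ v : W, v.1 ∉ X → h v = 0}
      add_mem' := fun {a b} ha hb v hv => by simp [ha v hv, hb v hv]
      zero_mem' := fun v _ => rfl
      smul_mem' := fun c a ha v hv => by simp [ha v hv] }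
  have hP : ∀ h, h ∈ P ↔ ∀ v : W, v.1 ∉ X → h v = 0 := fun h => Iff.rfl
  let b : W × W → PiLp 2 fun _ : W => EuclideanSpace ℝ (Fin d) := fun vw =>
    if s(vw.1.1, vw.2.1) ∈ B then nodalLoad W (barLoad vw.1.1 vw.2.1) else 0
  have hspan : Submodule.span ℝ (Set.range b) = (supportable B).map (nodalLoad W) := by
    rw [supportable, Submodule.map_span]
    apply le_antisymm <;> rw [Submodule.span_le]
    · rintro _ ⟨⟨v, w⟩, rfl⟩
      simp only [b]
      split_ifs with h
      · exact Submodule.subset_span ⟨_, ⟨_, h, rfl⟩, rfl⟩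
      · exact zero_mem _
    · rintro _ ⟨_, ⟨e, he, rfl⟩, rfl⟩
      have hW := hBW e he
      revert he hW
      induction e with
      | _ p q =>
        intro he hW
        refine Submodule.subset_span ⟨(⟨p, hW p (by simp)⟩, ⟨q, hW q (by simp)⟩), ?_⟩
        simp only [b, if_pos he, edgeLoad_mk]
  have hFX : F ∈ Finsupp.supported _ ℝ X := by
    have h : F ∈ supportable B ⊓ Finsupp.supported _ ℝ X := by
      rw [hF]; exact Submodule.mem_span_singleton_self F
    exact h.2
  have hF0' : nodalLoad W F ≠ 0 := by
    intro h
    apply hF0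
    ext1 p
    by_cases hp : p ∈ X
    · have := congrArg (fun h => h ⟨p, hXW hp⟩) h
      simpa [nodalLoad_apply] using this
    · exact (Finsupp.mem_supported' ℝ F).1 hFX p hp
  obtain ⟨κ, hκ, h1, h2⟩ := exists_rankOne_response b P hF0'
    (by rw [hspan]; exact span_nodalLoad_inf hBW hF hP)
  have hforce : ∀ (m : ℝ) (hm : 0 ≤ m) (M : Set (EuclideanSpace ℝ (Fin d)))
      (u : PiLp 2 fun _ : W => EuclideanSpace ℝ (Fin d)) (v : W),
      (barNetwork W B (by positivity : 0 < κ * 2) hm M).nodeForce 0 u v =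
        (κ • ∑ i, ⟪b i, u⟫_ℝ • b i) v := by
    intro m hm M u v
    rw [nodeForce_barNetwork_zero, PiLp.smul_apply, sum_inner_nodalLoad, smul_smul]
  refine ⟨κ * 2, by positivity, fun m hm M => ⟨fun u hu v => ?_, fun u₀ => ?_⟩⟩
  · have hu' : κ • ∑ i, ⟪b i, WithLp.toLp 2 u⟫_ℝ • b i ∈ P := by
      rw [hP]
      intro v hv
      rw [← hforce m hm M]
      exact hu v hv
    have := h1 _ hu'
    have e := hforce m hm M (WithLp.toLp 2 u) v
    rw [this, PiLp.smul_apply, PiLp.inner_apply] at e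
    exact e
  · obtain ⟨u, hu, huP⟩ := h2 (WithLp.toLp 2 u₀)
    refine ⟨u, fun v hv => ?_, fun v hv => ?_⟩
    · rw [Submodule.mem_orthogonal] at hu
      -- `P` contains all vectors concentrated at a terminal, so orthogonality to `P` means that the
      -- prescribed displacement is unchanged there.
      have hs : WithLp.toLp 2 (Pi.single v (u v - u₀ v)) ∈ P := by
        rw [hP]
        intro w hw
        have hwv : w ≠ v := by rintro rfl; exact hw hv
        simp [hwv]
      have h := hu _ hs
      rw [PiLp.inner_apply, Finset.sum_eq_single v (by
        intro w _ hw
        simp [hw]) (by simp)] at h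
      simp only [Pi.single_eq_same, PiLp.sub_apply] at h
      exact sub_eq_zero.1 (inner_self_eq_zero.1 h)
    · rw [hforce m hm M]
      exact (hP _).1 huP v hv

end Network

/-! ### Adding the masses. -/

section Dynamics

open scoped InnerProductSpace

variable {d : ℕ}

theorem rankOneMatrix_mulVec_stackedVec {T : Type} [Fintype T]
    (g u : T → EuclideanSpace ℝ (Fin d)) :
    (rankOneMatrix g).mulVec (stackedVec u) = stackedVec fun i => (∑ j, ⟪g j, u j⟫_ℝ) • g i := by
  have h : stackedVec g ⬝ᵥ stackedVec u = ∑ j, ⟪g j, u j⟫_ℝ := by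
    simp only [dotProduct, stackedVec, Fintype.sum_prod_type, PiLp.inner_apply]
    exact Finset.sum_congr rfl fun i _ => Finset.sum_congr rfl fun k _ => by
      simp [mul_comm]
  rw [rankOneMatrix, Matrix.vecMulVec_mulVec, h]
  ext p
  simp [stackedVec, mul_comm]

namespace SpringMassNetwork

variable {V : Type} [Fintype V] (N : SpringMassNetwork d V)

theorem nodeForce_eq (ω : ℝ) (u : V → EuclideanSpace ℝ (Fin d)) (v : V) :
    N.nodeForce ω u v = N.nodeForce 0 u v - (ω ^ 2 * N.mass v) • u v := by
  simp [nodeForce]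

/-- The static response with respect to the terminals `t i` is `g gᵀ`. -/
structure HasRankOneResponse {T : Type} [Fintype T] (t : T → V)
    (g : T → EuclideanSpace ℝ (Fin d)) : Prop where
  force : ∀ u, (∀ v, v ∉ Set.range t → N.nodeForce 0 u v = 0) →
    ∀ i, N.nodeForce 0 u (t i) = (∑ j, ⟪g j, u (t j)⟫_ℝ) • g i
  extend : ∀ u₀ : T → EuclideanSpace ℝ (Fin d), ∃ u, (∀ i, u (t i) = u₀ i) ∧
    ∀ v, v ∉ Set.range t → N.nodeForce 0 u v = 0

variable {N}

theorem HasRankOneResponse.isResponseAt {T : Type} [Fintype T] {t : T → V}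
    {g : T → EuclideanSpace ℝ (Fin d)} (h : N.HasRankOneResponse t g) :
    N.IsResponseAt t 0 (rankOneMatrix g) := by
  refine ⟨fun ⟨uB, hu⟩ => hu (h.extend uB), fun uB u hu => ?_⟩
  rw [rankOneMatrix_mulVec_stackedVec]
  congr 1
  funext i
  rw [h.force u hu.2 i]
  simp only [hu.1]

variable {T I : Type} [Fintype T] [Fintype I] {t : T → V} {s : I → V}
  {f : T → EuclideanSpace ℝ (Fin d)} {a : I → EuclideanSpace ℝ (Fin d)} {m : ℝ}

/-- The inertial forces act as external loads on the static network at the nodes `s j`; since its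
response has rank one, a single scalar `c` governs all forces. -/
theorem HasRankOneResponse.nodeForce_of_isEquilibrium
    (h : N.HasRankOneResponse (Sum.elim t s) (Sum.elim f a))
    (hts : Function.Injective (Sum.elim t s)) (hms : ∀ j, N.mass (s j) = m)
    (hm0 : ∀ v, v ∉ Set.range s → N.mass v = 0) {ω : ℝ} {uB : T → EuclideanSpace ℝ (Fin d)}
    {u : V → EuclideanSpace ℝ (Fin d)} (hu : N.IsEquilibrium t ω uB u) :
    ∃ c, c = ∑ i, ⟪f i, uB i⟫_ℝ + ∑ j, ⟪a j, u (s j)⟫_ℝ ∧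
      (∀ i, N.nodeForce ω u (t i) = c • f i) ∧ ∀ j, c • a j = (ω ^ 2 * m) • u (s j) := by
  have hne : ∀ i j, t i ≠ s j := fun i j e => by
    have := @hts (Sum.inl i) (Sum.inr j) e
    simp at this
  have hbal : ∀ v, v ∉ Set.range (Sum.elim t s) → N.nodeForce 0 u v = 0 := by
    intro v hv
    rw [Set.Sum.elim_range, Set.mem_union, not_or] at hv
    have := hu.2 v hv.1
    rwa [nodeForce_eq, hm0 v hv.2, mul_zero, zero_smul, sub_zero] at this
  have hforce := h.force u hbal
  simp only [Fintype.sum_sum_type, Sum.elim_inl, Sum.elim_inr, hu.1] at hforce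
  refine ⟨_, rfl, fun i => ?_, fun j => ?_⟩
  · rw [nodeForce_eq, hm0 (t i) (by rintro ⟨j, e⟩; exact hne i j e.symm), mul_zero, zero_smul,
      sub_zero]
    exact hforce (Sum.inl i)
  · have h1 := hu.2 (s j) (by rintro ⟨i, e⟩; exact hne i j e)
    rw [nodeForce_eq, hms] at h1
    have h2 := hforce (Sum.inr j)
    simp only [Sum.elim_inr] at h2
    rw [← h2]
    exact sub_eq_zero.1 h1

/-- The masses are sought moving along `k • a`. Then all their equations of motion reduce to the one
scalar equation `hk`. -/
theorem HasRankOneResponse.exists_isEquilibrium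
    (h : N.HasRankOneResponse (Sum.elim t s) (Sum.elim f a))
    (hms : ∀ j, N.mass (s j) = m) (hm0 : ∀ v, v ∉ Set.range s → N.mass v = 0) {ω k : ℝ}
    {uB : T → EuclideanSpace ℝ (Fin d)}
    (hk : ∑ i, ⟪f i, uB i⟫_ℝ + k * ∑ j, ‖a j‖ ^ 2 = ω ^ 2 * m * k) :
    ∃ u, N.IsEquilibrium t ω uB u := by
  obtain ⟨u, hu, hbal⟩ := h.extend (Sum.elim uB fun j => k • a j)
  have hforce := h.force u hbal
  simp only [hu, Fintype.sum_sum_type, Sum.elim_inl, Sum.elim_inr, real_inner_smul_right,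
    real_inner_self_eq_norm_sq, ← Finset.mul_sum, hk] at hforce
  refine ⟨u, fun i => hu (Sum.inl i), fun v hv => ?_⟩
  rw [nodeForce_eq]
  by_cases hvs : v ∈ Set.range s
  · obtain ⟨j, rfl⟩ := hvs
    have h1 := hforce (Sum.inr j)
    have h2 := hu (Sum.inr j)
    simp only [Sum.elim_inr] at h1 h2
    rw [h1, h2, hms, smul_smul, sub_self]
  · rw [hm0 v hvs, mul_zero, zero_smul, sub_zero]
    refine hbal v ?_
    rw [Set.Sum.elim_range, Set.mem_union, not_or]
    exact ⟨hv, hvs⟩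

variable {ω₀ : ℝ}

/-- Pairing with `a` turns the equations of motion into `c * ω₀ ^ 2 = ω ^ 2 * (a·y)`, because the
mass is `|a|² / ω₀²`; eliminating `a·y` with `hc` finishes. -/
theorem HasRankOneResponse.mul_eq_of_isEquilibrium {c ω φ : ℝ} (hω₀ : ω₀ ≠ 0) (ha : a ≠ 0)
    {y : I → EuclideanSpace ℝ (Fin d)} (hc : c = φ + ∑ j, ⟪a j, y j⟫_ℝ)
    (h : ∀ j, c • a j = (ω ^ 2 * ((∑ l, ‖a l‖ ^ 2) / ω₀ ^ 2)) • y j) :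
    c * (ω ^ 2 - ω₀ ^ 2) = ω ^ 2 * φ := by
  have hA : 0 < ∑ l, ‖a l‖ ^ 2 := by
    obtain ⟨j, hj⟩ := Function.ne_iff.1 ha
    exact Finset.sum_pos' (fun _ _ => by positivity)
      ⟨j, Finset.mem_univ j, by have := norm_pos_iff.2 hj; positivity⟩
  have h1 : c * ∑ l, ‖a l‖ ^ 2 = ω ^ 2 * ((∑ l, ‖a l‖ ^ 2) / ω₀ ^ 2) * ∑ j, ⟪a j, y j⟫_ℝ := by
    rw [Finset.mul_sum, Finset.mul_sum Finset.univ fun j => ⟪a j, y j⟫_ℝ]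
    refine Finset.sum_congr rfl fun j _ => ?_
    rw [← real_inner_smul_right, ← h, real_inner_smul_right, real_inner_self_eq_norm_sq]
  have h2 : c * ω₀ ^ 2 = ω ^ 2 * ∑ j, ⟪a j, y j⟫_ℝ := by
    field_simp at h1
    linear_combination h1
  linear_combination ω ^ 2 * hc - h2

theorem HasRankOneResponse.isResponseAt_of_ne
    (h : N.HasRankOneResponse (Sum.elim t s) (Sum.elim f a))
    (hts : Function.Injective (Sum.elim t s)) (hω₀ : ω₀ ≠ 0) (ha : a ≠ 0)
    (hms : ∀ j, N.mass (s j) = (∑ l, ‖a l‖ ^ 2) / ω₀ ^ 2)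
    (hm0 : ∀ v, v ∉ Set.range s → N.mass v = 0) {ω : ℝ} (hω : ω ^ 2 ≠ ω₀ ^ 2) :
    N.IsResponseAt t ω ((ω ^ 2 / (ω ^ 2 - ω₀ ^ 2)) • rankOneMatrix f) := by
  have hA : 0 < ∑ l, ‖a l‖ ^ 2 := by
    obtain ⟨j, hj⟩ := Function.ne_iff.1 ha
    exact Finset.sum_pos' (fun _ _ => by positivity)
      ⟨j, Finset.mem_univ j, by have := norm_pos_iff.2 hj; positivity⟩
  have hne : ω ^ 2 - ω₀ ^ 2 ≠ 0 := sub_ne_zero.2 hω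
  constructor
  · rintro ⟨uB, hu⟩
    -- The value of `k` solves the scalar equation of motion, which is nondegenerate away from `ω ^
    -- 2 = ω₀ ^ 2`.
    refine hu (h.exists_isEquilibrium hms hm0
      (k := (∑ i, ⟪f i, uB i⟫_ℝ) * ω₀ ^ 2 / ((ω ^ 2 - ω₀ ^ 2) * ∑ l, ‖a l‖ ^ 2)) ?_)
    field_simp
    ring
  · intro uB u hu
    obtain ⟨c, hc, h1, h2⟩ := h.nodeForce_of_isEquilibrium hts hms hm0 hu
    have h3 := mul_eq_of_isEquilibrium hω₀ ha hc h2
    rw [Matrix.smul_mulVec, rankOneMatrix_mulVec_stackedVec]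
    ext p
    simp only [stackedVec, h1, Pi.smul_apply, PiLp.smul_apply, smul_eq_mul]
    have : c = ω ^ 2 / (ω ^ 2 - ω₀ ^ 2) * ∑ i, ⟪f i, uB i⟫_ℝ := by
      field_simp
      exact h3
    rw [this, mul_assoc]

theorem HasRankOneResponse.isResonance_iff
    (h : N.HasRankOneResponse (Sum.elim t s) (Sum.elim f a))
    (hts : Function.Injective (Sum.elim t s)) (hω₀ : ω₀ ≠ 0) (ha : a ≠ 0)
    (hms : ∀ j, N.mass (s j) = (∑ l, ‖a l‖ ^ 2) / ω₀ ^ 2)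
    (hm0 : ∀ v, v ∉ Set.range s → N.mass v = 0) (ω : ℝ) :
    N.IsResonance t ω ↔ f ≠ 0 ∧ ω ^ 2 = ω₀ ^ 2 := by
  constructor
  · intro hres
    refine ⟨?_, ?_⟩
    · rintro rfl
      obtain ⟨uB, hu⟩ := hres
      exact hu (h.exists_isEquilibrium hms hm0 (k := 0) (by simp))
    · by_contra hω
      exact (h.isResponseAt_of_ne hts hω₀ ha hms hm0 hω).1 hres
  · rintro ⟨hf, hω⟩
    -- Prescribing the terminal displacements `f` gives a positive forcing `f·f`, while at resonance
    -- the scalar identity would force `ω₀² (f·f) = 0`.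
    refine ⟨f, fun ⟨u, hu⟩ => ?_⟩
    obtain ⟨c, hc, -, h2⟩ := h.nodeForce_of_isEquilibrium hts hms hm0 hu
    have h3 := mul_eq_of_isEquilibrium hω₀ ha hc h2
    have hφ : 0 < ∑ i, ⟪f i, f i⟫_ℝ := by
      obtain ⟨j, hj⟩ := Function.ne_iff.1 hf
      exact Finset.sum_pos' (fun _ _ => real_inner_self_nonneg)
        ⟨j, Finset.mem_univ j, real_inner_self_pos.2 hj⟩
    rw [hω, sub_self, mul_zero] at h3
    exact (mul_pos (by positivity : 0 < ω₀ ^ 2) hφ).ne h3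

end SpringMassNetwork

end Dynamics

/-! ### Assembly of the theorem. -/

section Main

open scoped InnerProductSpace

/-- Planarization is applied with all old nodes and terminals protected, so that the loads on `X` in
particular are unchanged. -/
theorem Realizes.exists_noncrossing {S U X : Set (EuclideanSpace ℝ (Fin 2))}
    {F : EuclideanSpace ℝ (Fin 2) →₀ EuclideanSpace ℝ (Fin 2)}
    {B : Set (Sym2 (EuclideanSpace ℝ (Fin 2)))} (h : Realizes U S X F B) (hX : X.Finite)
    (hS : S.Finite) (hU : IsOpen U) (hUc : Convex ℝ U) :
    ∃ B', Realizes U S X F B' ∧ crossings B' = ∅ ∧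
      ∀ e ∈ B', ∀ z, (z ∈ X ∨ ∃ e' ∈ B', z ∈ e') → z ∉ openBar e := by
  classical
  have hZ : (X ∪ {p | ∃ e ∈ B, p ∈ e}).Finite := by
    refine hX.union ?_
    have e : {p | ∃ e ∈ B, p ∈ e} = ⋃ e ∈ B, {p | p ∈ e} := by ext; simp
    rw [e]
    exact h.finite.biUnion fun e _ => by
      have : {p | p ∈ e} = (e.toFinset : Set _) := by ext; simp
      rw [this]; exact e.toFinset.finite_toSet
  obtain ⟨O, B', hO, hB', h0, hn, hsup⟩ := exists_planar hZ hS hU hUc h.finite h.not_isDiag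
    fun e he p hp => ⟨Or.inr ⟨e, he, hp⟩, h.mem_region e he p hp⟩
  refine ⟨B', ⟨hB'.finite, hB'.not_isDiag, fun e he p hp => (hn e he p hp).1,
    fun e he p hp hpX => ?_, ?_⟩, h0, ?_⟩
  · rcases (hn e he p hp).2 with (hp' | ⟨e', he', hp'⟩) | hp'
    · exact absurd hp' hpX
    · exact h.notMem_of_notMem e' he' p hp' hpX
    · exact hp'
  · rw [← h.supportable_inf, ← hsup, inf_assoc,
      inf_eq_right.2 (Finsupp.supported_mono Set.subset_union_left)]
  · rintro e he z (hz | ⟨e', he', hz⟩)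
    · exact hB'.notMem_openBar e he z (hO (Or.inl (Or.inl hz)))
    · exact hB'.notMem_openBar e he z (hB'.mem_nodes e' he' z hz)

theorem exists_realizes_noncrossing {d : ℕ} (hd : d = 2 ∨ d = 3) {n : ℕ}
    {x f : Fin n → EuclideanSpace ℝ (Fin d)} (hx : Function.Injective x)
    {S U : Set (EuclideanSpace ℝ (Fin d))} (hS : S.Finite) (hU : IsOpen U) (hUc : Convex ℝ U)
    (hUne : U.Nonempty) (hxU : ∀ i, x i ∈ U) :
    ∃ (p a : Fin 2 → EuclideanSpace ℝ (Fin d)) (B : Set (Sym2 (EuclideanSpace ℝ (Fin d)))),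
      Function.Injective (Sum.elim x p) ∧ (∀ j, p j ∈ U ∧ p j ∉ S) ∧ a ≠ 0 ∧
      Realizes U S (Set.range (Sum.elim x p)) (pointLoad (Sum.elim x p) (Sum.elim f a)) B ∧
      (d = 2 → crossings B = ∅ ∧ ∀ e ∈ B, ∀ z,
        (z ∈ Set.range (Sum.elim x p) ∨ ∃ e' ∈ B, z ∈ e') → z ∉ openBar e) := by
  obtain ⟨p, a, B, hp, hpU, ha, hB⟩ := exists_realizes hd (f := f) hx hS hU hUne hxU
  by_cases h2 : d = 2
  · subst h2
    obtain ⟨B', hB', h⟩ := hB.exists_noncrossing (Set.finite_range _) hS hU hUc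
    exact ⟨p, a, B', hp, hpU, ha, hB', fun _ => h⟩
  · exact ⟨p, a, B, hp, hpU, ha, hB, fun h => absurd h h2⟩

section

variable {d : ℕ} {W : Set (EuclideanSpace ℝ (Fin d))} {B : Set (Sym2 (EuclideanSpace ℝ (Fin d)))}

theorem mem_of_hasSpring_barNetwork {κ m : ℝ} {hκ : 0 < κ} {hm : 0 ≤ m}
    {M : Set (EuclideanSpace ℝ (Fin d))} {v w : W}
    (h : (barNetwork W B hκ hm M).HasSpring v w) : s(v.1, w.1) ∈ B := by
  by_contra hB
  simp [SpringMassNetwork.HasSpring, barNetwork, hB] at h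

theorem nonCrossing_barNetwork {κ m : ℝ} (hκ : 0 < κ) (hm : 0 ≤ m)
    (M : Set (EuclideanSpace ℝ (Fin d))) (h0 : crossings B = ∅)
    (h : ∀ e ∈ B, ∀ z ∈ W, z ∉ openBar e) : (barNetwork W B hκ hm M).NonCrossing := by
  refine ⟨fun v w hvw z => h _ (mem_of_hasSpring_barNetwork hvw) z.1 z.2,
    fun v w v' w' hvw hvw' hne => ?_⟩
  rw [Set.disjoint_left]
  intro c hc hc'
  have : c ∈ crossings B := ⟨_, mem_of_hasSpring_barNetwork hvw, _,
    mem_of_hasSpring_barNetwork hvw', fun e => hne ?_, hc, hc'⟩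
  · rwa [h0] at this
  · exact Sym2.map.injective Subtype.val_injective (by simpa using e)

theorem exists_hasRankOneResponse_barNetwork [Fintype W] {T : Type} [Fintype T] {t : T → W}
    (ht : Function.Injective t) (hBW : ∀ e ∈ B, ∀ p ∈ e, p ∈ W)
    {g : T → EuclideanSpace ℝ (Fin d)} (hg : g ≠ 0)
    (hB : supportable B ⊓ Finsupp.supported _ ℝ (Set.range fun i => (t i).1) =
      Submodule.span ℝ {pointLoad (fun i => (t i).1) g}) :
    ∃ (κ : ℝ) (hκ : 0 < κ), ∀ (m : ℝ) (hm : 0 ≤ m) (M : Set (EuclideanSpace ℝ (Fin d))),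
      (barNetwork W B hκ hm M).HasRankOneResponse t g := by
  have htv : Function.Injective fun i => (t i).1 := Subtype.val_injective.comp ht
  have hmem : ∀ v : W, v.1 ∈ Set.range (fun i => (t i).1) ↔ v ∈ Set.range t := fun v =>
    ⟨fun ⟨i, hi⟩ => ⟨i, Subtype.ext hi⟩, fun ⟨i, hi⟩ => ⟨i, congrArg Subtype.val hi⟩⟩
  have hF0 : pointLoad (fun i => (t i).1) g ≠ 0 := fun h => hg <| funext fun i => by
    have := pointLoad_apply (g := g) htv i
    rwa [h, Finsupp.zero_apply, eq_comm] at this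
  obtain ⟨κ, hκ, h⟩ := exists_barNetwork_response hBW
    (by rintro _ ⟨i, rfl⟩; exact (t i).2) hF0 hB
  refine ⟨κ, hκ, fun m hm M => ⟨fun u hu i => ?_, fun u₀ => ?_⟩⟩
  · rw [(h m hm M).1 u (fun v hv => hu v fun h => hv ((hmem v).2 h)) (t i), pointLoad_apply htv i]
    congr 1
    symm
    refine Fintype.sum_of_injective t ht _ _ (fun v hv => ?_) fun j => ?_
    · rw [pointLoad_apply_of_notMem (fun h => hv ((hmem v).1 h)), inner_zero_left]
    · rw [pointLoad_apply htv j]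
  · obtain ⟨u, h1, h2⟩ := (h m hm M).2 (Function.extend t u₀ 0)
    refine ⟨u, fun i => ?_, fun v hv => h2 v fun h => hv ((hmem v).1 h)⟩
    rw [h1 (t i) ⟨i, rfl⟩, ht.extend_apply]

end

theorem mainTheorem6 (d : ℕ) (hd : d = 2 ∨ d = 3) (n : ℕ) (hn : 0 < n)
    (x : Fin n → EuclideanSpace ℝ (Fin d)) (hx : Function.Injective x)
    (f : Fin n → EuclideanSpace ℝ (Fin d)) (ω₀ : ℝ) (hω₀ : ω₀ ≠ 0)
    (ε : ℝ) (hε : 0 < ε) (S : Finset (EuclideanSpace ℝ (Fin d))) :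
    ∃ (V : Type) (_ : Fintype V) (N : SpringMassNetwork d V) (t : Fin n → V),
      (∀ i, N.pos (t i) = x i) ∧
      -- if `d = 2`, the network is planar
      (d = 2 → N.NonCrossing) ∧
      -- location of the interior nodes
      (∀ v, v ∉ Set.range t →
        N.pos v ∈ Metric.cthickening ε (convexHull ℝ (Set.range x)) ∧ N.pos v ∉ S) ∧
      -- the response function
      (∀ ω : ℝ, ω ^ 2 ≠ ω₀ ^ 2 →
        N.IsResponseAt t ω ((ω ^ 2 / (ω ^ 2 - ω₀ ^ 2)) • rankOneMatrix f)) ∧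
      -- zero static response
      N.IsResponseAt t 0 0 ∧
      -- the resonance frequencies
      (∀ ω : ℝ, N.IsResonance t ω ↔ f ≠ 0 ∧ ω ^ 2 = ω₀ ^ 2) ∧
      -- exactly two nodes carry mass, both interior, with equal masses; with them as additional
      -- terminals the static response has rank one
      ∃ (s : Fin 2 → V) (a : Fin 2 → EuclideanSpace ℝ (Fin d)),
        Function.Injective (Sum.elim t s) ∧ a ≠ 0 ∧
        N.IsResponseAt (Sum.elim t s) 0 (rankOneMatrix (Sum.elim f a)) ∧
        (∀ j, N.mass (s j) = (∑ l, ‖a l‖ ^ 2) / ω₀ ^ 2) ∧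
        (∀ v, v ∉ Set.range s → N.mass v = 0) := by
  classical
  have hxC : ∀ i, x i ∈ convexHull ℝ (Set.range x) := fun i => subset_convexHull ℝ _ ⟨i, rfl⟩
  have hxU : ∀ i, x i ∈ Metric.thickening ε (convexHull ℝ (Set.range x)) := fun i =>
    Metric.self_subset_thickening hε _ (hxC i)
  obtain ⟨p, a, B, hp, hpU, ha, hB, hplanar⟩ := exists_realizes_noncrossing hd (f := f) hx
    S.finite_toSet Metric.isOpen_thickening ((convex_convexHull ℝ (Set.range x)).thickening ε)
    ⟨_, hxU ⟨0, hn⟩⟩ hxU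
  -- Terminals and massive nodes are included separately because no bar need end at a point without
  -- force.
  set W : Set (EuclideanSpace ℝ (Fin d)) :=
    Set.range (Sum.elim x p) ∪ ⋃ e ∈ B, (e.toFinset : Set (EuclideanSpace ℝ (Fin d))) with hW
  have hWmem : ∀ z, z ∈ W ↔ z ∈ Set.range (Sum.elim x p) ∨ ∃ e ∈ B, z ∈ e := by
    intro z
    simp [hW]
  have hWfin : W.Finite := (Set.finite_range _).union
    (hB.finite.biUnion fun e _ => e.toFinset.finite_toSet)
  let _ : Fintype W := hWfin.fintype
  let t : Fin n → W := fun i => ⟨x i, (hWmem _).2 (Or.inl ⟨Sum.inl i, rfl⟩)⟩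
  let s : Fin 2 → W := fun j => ⟨p j, (hWmem _).2 (Or.inl ⟨Sum.inr j, rfl⟩)⟩
  have hts : (fun i => (Sum.elim t s i).1) = Sum.elim x p := by
    funext i
    rcases i with i | i <;> rfl
  have htsinj : Function.Injective (Sum.elim t s) := by
    refine Function.Injective.of_comp (f := Subtype.val) ?_
    rw [← hts] at hp
    exact hp
  have hg : Sum.elim f a ≠ 0 := fun h => ha <| funext fun j => congrFun h (Sum.inr j)
  obtain ⟨κ, hκ, h⟩ := exists_hasRankOneResponse_barNetwork (B := B) htsinj
    (fun e he z hz => (hWmem z).2 (Or.inr ⟨e, he, hz⟩)) hg (by rw [hts]; exact hB.supportable_inf)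
  have hm : 0 ≤ (∑ l, ‖a l‖ ^ 2) / ω₀ ^ 2 := by positivity
  replace h := h _ hm (Set.range p)
  have hms : ∀ j, (barNetwork W B hκ hm (Set.range p)).mass (s j) = (∑ l, ‖a l‖ ^ 2) / ω₀ ^ 2 :=
    fun j => if_pos ⟨j, rfl⟩
  have hm0 : ∀ v, v ∉ Set.range s → (barNetwork W B hκ hm (Set.range p)).mass v = 0 :=
    fun v hv => if_neg fun ⟨j, hj⟩ => hv ⟨j, Subtype.ext hj⟩
  have hres : ∀ ω : ℝ, ω ^ 2 ≠ ω₀ ^ 2 → (barNetwork W B hκ hm (Set.range p)).IsResponseAt t ω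
      ((ω ^ 2 / (ω ^ 2 - ω₀ ^ 2)) • rankOneMatrix f) := fun ω hω =>
    h.isResponseAt_of_ne htsinj hω₀ ha hms hm0 hω
  refine ⟨W, inferInstance, barNetwork W B hκ hm (Set.range p), t, fun i => rfl, fun h2 => ?_,
    fun v hv => ?_, hres, ?_, h.isResonance_iff htsinj hω₀ ha hms hm0, s, a, htsinj, ha,
    h.isResponseAt, hms, hm0⟩
  · exact nonCrossing_barNetwork hκ hm _ (hplanar h2).1 fun e he z hz =>
      (hplanar h2).2 e he z ((hWmem z).1 hz)
  · suffices v.1 ∈ Metric.thickening ε (convexHull ℝ (Set.range x)) ∧ v.1 ∉ (S : Set _) from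
      ⟨Metric.thickening_subset_cthickening _ _ this.1, fun hS => this.2 hS⟩
    by_cases hvX : v.1 ∈ Set.range (Sum.elim x p)
    · obtain ⟨i | j, hi⟩ := hvX
      · exact absurd ⟨i, Subtype.ext hi⟩ hv
      · rw [← hi]
        exact hpU j
    · obtain ⟨e, he, hve⟩ := ((hWmem v.1).1 v.2).resolve_left hvX
      exact ⟨hB.mem_region e he v.1 hve, hB.notMem_of_notMem e he v.1 hve hvX⟩
  · have := hres 0 (by simpa using (pow_ne_zero 2 hω₀).symm)
    simpa using this

end Main
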